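/- Let $\epsilon_1,\epsilon_2\in C^1([0,1])$ be positive, $c_1,c_2\in C([0,1])$ real-valued, and $q\in\mathbb R$, $q\neq 0$. Consider on $x\in[0,1]$, $t\ge 0$ the linear hyperbolic system $$u_t=-\epsilon_1(x)u_x+c_1(x)v,\qquad v_t=\epsilon_2(x)v_x+c_2(x)u,$$ with boundary conditions $u(0,t)=q\,v(0,t)$, $v(1,t)=U(t)$, where $w=(u,v)$ and $\|w\|_{L^2}=\big(\int_0^1(u^2+v^2)\,dx\big)^{1/2}$. On the triangle $\mathcal T=\{(x,\xi):0\le\xi\le x\le1\}$ consider the kernel equations $$\epsilon_1(x)K^{uu}_x+\epsilon_1(\xi)K^{uu}_\xi=-\epsilon_1'(\xi)K^{uu}-c_2(\xi)K^{uv},\qquad \epsilon_1(x)K^{uv}_x-\epsilon_2(\xi)K^{uv}_\xi=\epsilon_2'(\xi)K^{uv}-c_1(\xi)K^{uu},$$ $$\epsilon_2(x)K^{vu}_x-\epsilon_1(\xi)K^{vu}_\xi=\epsilon_1'(\xi)K^{vu}+c_2(\xi)K^{vv},\qquad \epsilon_2(x)K^{vv}_x+\epsilon_2(\xi)K^{vv}_\xi=-\epsilon_2'(\xi)K^{vv}+c_1(\xi)K^{vu},$$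 with $$K^{uu}(x,0)=\tfrac{\epsilon_2(0)}{q\,\epsilon_1(0)}K^{uv}(x,0),\quad K^{uv}(x,x)=\tfrac{c_1(x)}{\epsilon_1(x)+\epsilon_2(x)},\quad K^{vu}(x,x)=-\tfrac{c_2(x)}{\epsilon_1(x)+\epsilon_2(x)},\quad K^{vv}(x,0)=\tfrac{q\,\epsilon_1(0)}{\epsilon_2(0)}K^{vu}(x,0),$$ where the differential equations are understood along characteristics (for each equation $a(x)F_x+b(\xi)F_\xi=R$, along every curve $X'=a(X)$, $\Xi'=b(\Xi)$ in $\mathcal T$ the function $F(X,\Xi)$ is differentiable with derivative $R(X,\Xi)$). These equations have exactly one solution $K^{uu},K^{uv},K^{vu},K^{vv}$ in $C(\mathcal T)$. Close the loop with the control law $$U(t)=\int_0^1K^{vu}(1,\xi)u(\xi,t)\,d\xi+\int_0^1K^{vv}(1,\xi)v(\xi,t)\,d\xi .$$ A solution with initial datum $w_0=(u_0,v_0)\in L^2([0,1];\mathbb R^2)$ is a $w=(u,v)\in C([0,\infty);L^2([0,1];\mathbb R^2))$ with $w(0)=w_0$ such that, for all $\varphi,\psi\in C^1([0,1])$ with $\varphi(1)=0$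 and $\epsilon_2(0)\psi(0)=q\,\epsilon_1(0)\varphi(0)$, and all $t\ge0$, $$\int_0^1\!(u\varphi+v\psi)(x,t)\,dx=\int_0^1\!(u_0\varphi+v_0\psi)\,dx+\int_0^t\!\Big[\int_0^1\!\big(u\,((\epsilon_1\varphi)'+c_2\psi)+v\,(-(\epsilon_2\psi)'+c_1\varphi)\big)dx+\epsilon_2(1)\psi(1)U(s)\Big]ds .$$ Then for every $w_0\in L^2$ the closed-loop system has exactly one solution, and: 1. for every $\lambda>0$ there is $c>0$ (independent of $w_0$) such that every solution satisfies $\|w(\cdot,t)\|_{L^2}\le c\,e^{-\lambda t}\|w_0\|_{L^2}$ for all $t\ge0$; 2. every solution satisfies $w(\cdot,t)=0$ for all $t\ge t_F$, where $t_F=\int_0^1\big(\tfrac1{\epsilon_1(\xi)}+\tfrac1{\epsilon_2(\xi)}\big)d\xi$. -/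

import Mathlib

open MeasureTheory

/-- Coefficients of the `2 × 2` linear hyperbolic system
`u_t = -ε₁(x) u_x + c₁(x) v`, `v_t = ε₂(x) v_x + c₂(x) u` on `0 ≤ x ≤ 1`,
with boundary conditions `u(0,t) = q v(0,t)`, `v(1,t) = U(t)`.
Only the values of the functions on `[0,1]` matter. -/
structure HyperbolicPlant where
  ε₁ : ℝ → ℝ
  ε₂ : ℝ → ℝ
  c₁ : ℝ → ℝ
  c₂ : ℝ → ℝ
  q : ℝ

/-- The real Hilbert space `L²([0,1])`. -/
abbrev L2unit : Type := Lp ℝ 2 (volume.restrict (Set.Icc (0 : ℝ) 1))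

/-- The norm `‖(u,v)‖_{L²} = √(∫₀¹ (u² + v²))`. -/
noncomputable def stateNorm (u v : L2unit) : ℝ :=
  Real.sqrt (∫ x in Set.Icc (0 : ℝ) 1, ((u x) ^ 2 + (v x) ^ 2))

/-- The triangle `{(x,ξ) : 0 ≤ ξ ≤ x ≤ 1}`. -/
def kernelTriangle : Set (ℝ × ℝ) := {p | 0 ≤ p.2 ∧ p.2 ≤ p.1 ∧ p.1 ≤ 1}

/-- A matrix of kernels, as functions of `(x, ξ)`; only values on the triangle matter. -/
structure KernelMatrix where
  uu : ℝ → ℝ → ℝ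
  uv : ℝ → ℝ → ℝ
  vu : ℝ → ℝ → ℝ
  vv : ℝ → ℝ → ℝ

/-- `F` solves `a(x) F_x + b(ξ) F_ξ = R(x,ξ)` on the triangle in the sense of characteristics:
along every curve `X' = a(X)`, `Ξ' = b(Ξ)` that stays in the triangle, `F(X,Ξ)` is differentiable
with derivative `R(X,Ξ)`. (For a `C¹` function `F` this is the pointwise equation; it makes sense
for `F` that is merely continuous.) -/
def SolvesAlongCharacteristics (a b : ℝ → ℝ) (F R : ℝ → ℝ → ℝ) : Prop :=
  ∀ (s₀ s₁ : ℝ) (X Ξ : ℝ → ℝ),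
    (∀ s ∈ Set.Icc s₀ s₁,
      (X s, Ξ s) ∈ kernelTriangle ∧
      HasDerivWithinAt X (a (X s)) (Set.Icc s₀ s₁) s ∧
      HasDerivWithinAt Ξ (b (Ξ s)) (Set.Icc s₀ s₁) s) →
    ∀ s ∈ Set.Icc s₀ s₁,
      HasDerivWithinAt (fun r => F (X r) (Ξ r)) (R (X s) (Ξ s)) (Set.Icc s₀ s₁) s

namespace HyperbolicPlant

/-- `ε₁'` on `[0,1]` (one-sided at the end points). -/
noncomputable def dε₁ (P : HyperbolicPlant) (x : ℝ) : ℝ := derivWithin P.ε₁ (Set.Icc 0 1) x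

/-- `ε₂'` on `[0,1]` (one-sided at the end points). -/
noncomputable def dε₂ (P : HyperbolicPlant) (x : ℝ) : ℝ := derivWithin P.ε₂ (Set.Icc 0 1) x

/-- The backstepping kernel equations on the triangle, for continuous kernels. -/
structure IsBacksteppingKernel (P : HyperbolicPlant) (K : KernelMatrix) : Prop where
  cont_uu : ContinuousOn (fun p : ℝ × ℝ => K.uu p.1 p.2) kernelTriangle
  cont_uv : ContinuousOn (fun p : ℝ × ℝ => K.uv p.1 p.2) kernelTriangle
  cont_vu : ContinuousOn (fun p : ℝ × ℝ => K.vu p.1 p.2) kernelTriangle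
  cont_vv : ContinuousOn (fun p : ℝ × ℝ => K.vv p.1 p.2) kernelTriangle
  /-- `ε₁(x) K^{uu}_x + ε₁(ξ) K^{uu}_ξ = -ε₁'(ξ) K^{uu} - c₂(ξ) K^{uv}` -/
  eqn_uu : SolvesAlongCharacteristics P.ε₁ P.ε₁ K.uu
    (fun x ξ => -P.dε₁ ξ * K.uu x ξ - P.c₂ ξ * K.uv x ξ)
  /-- `ε₁(x) K^{uv}_x - ε₂(ξ) K^{uv}_ξ = ε₂'(ξ) K^{uv} - c₁(ξ) K^{uu}` -/
  eqn_uv : SolvesAlongCharacteristics P.ε₁ (fun ξ => -P.ε₂ ξ) K.uv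
    (fun x ξ => P.dε₂ ξ * K.uv x ξ - P.c₁ ξ * K.uu x ξ)
  /-- `ε₂(x) K^{vu}_x - ε₁(ξ) K^{vu}_ξ = ε₁'(ξ) K^{vu} + c₂(ξ) K^{vv}` -/
  eqn_vu : SolvesAlongCharacteristics P.ε₂ (fun ξ => -P.ε₁ ξ) K.vu
    (fun x ξ => P.dε₁ ξ * K.vu x ξ + P.c₂ ξ * K.vv x ξ)
  /-- `ε₂(x) K^{vv}_x + ε₂(ξ) K^{vv}_ξ = -ε₂'(ξ) K^{vv} + c₁(ξ) K^{vu}` -/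
  eqn_vv : SolvesAlongCharacteristics P.ε₂ P.ε₂ K.vv
    (fun x ξ => -P.dε₂ ξ * K.vv x ξ + P.c₁ ξ * K.vu x ξ)
  bc_uu : ∀ x ∈ Set.Icc (0 : ℝ) 1, K.uu x 0 = P.ε₂ 0 / (P.q * P.ε₁ 0) * K.uv x 0
  bc_uv : ∀ x ∈ Set.Icc (0 : ℝ) 1, K.uv x x = P.c₁ x / (P.ε₁ x + P.ε₂ x)
  bc_vu : ∀ x ∈ Set.Icc (0 : ℝ) 1, K.vu x x = -(P.c₂ x / (P.ε₁ x + P.ε₂ x))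
  bc_vv : ∀ x ∈ Set.Icc (0 : ℝ) 1, K.vv x 0 = P.q * P.ε₁ 0 / P.ε₂ 0 * K.vu x 0

/-- Weak solutions `(u,v) ∈ C([0,∞); L²)` of the system with boundary input `U` and initial
datum `(u₀,v₀)`: the equations are tested with `C¹` pairs `(φ,ψ)` that satisfy the adjoint boundary
conditions `φ(1) = 0`, `ε₂(0) ψ(0) = q ε₁(0) φ(0)`. (Integrating by parts, a smooth `(u,v)`
satisfies the identity for all such pairs iff it solves the equations with `u(0,t) = q v(0,t)` and
`v(1,t) = U(t)`.) -/
structure IsWeakSolution (P : HyperbolicPlant) (U : ℝ → ℝ) (u₀ v₀ : L2unit)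
    (u v : ℝ → L2unit) : Prop where
  cont_u : ContinuousOn u (Set.Ici 0)
  cont_v : ContinuousOn v (Set.Ici 0)
  init_u : u 0 = u₀
  init_v : v 0 = v₀
  weak : ∀ φ ψ : ℝ → ℝ,
    ContDiffOn ℝ 1 φ (Set.Icc 0 1) → ContDiffOn ℝ 1 ψ (Set.Icc 0 1) →
    φ 1 = 0 → P.ε₂ 0 * ψ 0 = P.q * P.ε₁ 0 * φ 0 →
    ∀ t : ℝ, 0 ≤ t →
      (∫ x in Set.Icc (0 : ℝ) 1, (u t x * φ x + v t x * ψ x)) =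
        (∫ x in Set.Icc (0 : ℝ) 1, (u₀ x * φ x + v₀ x * ψ x)) +
        ∫ s in (0 : ℝ)..t,
          ((∫ x in Set.Icc (0 : ℝ) 1,
              (u s x * (derivWithin (fun y => P.ε₁ y * φ y) (Set.Icc 0 1) x + P.c₂ x * ψ x) +
               v s x * (-derivWithin (fun y => P.ε₂ y * ψ y) (Set.Icc 0 1) x + P.c₁ x * φ x))) +
            P.ε₂ 1 * ψ 1 * U s)

/-- The full-state feedback `U = ∫₀¹ K^{vu}(1,ξ) u(ξ) dξ + ∫₀¹ K^{vv}(1,ξ) v(ξ) dξ`. -/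
noncomputable def feedback (K : KernelMatrix) (u v : L2unit) : ℝ :=
  (∫ ξ in Set.Icc (0 : ℝ) 1, K.vu 1 ξ * u ξ) + ∫ ξ in Set.Icc (0 : ℝ) 1, K.vv 1 ξ * v ξ

/-- Weak solutions of the closed-loop system. -/
def IsClosedLoopSolution (P : HyperbolicPlant) (K : KernelMatrix) (u₀ v₀ : L2unit)
    (u v : ℝ → L2unit) : Prop :=
  P.IsWeakSolution (fun t => feedback K (u t) (v t)) u₀ v₀ u v

/-- `t_F = ∫₀¹ (1/ε₁ + 1/ε₂)`. -/
noncomputable def finalTime (P : HyperbolicPlant) : ℝ :=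
  ∫ ξ in (0 : ℝ)..1, (1 / P.ε₁ ξ + 1 / P.ε₂ ξ)

end HyperbolicPlant

/-! The Volterra transformation `backOp`, the identity minus the integral operators with the
backstepping kernels, turns the closed loop into the target system α_t = -ε₁ α_x, β_t = ε₂ β_x, α(0)
= q β(0), β(1) = 0. Nothing enters this system at x = 1: β is carried to x = 0, reflected there into
α, and leaves at x = 1, all within the time t_F. Since `backOp` is boundedly invertible on L²,
well-posedness, a uniform bound and extinction at t_F pass back to the closed loop (`closedLoop`). A
uniformly bounded system that is at rest from a fixed time on decays at every exponential rate
(`decay_of_bound`).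

Kernels. The four equations split into two Goursat problems of the same form
(`isBacksteppingKernel_iff`). Parametrised by travel time along characteristics, such a problem is a
pair of integral equations (`isGoursat_iff`), and these are a contraction in an exponentially
weighted sup norm (`exists_isGoursat_unique`).

Transformation. Neither the solutions nor the kernels are differentiable in the classical sense, so
the computation is done on test functions, with the adjoint transformation `adjOp`. A kernel with a
derivative only along characteristics still gives differentiable Volterra integrals, because in
characteristic coordinates only the derivative along characteristics enters
(`hasDerivWithinAt_volterra`). Hence `adjOp` intertwines the adjoint generators of the target system
and of the closed loop (`hasDerivWithinAt_adjFst`, `hasDerivWithinAt_adjSnd`) and carries one domain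
exactly onto the other (`exists_isTestPair`, `IsTestPair.exists_source`). The adjoint target
generator has a bounded inverse, `plantSource`, whose adjoint is N = `plantTarget`. The weak
formulation therefore becomes the equation N (z(t) - z(0)) = ∫₀ᵗ z for z = `backOp` w, in which only
bounded operators occur (`isClosedLoopSolution_iff`).

Target system. Uniqueness is an energy estimate for the time integral of a solution
(`IsTargetSolution.eq_zero`). For existence the reflection at x = 0 is unfolded: in travel-time
coordinates both components are windows onto one profile on the line that is translated with unit
speed, and the profile vanishes beyond t_F (`exists_isTargetSolution`). -/

namespace Backstepping

open Set Filter Topology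

/-! ### Clamping to the unit interval and to the triangle -/

/-- The retraction of `ℝ` onto `[0,1]`. -/
def clamp (x : ℝ) : ℝ := max 0 (min 1 x)

lemma clamp_mem (x : ℝ) : clamp x ∈ Icc (0 : ℝ) 1 :=
  ⟨le_max_left _ _, max_le zero_le_one (min_le_left _ _)⟩

lemma clamp_of_mem {x : ℝ} (hx : x ∈ Icc (0 : ℝ) 1) : clamp x = x := by
  simp [clamp, hx.1, hx.2]

@[fun_prop]
lemma continuous_clamp : Continuous clamp := by unfold clamp; fun_prop

lemma continuous_comp_clamp {f : ℝ → ℝ} (hf : ContinuousOn f (Icc 0 1)) :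
    Continuous fun x => f (clamp x) :=
  hf.comp_continuous continuous_clamp clamp_mem

/-- A retraction of the plane onto `kernelTriangle`. -/
def triRetract (p : ℝ × ℝ) : ℝ × ℝ := (clamp p.1, max 0 (min (clamp p.1) p.2))

lemma triRetract_mem (p : ℝ × ℝ) : triRetract p ∈ kernelTriangle :=
  ⟨le_max_left _ _, max_le (clamp_mem _).1 (min_le_left _ _), (clamp_mem _).2⟩

lemma triRetract_of_mem {p : ℝ × ℝ} (hp : p ∈ kernelTriangle) : triRetract p = p := by
  obtain ⟨h1, h2, h3⟩ := hp
  have : clamp p.1 = p.1 := clamp_of_mem ⟨h1.trans h2, h3⟩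
  simp [triRetract, this, h1, h2]

@[fun_prop]
lemma continuous_triRetract : Continuous triRetract := by unfold triRetract; fun_prop

lemma isCompact_kernelTriangle : IsCompact kernelTriangle := by
  have : kernelTriangle = triRetract '' (Icc (0 : ℝ) 1 ×ˢ Icc (0 : ℝ) 1) := by
    ext p
    constructor
    · intro hp
      exact ⟨p, ⟨⟨hp.1.trans hp.2.1, hp.2.2⟩, ⟨hp.1, hp.2.1.trans hp.2.2⟩⟩, triRetract_of_mem hp⟩
    · rintro ⟨p, -, rfl⟩
      exact triRetract_mem p
  rw [this]
  exact (isCompact_Icc.prod isCompact_Icc).image continuous_triRetract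

lemma continuous_comp_triRetract {F : ℝ → ℝ → ℝ}
    (hF : ContinuousOn (fun p : ℝ × ℝ => F p.1 p.2) kernelTriangle) :
    Continuous fun p => F (triRetract p).1 (triRetract p).2 :=
  hF.comp_continuous continuous_triRetract triRetract_mem

lemma mem_fst {x ξ : ℝ} (h : (x, ξ) ∈ kernelTriangle) : x ∈ Icc (0 : ℝ) 1 :=
  ⟨h.1.trans h.2.1, h.2.2⟩

lemma mem_snd {x ξ : ℝ} (h : (x, ξ) ∈ kernelTriangle) : ξ ∈ Icc (0 : ℝ) 1 :=
  ⟨h.1, h.2.1.trans h.2.2⟩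

lemma mem_diag {x : ℝ} (h : x ∈ Icc (0 : ℝ) 1) : (x, x) ∈ kernelTriangle :=
  ⟨h.1, le_rfl, h.2⟩

lemma mem_bottom {x : ℝ} (h : x ∈ Icc (0 : ℝ) 1) : (x, (0 : ℝ)) ∈ kernelTriangle :=
  ⟨le_rfl, h.1, h.2⟩

/-! ### Travel times -/

/-- A continuous speed on the line, bounded and bounded away from zero. -/
structure IsSpeed (e : ℝ → ℝ) : Prop where
  cont : Continuous e
  bdd : ∃ m M : ℝ, 0 < m ∧ ∀ x, m ≤ e x ∧ e x ≤ M

/-- The time needed to travel from `0` to `x` with speed `e`. -/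
noncomputable def travel (e : ℝ → ℝ) (x : ℝ) : ℝ := ∫ t in (0 : ℝ)..x, (e t)⁻¹

/-- The position reached at a given time when travelling from `0` with speed `e`. -/
noncomputable def position (e : ℝ → ℝ) : ℝ → ℝ := Function.invFun (travel e)

lemma isSpeed_clamp {f : ℝ → ℝ} (hf : ContinuousOn f (Icc 0 1)) (hpos : ∀ x ∈ Icc (0 : ℝ) 1, 0 < f x) :
    IsSpeed fun x => f (clamp x) := by
  refine ⟨continuous_comp_clamp hf, ?_⟩
  obtain ⟨a, ha, hma⟩ := isCompact_Icc.exists_isMinOn ⟨0, by simp⟩ hf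
  obtain ⟨b, -, hmb⟩ := isCompact_Icc.exists_isMaxOn ⟨0, by simp⟩ hf
  exact ⟨f a, f b, hpos a ha, fun x => ⟨hma (clamp_mem x), hmb (clamp_mem x)⟩⟩

namespace IsSpeed

variable {e : ℝ → ℝ}

lemma pos (he : IsSpeed e) (x : ℝ) : 0 < e x := by
  obtain ⟨m, M, hm, h⟩ := he.bdd
  exact hm.trans_le (h x).1

lemma continuous_inv (he : IsSpeed e) : Continuous fun x => (e x)⁻¹ :=
  he.cont.inv₀ fun x => (he.pos x).ne'

lemma hasDerivAt_travel (he : IsSpeed e) (x : ℝ) : HasDerivAt (travel e) (e x)⁻¹ x :=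
  (he.continuous_inv.integral_hasStrictDerivAt 0 x).hasDerivAt

@[fun_prop]
lemma continuous_travel (he : IsSpeed e) : Continuous (travel e) :=
  continuous_iff_continuousAt.2 fun x => (he.hasDerivAt_travel x).continuousAt

lemma strictMono_travel (he : IsSpeed e) : StrictMono (travel e) :=
  strictMono_of_hasDerivAt_pos he.hasDerivAt_travel fun x => inv_pos.2 (he.pos x)

/-- An upper bound M for the speed makes `travel e x - x / M` monotone, so travel times are
unbounded in both directions. -/
lemma surjective_travel (he : IsSpeed e) : Function.Surjective (travel e) := by
  obtain ⟨m, M, hm, h⟩ := he.bdd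
  have hM : 0 < M := hm.trans_le ((h 0).1.trans (h 0).2)
  have key : Monotone fun x => travel e x - M⁻¹ * x := by
    refine monotone_of_deriv_nonneg
      (fun x => ((he.hasDerivAt_travel x).sub ((hasDerivAt_id x).const_mul _)).differentiableAt)
      fun x => ?_
    have h1 := ((he.hasDerivAt_travel x).sub ((hasDerivAt_id x).const_mul M⁻¹)).deriv
    have h2 : M⁻¹ ≤ (e x)⁻¹ := inv_anti₀ (he.pos x) (h x).2
    change 0 ≤ deriv (travel e - fun y => M⁻¹ * id y) x
    rw [h1]
    simpa using h2
  have h0 : travel e 0 = 0 := by simp [travel]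
  have htop : Tendsto (travel e) atTop atTop := by
    refine tendsto_atTop_mono' _ ?_ (tendsto_id.const_mul_atTop (inv_pos.2 hM))
    filter_upwards [eventually_ge_atTop 0] with x hx
    have := key hx
    simp [h0] at this
    simpa using this
  have hbot : Tendsto (travel e) atBot atBot := by
    refine tendsto_atBot_mono' _ ?_ (tendsto_id.const_mul_atBot (inv_pos.2 hM))
    filter_upwards [eventually_le_atBot 0] with x hx
    have := key hx
    simp [h0] at this
    simpa using this
  exact he.continuous_travel.surjective htop hbot

@[simp]
lemma travel_zero : travel e 0 = 0 := by simp [travel]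

lemma position_travel (he : IsSpeed e) (x : ℝ) : position e (travel e x) = x :=
  Function.leftInverse_invFun he.strictMono_travel.injective x

lemma travel_position (he : IsSpeed e) (x : ℝ) : travel e (position e x) = x :=
  Function.rightInverse_invFun he.surjective_travel x

lemma position_zero (he : IsSpeed e) : position e 0 = 0 := by
  simpa using he.position_travel 0

lemma strictMono_position (he : IsSpeed e) : StrictMono (position e) := fun x y hxy => by
  rw [← he.strictMono_travel.lt_iff_lt]
  simpa [he.travel_position] using hxy

@[fun_prop]
lemma continuous_position (he : IsSpeed e) : Continuous (position e) :=
  he.strictMono_position.monotone.continuous_of_surjective fun x => ⟨travel e x, he.position_travel x⟩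

lemma hasDerivAt_position (he : IsSpeed e) (y : ℝ) :
    HasDerivAt (position e) (e (position e y)) y := by
  have := HasDerivAt.of_local_left_inverse he.continuous_position.continuousAt
    (he.hasDerivAt_travel (position e y)) (inv_ne_zero (he.pos _).ne')
    (Eventually.of_forall he.travel_position)
  simpa using this

lemma travel_le_iff (he : IsSpeed e) {x y : ℝ} : travel e x ≤ y ↔ x ≤ position e y := by
  rw [← he.strictMono_position.le_iff_le, he.position_travel]

lemma le_travel_iff (he : IsSpeed e) {x y : ℝ} : y ≤ travel e x ↔ position e y ≤ x := by
  rw [← he.strictMono_position.le_iff_le, he.position_travel]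

lemma lipschitz_travel (he : IsSpeed e) : ∃ K, LipschitzWith K (travel e) := by
  obtain ⟨m, M, hm, h⟩ := he.bdd
  refine ⟨(m⁻¹).toNNReal, lipschitzWith_of_nnnorm_deriv_le
    (fun x => (he.hasDerivAt_travel x).differentiableAt) fun x => ?_⟩
  rw [(he.hasDerivAt_travel x).deriv, ← NNReal.coe_le_coe, coe_nnnorm, Real.norm_eq_abs,
    abs_of_pos (inv_pos.2 (he.pos x)), Real.coe_toNNReal _ (inv_pos.2 hm).le]
  exact inv_anti₀ hm (h x).1

lemma lipschitz_position (he : IsSpeed e) : ∃ K, LipschitzWith K (position e) := by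
  obtain ⟨m, M, hm, h⟩ := he.bdd
  refine ⟨M.toNNReal, lipschitzWith_of_nnnorm_deriv_le
    (fun x => (he.hasDerivAt_position x).differentiableAt) fun x => ?_⟩
  rw [(he.hasDerivAt_position x).deriv, ← NNReal.coe_le_coe, coe_nnnorm, Real.norm_eq_abs,
    abs_of_pos (he.pos _), Real.coe_toNNReal _ (hm.le.trans ((h 0).1.trans (h 0).2))]
  exact (h _).2

/-- The speed whose travel time is the sum of two travel times. -/
lemma harmonic {a b : ℝ → ℝ} (ha : IsSpeed a) (hb : IsSpeed b) :
    IsSpeed fun x => ((a x)⁻¹ + (b x)⁻¹)⁻¹ := by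
  obtain ⟨m, M, hm, h⟩ := ha.bdd
  obtain ⟨m', M', hm', h'⟩ := hb.bdd
  have hM : 0 < M := hm.trans_le ((h 0).1.trans (h 0).2)
  have hM' : 0 < M' := hm'.trans_le ((h' 0).1.trans (h' 0).2)
  refine ⟨(ha.continuous_inv.add hb.continuous_inv).inv₀ fun x =>
    (add_pos (inv_pos.2 (ha.pos x)) (inv_pos.2 (hb.pos x))).ne',
    (m⁻¹ + m'⁻¹)⁻¹, (M⁻¹ + M'⁻¹)⁻¹, by positivity, fun x => ⟨?_, ?_⟩⟩
  · have := ha.pos x; have := hb.pos x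
    exact inv_anti₀ (by positivity) (add_le_add (inv_anti₀ hm (h x).1) (inv_anti₀ hm' (h' x).1))
  · exact inv_anti₀ (by positivity)
      (add_le_add (inv_anti₀ (ha.pos x) (h x).2) (inv_anti₀ (hb.pos x) (h' x).2))

lemma travel_harmonic {a b : ℝ → ℝ} (ha : IsSpeed a) (hb : IsSpeed b) (x : ℝ) :
    travel (fun x => ((a x)⁻¹ + (b x)⁻¹)⁻¹) x = travel a x + travel b x := by
  simp only [travel, inv_inv]
  exact intervalIntegral.integral_add (ha.continuous_inv.intervalIntegrable _ _)
    (hb.continuous_inv.intervalIntegrable _ _)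

end IsSpeed

/-! ### The Leibniz rule with moving end points -/

/-- The Leibniz rule for `∫_{α(η)}^{β(η)} f(z,η) dz`. -/
lemma hasDerivAt_integral_moving {f f' : ℝ → ℝ → ℝ} (hf : Continuous f.uncurry)
    (hf' : Continuous f'.uncurry) (hff' : ∀ z η, HasDerivAt (f z) (f' z η) η)
    {α β : ℝ → ℝ} {α' β' η : ℝ} (hα : HasDerivAt α α' η) (hβ : HasDerivAt β β' η) :
    HasDerivAt (fun η => ∫ z in (α η)..(β η), f z η)
      (β' * f (β η) η - α' * f (α η) η + ∫ z in (α η)..(β η), f' z η) η := by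
  have hswap : Continuous fun p : ℝ × ℝ => f p.2 p.1 := hf.comp continuous_swap
  have hswap' : Continuous fun p : ℝ × ℝ => f' p.2 p.1 := hf'.comp continuous_swap
  have hfz : ∀ η, Continuous fun z => f z η := fun η => hf.comp (by fun_prop : Continuous fun z => (z, η))
  have hfz' : ∀ η, Continuous fun z => f' z η := fun η => hf'.comp (by fun_prop : Continuous fun z => (z, η))
  -- It is enough to move the upper limit. `Φ` has continuous partial derivatives, hence is jointly
  -- differentiable, and the chain rule along η ↦ (γ η, η) gives each of the two end point
  -- contributions.
  let Φ : ℝ → ℝ → ℝ := fun b η => ∫ z in (0 : ℝ)..b, f z η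
  have d1 : ∀ b η, HasDerivAt (fun b => Φ b η) (f b η) b := fun b η =>
    ((hfz η).integral_hasStrictDerivAt 0 b).hasDerivAt
  have d2 : ∀ b η, HasDerivAt (fun η => Φ b η) (∫ z in (0 : ℝ)..b, f' z η) η := by
    intro b η
    obtain ⟨C, hC⟩ := (isCompact_uIcc (a := (0:ℝ)) (b := b)).prod (isCompact_closedBall η 1)
      |>.exists_bound_of_continuousOn hf'.continuousOn
    refine (intervalIntegral.hasDerivAt_integral_of_dominated_loc_of_deriv_le
      (bound := fun _ => C) (s := Metric.ball η 1) (F' := fun η z => f' z η)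
      (Metric.ball_mem_nhds _ one_pos) ?_
      ((hfz η).intervalIntegrable _ _) (hfz' η).aestronglyMeasurable ?_ (by simp) ?_).2
    · exact Eventually.of_forall fun η => (hfz η).aestronglyMeasurable
    · refine Eventually.of_forall fun z hz y hy => ?_
      exact hC (z, y) ⟨uIoc_subset_uIcc hz, Metric.ball_subset_closedBall hy⟩
    · exact Eventually.of_forall fun z _ y _ => hff' z y
  have c2 : Continuous fun p : ℝ × ℝ => ∫ z in (0 : ℝ)..p.1, f' z p.2 :=
    intervalIntegral.continuous_parametric_intervalIntegral_of_continuous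
      (f := fun (p : ℝ × ℝ) z => f' z p.2)
      (hf'.comp (by fun_prop : Continuous fun q : (ℝ × ℝ) × ℝ => (q.2, q.1.2))) continuous_fst
  have key : ∀ b η, HasFDerivAt (fun p : ℝ × ℝ => Φ p.1 p.2)
      ((ContinuousLinearMap.toSpanSingleton ℝ (f b η)).coprod
        (ContinuousLinearMap.toSpanSingleton ℝ (∫ z in (0 : ℝ)..b, f' z η))) (b, η) := by
    intro b η
    refine (hasStrictFDerivAt_uncurry_coprod (u := (b, η)) (f := Φ)
      (f₁ := fun b η => ContinuousLinearMap.toSpanSingleton ℝ (f b η))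
      (f₂ := fun b η => ContinuousLinearMap.toSpanSingleton ℝ (∫ z in (0 : ℝ)..b, f' z η))
      ?_ ?_ ?_ ?_).hasFDerivAt
    · exact Eventually.of_forall fun v => (d1 v.1 v.2).hasFDerivAt
    · exact Eventually.of_forall fun v => (d2 v.1 v.2).hasFDerivAt
    · exact ((ContinuousLinearMap.toSpanSingletonCLE (𝕜 := ℝ) (E := ℝ)).continuous.comp
        hf).continuousAt
    · exact ((ContinuousLinearMap.toSpanSingletonCLE (𝕜 := ℝ) (E := ℝ)).continuous.comp
        c2).continuousAt
  have comp : ∀ {γ : ℝ → ℝ} {γ' : ℝ}, HasDerivAt γ γ' η →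
      HasDerivAt (fun η => Φ (γ η) η) (γ' * f (γ η) η + ∫ z in (0 : ℝ)..(γ η), f' z η) η := by
    intro γ γ' hγ
    have := HasFDerivAt.comp_hasDerivAt (f := fun η => (γ η, η)) η (key (γ η) η)
      (hγ.prodMk (hasDerivAt_id η))
    simpa [Function.comp_def] using this
  have hsub := (comp hβ).sub (comp hα)
  have e1 : ∀ η, Φ (β η) η - Φ (α η) η = ∫ z in (α η)..(β η), f z η := fun η =>
    intervalIntegral.integral_interval_sub_left ((hfz η).intervalIntegrable _ _)
      ((hfz η).intervalIntegrable _ _)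
  have e2 := intervalIntegral.integral_interval_sub_left (μ := volume)
    ((hfz' η).intervalIntegrable 0 (β η)) ((hfz' η).intervalIntegrable 0 (α η))
  refine (hsub.congr_of_eventuallyEq
    (Eventually.of_forall fun η => (e1 η).symm)).congr_deriv ?_
  rw [← e2]; ring

/-! ### Characteristics -/

/-- The point with `a`-travel time `r` on the characteristic of `(a, ςb)` with label `z`. -/
noncomputable def charPoint (a b : ℝ → ℝ) (ς z r : ℝ) : ℝ × ℝ :=
  (position a r, position b (ς * (r - z)))

/-- The label of the characteristic of `(a, ςb)` through `(x, ξ)`. -/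
noncomputable def charLabel (a b : ℝ → ℝ) (ς x ξ : ℝ) : ℝ := travel a x - ς * travel b ξ

section Characteristics

variable {a b : ℝ → ℝ} {ς : ℝ}

lemma charPoint_charLabel (ha : IsSpeed a) (hb : IsSpeed b) (hς : ς * ς = 1) (x ξ : ℝ) :
    charPoint a b ς (charLabel a b ς x ξ) (travel a x) = (x, ξ) := by
  have : ς * (travel a x - charLabel a b ς x ξ) = travel b ξ := by
    rw [charLabel, sub_sub_cancel, ← mul_assoc, hς, one_mul]
  rw [charPoint, this, ha.position_travel, hb.position_travel]

lemma continuous_charPoint (ha : IsSpeed a) (hb : IsSpeed b) :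
    Continuous fun p : ℝ × ℝ => charPoint a b ς p.1 p.2 :=
  (ha.continuous_position.comp continuous_snd).prodMk
    (hb.continuous_position.comp (by fun_prop))

lemma continuous_charLabel (ha : IsSpeed a) (hb : IsSpeed b) :
    Continuous fun p : ℝ × ℝ => charLabel a b ς p.1 p.2 :=
  (ha.continuous_travel.comp continuous_fst).sub
    (continuous_const.mul (hb.continuous_travel.comp continuous_snd))

variable {A B : ℝ → ℝ} {K R : ℝ → ℝ → ℝ} {Rt : ℝ × ℝ → ℝ}

/-- `charPoint a b ς z` is itself a characteristic curve, parametrised by the travel time of its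
first coordinate, so the fundamental theorem of calculus applies along it. -/
lemma SolvesAlongCharacteristics.eq_add_integral (ha : IsSpeed a) (hb : IsSpeed b)
    (hA : ∀ x ∈ Icc (0 : ℝ) 1, A x = a x) (hB : ∀ x ∈ Icc (0 : ℝ) 1, B x = ς * b x)
    (hRt : Continuous Rt) (hR : ∀ x ξ, (x, ξ) ∈ kernelTriangle → R x ξ = Rt (x, ξ))
    (hS : SolvesAlongCharacteristics A B K R) {z r₀ r₁ : ℝ} (h01 : r₀ ≤ r₁)
    (hT : ∀ r ∈ Icc r₀ r₁, charPoint a b ς z r ∈ kernelTriangle) :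
    K (charPoint a b ς z r₁).1 (charPoint a b ς z r₁).2 =
      K (charPoint a b ς z r₀).1 (charPoint a b ς z r₀).2 +
        ∫ r in r₀..r₁, Rt (charPoint a b ς z r) := by
  have hd := hS r₀ r₁ (fun r => (charPoint a b ς z r).1) (fun r => (charPoint a b ς z r).2) ?_
  · have hcont := (hRt.comp (continuous_charPoint (ς := ς) ha hb)).comp
      (by fun_prop : Continuous fun r : ℝ => (z, r))
    have := intervalIntegral.integral_eq_sub_of_hasDerivAt_of_le h01
      (fun r hr => (hd r hr).continuousWithinAt)
      (fun r hr => ((hd r (Ioo_subset_Icc_self hr)).hasDerivAt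
        (Icc_mem_nhds hr.1 hr.2)).congr_deriv (hR _ _ (hT r (Ioo_subset_Icc_self hr))))
      (hcont.intervalIntegrable _ _)
    simp only [Prod.mk.eta] at this
    rw [this]; ring
  · intro s hs
    refine ⟨hT s hs, ?_, ?_⟩
    · rw [show A (charPoint a b ς z s).1 = a (position a s) from hA _ (mem_fst (hT s hs))]
      exact (ha.hasDerivAt_position s).hasDerivWithinAt
    · rw [show B (charPoint a b ς z s).2 = ς * b (position b (ς * (s - z))) from
        hB _ (mem_snd (hT s hs))]
      have h1 : HasDerivAt (fun r => ς * (r - z)) ς s := by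
        simpa using ((hasDerivAt_id s).sub_const z).const_mul ς
      have := (hb.hasDerivAt_position (ς * (s - z))).comp s h1
      rw [mul_comm] at this
      exact this.hasDerivWithinAt

/-- Along an arbitrary characteristic curve the label is constant and the travel time of the first
coordinate grows at unit rate. The integral formula then depends on the curve parameter only through
its upper limit. -/
lemma solvesAlongCharacteristics_of_eq (ha : IsSpeed a) (hb : IsSpeed b) (hς : ς * ς = 1)
    (hA : ∀ x ∈ Icc (0 : ℝ) 1, A x = a x) (hB : ∀ x ∈ Icc (0 : ℝ) 1, B x = ς * b x)
    (hRt : Continuous Rt) (hR : ∀ x ξ, (x, ξ) ∈ kernelTriangle → R x ξ = Rt (x, ξ))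
    {base r₀ : ℝ → ℝ} (hK : ∀ x ξ, (x, ξ) ∈ kernelTriangle →
      K x ξ = base (charLabel a b ς x ξ) + ∫ r in (r₀ (charLabel a b ς x ξ))..(travel a x),
        Rt (charPoint a b ς (charLabel a b ς x ξ) r)) :
    SolvesAlongCharacteristics A B K R := by
  intro s₀ s₁ X Ξ hX s hs
  have dX : ∀ r ∈ Icc s₀ s₁, HasDerivWithinAt (fun r => travel a (X r)) 1 (Icc s₀ s₁) r := by
    intro r hr
    obtain ⟨hT, h1, -⟩ := hX r hr
    rw [hA _ (mem_fst hT)] at h1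
    refine ((ha.hasDerivAt_travel (X r)).comp_hasDerivWithinAt r h1).congr_deriv ?_
    exact inv_mul_cancel₀ (ha.pos _).ne'
  have dΞ : ∀ r ∈ Icc s₀ s₁, HasDerivWithinAt (fun r => travel b (Ξ r)) ς (Icc s₀ s₁) r := by
    intro r hr
    obtain ⟨hT, -, h1⟩ := hX r hr
    rw [hB _ (mem_snd hT)] at h1
    refine ((hb.hasDerivAt_travel (Ξ r)).comp_hasDerivWithinAt r h1).congr_deriv ?_
    have := (hb.pos (Ξ r)).ne'
    field_simp
  have hz : ∀ r ∈ Icc s₀ s₁, charLabel a b ς (X r) (Ξ r) = charLabel a b ς (X s) (Ξ s) := by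
    have hd : ∀ r ∈ Icc s₀ s₁,
        HasDerivWithinAt (fun r => charLabel a b ς (X r) (Ξ r)) 0 (Icc s₀ s₁) r := by
      intro r hr
      refine ((dX r hr).sub ((dΞ r hr).const_mul ς)).congr_deriv ?_
      rw [hς, sub_self]
    have h0 := constant_of_has_deriv_right_zero
      (fun r hr => (hd r hr).continuousWithinAt)
      (fun r hr => ((hd r (Ico_subset_Icc_self hr)).mono_of_mem_nhdsWithin
        (Icc_mem_nhdsGE_of_mem hr)))
    intro r hr
    rw [h0 r hr, h0 s hs]
  set z := charLabel a b ς (X s) (Ξ s) with hzdef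
  have hcont : Continuous fun r => Rt (charPoint a b ς z r) :=
    (hRt.comp (continuous_charPoint (ς := ς) ha hb)).comp
      (by fun_prop : Continuous fun r : ℝ => (z, r))
  have hmain : HasDerivWithinAt
      (fun r => base z + ∫ r in (r₀ z)..(travel a (X r)), Rt (charPoint a b ς z r))
      (R (X s) (Ξ s)) (Icc s₀ s₁) s := by
    have h1 := (hcont.integral_hasStrictDerivAt (r₀ z) (travel a (X s))).hasDerivAt
    have h2 := (h1.comp_hasDerivWithinAt s (dX s hs)).const_add (base z)
    refine h2.congr_deriv ?_
    rw [hR _ _ (hX s hs).1, mul_one, hzdef, charPoint_charLabel ha hb hς]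
  refine hmain.congr (fun r hr => ?_) ?_
  · rw [hK _ _ (hX r hr).1, hz r hr]
  · rw [hK _ _ (hX s hs).1]

end Characteristics

/-! ### The entry points of the characteristics -/

section Entry

variable {a b : ℝ → ℝ}

/-- Followed backwards, both coordinates decrease and keep their distance in travel time. The second
one reaches 0 exactly when the travel time equals the label, so these characteristics enter through
the bottom side. -/
lemma charPoint_one_mem (ha : IsSpeed a) {x ξ : ℝ} (h : (x, ξ) ∈ kernelTriangle) {r : ℝ}
    (hr : r ∈ Icc (charLabel a a 1 x ξ) (travel a x)) :
    charPoint a a 1 (charLabel a a 1 x ξ) r ∈ kernelTriangle := by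
  obtain ⟨h1, h2, h3⟩ := h
  simp only [charLabel, one_mul, mem_Icc] at hr
  have hm := ha.strictMono_travel.monotone h2
  have e1 : charPoint a a 1 (charLabel a a 1 x ξ) r =
      (position a r, position a (r - (travel a x - travel a ξ))) := by
    simp [charPoint, charLabel]
  rw [e1]
  refine ⟨?_, ha.strictMono_position.monotone (by linarith), ?_⟩
  · change 0 ≤ position a _
    rw [← ha.position_zero]
    exact ha.strictMono_position.monotone (by linarith [hr.1])
  · exact (ha.le_travel_iff.1 hr.2).trans h3

/-- The foot on the diagonal of the characteristic of `(a, -b)` with label `z`. -/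
noncomputable def diagFoot (a b : ℝ → ℝ) (z : ℝ) : ℝ :=
  position (fun x => ((a x)⁻¹ + (b x)⁻¹)⁻¹) z

lemma travel_diagFoot (ha : IsSpeed a) (hb : IsSpeed b) (z : ℝ) :
    travel a (diagFoot a b z) + travel b (diagFoot a b z) = z := by
  rw [← ha.travel_harmonic hb]
  exact (ha.harmonic hb).travel_position z

lemma diagFoot_add (ha : IsSpeed a) (hb : IsSpeed b) (x : ℝ) :
    diagFoot a b (travel a x + travel b x) = x := by
  rw [← ha.travel_harmonic hb]
  exact (ha.harmonic hb).position_travel x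

lemma continuous_diagFoot (ha : IsSpeed a) (hb : IsSpeed b) : Continuous (diagFoot a b) :=
  (ha.harmonic hb).continuous_position

lemma monotone_diagFoot (ha : IsSpeed a) (hb : IsSpeed b) : Monotone (diagFoot a b) :=
  (ha.harmonic hb).strictMono_position.monotone

lemma charLabel_neg_one (x ξ : ℝ) : charLabel a b (-1) x ξ = travel a x + travel b ξ := by
  simp [charLabel]

lemma diagFoot_le (ha : IsSpeed a) (hb : IsSpeed b) {x ξ : ℝ} (h : (x, ξ) ∈ kernelTriangle) :
    diagFoot a b (charLabel a b (-1) x ξ) ≤ x := by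
  rw [charLabel_neg_one]
  conv_rhs => rw [← diagFoot_add ha hb x]
  exact monotone_diagFoot ha hb (by linarith [hb.strictMono_travel.monotone h.2.1])

lemma le_diagFoot (ha : IsSpeed a) (hb : IsSpeed b) {x ξ : ℝ} (h : (x, ξ) ∈ kernelTriangle) :
    ξ ≤ diagFoot a b (charLabel a b (-1) x ξ) := by
  rw [charLabel_neg_one]
  conv_lhs => rw [← diagFoot_add ha hb ξ]
  exact monotone_diagFoot ha hb (by linarith [ha.strictMono_travel.monotone h.2.1])

lemma diagFoot_mem (ha : IsSpeed a) (hb : IsSpeed b) {x ξ : ℝ} (h : (x, ξ) ∈ kernelTriangle) :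
    diagFoot a b (charLabel a b (-1) x ξ) ∈ Icc (0 : ℝ) 1 :=
  ⟨h.1.trans (le_diagFoot ha hb h), (diagFoot_le ha hb h).trans h.2.2⟩

lemma charPoint_diagFoot (ha : IsSpeed a) (hb : IsSpeed b) (z : ℝ) :
    charPoint a b (-1) z (travel a (diagFoot a b z)) = (diagFoot a b z, diagFoot a b z) := by
  have h := travel_diagFoot ha hb z
  have : -1 * (travel a (diagFoot a b z) - z) = travel b (diagFoot a b z) := by linarith
  rw [charPoint, this, ha.position_travel, hb.position_travel]

/-- Followed backwards, the first coordinate decreases and the second increases until they meet at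
the foot on the diagonal. Between the foot and (x, ξ) their order is preserved. -/
lemma charPoint_neg_one_mem (ha : IsSpeed a) (hb : IsSpeed b) {x ξ : ℝ}
    (h : (x, ξ) ∈ kernelTriangle) {r : ℝ}
    (hr : r ∈ Icc (travel a (diagFoot a b (charLabel a b (-1) x ξ))) (travel a x)) :
    charPoint a b (-1) (charLabel a b (-1) x ξ) r ∈ kernelTriangle := by
  set z := charLabel a b (-1) x ξ with hz
  have hz' := travel_diagFoot ha hb z
  have h1 : position a r ≤ x := ha.le_travel_iff.1 hr.2
  have h2 : diagFoot a b z ≤ position a r := ha.travel_le_iff.1 hr.1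
  have hzz : z = travel a x + travel b ξ := charLabel_neg_one x ξ
  have h3 : ξ ≤ position b (-1 * (r - z)) := hb.travel_le_iff.1 (by linarith [hr.2])
  have h4 : position b (-1 * (r - z)) ≤ diagFoot a b z := hb.le_travel_iff.1 (by linarith [hr.1])
  exact ⟨h.1.trans h3, h4.trans h2, h1.trans h.2.2⟩

end Entry

/-! ### A Goursat problem on the triangle -/

/-- The `2 × 2` systems into which the kernel equations split. -/
structure IsGoursat (A B : ℝ → ℝ) (κ : ℝ) (D m₁₁ m₁₂ m₂₁ m₂₂ : ℝ → ℝ) (F G : ℝ → ℝ → ℝ) :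
    Prop where
  cont_fst : ContinuousOn (fun p : ℝ × ℝ => F p.1 p.2) kernelTriangle
  cont_snd : ContinuousOn (fun p : ℝ × ℝ => G p.1 p.2) kernelTriangle
  eqn_fst : SolvesAlongCharacteristics A A F (fun x ξ => m₁₁ ξ * F x ξ + m₁₂ ξ * G x ξ)
  eqn_snd : SolvesAlongCharacteristics A (fun ξ => -B ξ) G
    (fun x ξ => m₂₁ ξ * F x ξ + m₂₂ ξ * G x ξ)
  bc_fst : ∀ x ∈ Icc (0 : ℝ) 1, F x 0 = κ * G x 0
  bc_snd : ∀ x ∈ Icc (0 : ℝ) 1, G x x = D x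

/-- Integration of `R` along a characteristic of `(a, ςb)`, from travel time `r₀ z` on. -/
noncomputable def charIntegral (a b : ℝ → ℝ) (ς : ℝ) (r₀ : ℝ → ℝ) (R : ℝ × ℝ → ℝ) (p : ℝ × ℝ) : ℝ :=
  ∫ r in (r₀ (charLabel a b ς p.1 p.2))..(travel a p.1),
    R (charPoint a b ς (charLabel a b ς p.1 p.2) r)

/-! ### Continuity and weighted estimates for integrals along characteristics -/

section

variable {a b : ℝ → ℝ} {ς : ℝ} {r₀ : ℝ → ℝ} {R R' : ℝ × ℝ → ℝ}

lemma continuous_charPoint_right (ha : IsSpeed a) (hb : IsSpeed b) (z : ℝ) :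
    Continuous fun r => charPoint a b ς z r :=
  (continuous_charPoint ha hb).comp (by fun_prop : Continuous fun r : ℝ => (z, r))

lemma continuous_charIntegral (ha : IsSpeed a) (hb : IsSpeed b) (hr₀ : Continuous r₀)
    (hR : Continuous R) : Continuous (charIntegral a b ς r₀ R) := by
  have hlab := continuous_charLabel (ς := ς) ha hb
  have hf : Continuous (Function.uncurry fun (p : ℝ × ℝ) r =>
      R (charPoint a b ς (charLabel a b ς p.1 p.2) r)) :=
    hR.comp ((continuous_charPoint ha hb).comp
      ((hlab.comp continuous_fst).prodMk continuous_snd))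
  have h1 := intervalIntegral.continuous_parametric_intervalIntegral_of_continuous
    (a₀ := 0) (μ := volume) hf (s := fun p => travel a p.1)
    (ha.continuous_travel.comp continuous_fst)
  have h2 := intervalIntegral.continuous_parametric_intervalIntegral_of_continuous
    (a₀ := 0) (μ := volume) hf (s := fun p => r₀ (charLabel a b ς p.1 p.2)) (hr₀.comp hlab)
  refine (h1.sub h2).congr fun p => ?_
  have hc : Continuous fun r => R (charPoint a b ς (charLabel a b ς p.1 p.2) r) :=
    hR.comp (continuous_charPoint_right ha hb _)
  exact intervalIntegral.integral_interval_sub_left (hc.intervalIntegrable _ _)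
    (hc.intervalIntegrable _ _)

/-- The integration variable is the travel time that appears in the weight, so integrating the
weight gains a factor 1 / γ. A large γ thus makes every integral term a contraction. -/
lemma abs_charIntegral_sub_le (ha : IsSpeed a) (hb : IsSpeed b) (hR : Continuous R)
    (hR' : Continuous R') {C γ : ℝ} (hC : 0 ≤ C) (hγ : 0 < γ)
    (h : ∀ p : ℝ × ℝ, |R p - R' p| ≤ C * Real.exp (γ * travel a p.1)) {p : ℝ × ℝ}
    (hp : r₀ (charLabel a b ς p.1 p.2) ≤ travel a p.1) :
    |charIntegral a b ς r₀ R p - charIntegral a b ς r₀ R' p| ≤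
      C / γ * Real.exp (γ * travel a p.1) := by
  have hc : Continuous fun r => R (charPoint a b ς (charLabel a b ς p.1 p.2) r) :=
    hR.comp (continuous_charPoint_right ha hb _)
  have hc' : Continuous fun r => R' (charPoint a b ς (charLabel a b ς p.1 p.2) r) :=
    hR'.comp (continuous_charPoint_right ha hb _)
  simp only [charIntegral]
  rw [← intervalIntegral.integral_sub (hc.intervalIntegrable _ _) (hc'.intervalIntegrable _ _)]
  refine (intervalIntegral.abs_integral_le_integral_abs hp).trans ?_
  have hE : Continuous fun r => C * Real.exp (γ * r) := by fun_prop
  refine (intervalIntegral.integral_mono_on hp ((hc.sub hc').abs.intervalIntegrable _ _)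
    (hE.intervalIntegrable _ _) fun r _ => ?_).trans ?_
  · refine (h _).trans (le_of_eq ?_)
    simp [charPoint, ha.travel_position]
  · have hd : ∀ r, HasDerivAt (fun r => C / γ * Real.exp (γ * r)) (C * Real.exp (γ * r)) r := by
      intro r
      refine ((((hasDerivAt_id r).const_mul γ).exp).const_mul (C / γ)).congr_deriv ?_
      simp only [id, mul_one]
      field_simp
    rw [intervalIntegral.integral_eq_sub_of_hasDerivAt (fun r _ => hd r)
      (hE.intervalIntegrable _ _)]
    have : 0 ≤ C / γ * Real.exp (γ * r₀ (charLabel a b ς p.1 p.2)) := by positivity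
    linarith

end

/-- Extension of a continuous function on the triangle to the plane. -/
noncomputable def triExtend (f : C(kernelTriangle, ℝ)) (p : ℝ × ℝ) : ℝ :=
  f ⟨triRetract p, triRetract_mem p⟩

lemma continuous_triExtend (f : C(kernelTriangle, ℝ)) : Continuous (triExtend f) :=
  f.continuous.comp (continuous_triRetract.subtype_mk _)

lemma triExtend_of_mem (f : C(kernelTriangle, ℝ)) {p : ℝ × ℝ} (hp : p ∈ kernelTriangle) :
    triExtend f p = f ⟨p, hp⟩ := by
  simp only [triExtend, triRetract_of_mem hp]

instance : CompactSpace kernelTriangle := isCompact_iff_compactSpace.1 isCompact_kernelTriangle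

lemma abs_triExtend_sub_le (f g : C(kernelTriangle, ℝ)) (p : ℝ × ℝ) :
    |triExtend f p - triExtend g p| ≤ dist f g := by
  rw [← Real.dist_eq]
  exact ContinuousMap.dist_apply_le_dist (f := f) (g := g) _

/-- The right-hand side of an equation of the Goursat problem. -/
def goursatRhs (m m' : ℝ → ℝ) (F G : ℝ × ℝ → ℝ) (p : ℝ × ℝ) : ℝ := m p.2 * F p + m' p.2 * G p

/-- The first component of the Goursat problem as an integral equation. -/
noncomputable def goursatFst (a : ℝ → ℝ) (κ : ℝ) (m m' : ℝ → ℝ) (F G : ℝ × ℝ → ℝ) (p : ℝ × ℝ) : ℝ :=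
  κ * G (position a (charLabel a a 1 p.1 p.2), 0) +
    charIntegral a a 1 id (goursatRhs m m' F G) p

/-- The second component of the Goursat problem as an integral equation. -/
noncomputable def goursatSnd (a b D m m' : ℝ → ℝ) (F G : ℝ × ℝ → ℝ) (p : ℝ × ℝ) : ℝ :=
  D (diagFoot a b (charLabel a b (-1) p.1 p.2)) +
    charIntegral a b (-1) (fun z => travel a (diagFoot a b z)) (goursatRhs m m' F G) p

/-! ### The integral equations of the Goursat problem: continuity and Lipschitz bounds -/

section

variable {a b D m m' : ℝ → ℝ} {κ : ℝ} {F G F' G' : ℝ × ℝ → ℝ}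

lemma continuous_goursatRhs (hm : Continuous m) (hm' : Continuous m') (hF : Continuous F)
    (hG : Continuous G) : Continuous (goursatRhs m m' F G) :=
  ((hm.comp continuous_snd).mul hF).add ((hm'.comp continuous_snd).mul hG)

lemma continuous_goursatFst (ha : IsSpeed a) (hm : Continuous m) (hm' : Continuous m')
    (hF : Continuous F) (hG : Continuous G) : Continuous (goursatFst a κ m m' F G) :=
  (continuous_const.mul (hG.comp ((ha.continuous_position.comp
    (continuous_charLabel ha ha)).prodMk continuous_const))).add
    (continuous_charIntegral ha ha continuous_id (continuous_goursatRhs hm hm' hF hG))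

lemma continuous_goursatSnd (ha : IsSpeed a) (hb : IsSpeed b) (hD : Continuous D)
    (hm : Continuous m) (hm' : Continuous m') (hF : Continuous F) (hG : Continuous G) :
    Continuous (goursatSnd a b D m m' F G) :=
  (hD.comp ((continuous_diagFoot ha hb).comp (continuous_charLabel ha hb))).add
    (continuous_charIntegral ha hb (ha.continuous_travel.comp (continuous_diagFoot ha hb))
      (continuous_goursatRhs hm hm' hF hG))

lemma charLabel_one_le (ha : IsSpeed a) {x ξ : ℝ} (h : (x, ξ) ∈ kernelTriangle) :
    charLabel a a 1 x ξ ≤ travel a x := by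
  have := ha.strictMono_travel.monotone h.1
  simp only [charLabel, one_mul, IsSpeed.travel_zero] at this ⊢
  linarith

lemma travel_diagFoot_le (ha : IsSpeed a) (hb : IsSpeed b) {x ξ : ℝ}
    (h : (x, ξ) ∈ kernelTriangle) :
    travel a (diagFoot a b (charLabel a b (-1) x ξ)) ≤ travel a x :=
  ha.strictMono_travel.monotone (diagFoot_le ha hb h)

lemma abs_goursatRhs_sub_le {C A₀ d γ : ℝ} (hm : ∀ x, |m x| ≤ C) (hm' : ∀ x, |m' x| ≤ C)
    (hF : ∀ p : ℝ × ℝ, |F p - F' p| ≤ A₀ * d * Real.exp (γ * travel a p.1))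
    (hG : ∀ p : ℝ × ℝ, |G p - G' p| ≤ d * Real.exp (γ * travel a p.1)) (p : ℝ × ℝ) :
    |goursatRhs m m' F G p - goursatRhs m m' F' G' p| ≤
      C * (A₀ + 1) * d * Real.exp (γ * travel a p.1) := by
  have hC : 0 ≤ C := (abs_nonneg _).trans (hm 0)
  calc |goursatRhs m m' F G p - goursatRhs m m' F' G' p|
      = |m p.2 * (F p - F' p) + m' p.2 * (G p - G' p)| := by
        simp only [goursatRhs]; congr 1; ring
    _ ≤ |m p.2| * |F p - F' p| + |m' p.2| * |G p - G' p| := by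
        rw [← abs_mul, ← abs_mul]; exact abs_add_le _ _
    _ ≤ C * (A₀ * d * Real.exp (γ * travel a p.1)) + C * (d * Real.exp (γ * travel a p.1)) := by
        gcongr
        exacts [hm _, hF p, hm' _, hG p]
    _ = _ := by ring

/-- The boundary term is evaluated at an earlier travel time, so the weight there is no larger, but
it gains no factor 1 / γ and contributes |κ|. The larger weight `A₀` allowed on the first component
is there to absorb this contribution. -/
lemma abs_goursatFst_sub_le (ha : IsSpeed a) (hm : Continuous m) (hm' : Continuous m')
    (hFc : Continuous F) (hGc : Continuous G) (hFc' : Continuous F') (hGc' : Continuous G')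
    {C A₀ d γ : ℝ} (hmC : ∀ x, |m x| ≤ C) (hmC' : ∀ x, |m' x| ≤ C) (hA₀ : 0 ≤ A₀) (hd : 0 ≤ d)
    (hγ : 0 < γ) (hF : ∀ p : ℝ × ℝ, |F p - F' p| ≤ A₀ * d * Real.exp (γ * travel a p.1))
    (hG : ∀ p : ℝ × ℝ, |G p - G' p| ≤ d * Real.exp (γ * travel a p.1)) {p : ℝ × ℝ}
    (hp : p ∈ kernelTriangle) :
    |goursatFst a κ m m' F G p - goursatFst a κ m m' F' G' p| ≤
      (|κ| + C * (A₀ + 1) / γ) * d * Real.exp (γ * travel a p.1) := by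
  have hC : 0 ≤ C := (abs_nonneg _).trans (hmC 0)
  have h1 := abs_charIntegral_sub_le (ς := 1) (r₀ := id) (p := p) ha ha
    (continuous_goursatRhs hm hm' hFc hGc) (continuous_goursatRhs hm hm' hFc' hGc')
    (C := C * (A₀ + 1) * d) (by positivity) hγ (abs_goursatRhs_sub_le hmC hmC' hF hG)
    (charLabel_one_le ha hp)
  have h2 := hG (position a (charLabel a a 1 p.1 p.2), 0)
  have h3 : Real.exp (γ * travel a (position a (charLabel a a 1 p.1 p.2))) ≤
      Real.exp (γ * travel a p.1) := by
    rw [ha.travel_position]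
    have := charLabel_one_le ha hp
    gcongr
  calc |goursatFst a κ m m' F G p - goursatFst a κ m m' F' G' p|
      = |κ * (G (position a (charLabel a a 1 p.1 p.2), 0) -
          G' (position a (charLabel a a 1 p.1 p.2), 0)) +
          (charIntegral a a 1 id (goursatRhs m m' F G) p -
            charIntegral a a 1 id (goursatRhs m m' F' G') p)| := by
        simp only [goursatFst]; congr 1; ring
    _ ≤ |κ| * (d * Real.exp (γ * travel a p.1)) +
        C * (A₀ + 1) * d / γ * Real.exp (γ * travel a p.1) := by
        refine (abs_add_le _ _).trans (add_le_add ?_ h1)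
        rw [abs_mul]
        exact mul_le_mul_of_nonneg_left (h2.trans (mul_le_mul_of_nonneg_left h3 hd)) (abs_nonneg _)
    _ = _ := by ring

lemma abs_goursatSnd_sub_le (ha : IsSpeed a) (hb : IsSpeed b) (hm : Continuous m)
    (hm' : Continuous m') (hFc : Continuous F) (hGc : Continuous G) (hFc' : Continuous F')
    (hGc' : Continuous G') {C A₀ d γ : ℝ} (hmC : ∀ x, |m x| ≤ C) (hmC' : ∀ x, |m' x| ≤ C)
    (hA₀ : 0 ≤ A₀) (hd : 0 ≤ d) (hγ : 0 < γ)
    (hF : ∀ p : ℝ × ℝ, |F p - F' p| ≤ A₀ * d * Real.exp (γ * travel a p.1))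
    (hG : ∀ p : ℝ × ℝ, |G p - G' p| ≤ d * Real.exp (γ * travel a p.1)) {p : ℝ × ℝ}
    (hp : p ∈ kernelTriangle) :
    |goursatSnd a b D m m' F G p - goursatSnd a b D m m' F' G' p| ≤
      C * (A₀ + 1) / γ * d * Real.exp (γ * travel a p.1) := by
  have hC : 0 ≤ C := (abs_nonneg _).trans (hmC 0)
  have h1 := abs_charIntegral_sub_le (ς := -1) (p := p)
    (r₀ := fun z => travel a (diagFoot a b z)) ha hb
    (continuous_goursatRhs hm hm' hFc hGc) (continuous_goursatRhs hm hm' hFc' hGc')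
    (C := C * (A₀ + 1) * d) (by positivity) hγ (abs_goursatRhs_sub_le hmC hmC' hF hG)
    (travel_diagFoot_le ha hb hp)
  simp only [goursatSnd, add_sub_add_left_eq_sub]
  exact h1.trans (le_of_eq (by ring))

end

section

variable {A B D m₁₁ m₁₂ m₂₁ m₂₂ : ℝ → ℝ} {κ : ℝ}

/-- The Goursat problem is equivalent to a system of integral equations. -/
lemma isGoursat_iff (hA : ContinuousOn A (Icc 0 1)) (hB : ContinuousOn B (Icc 0 1))
    (hA0 : ∀ x ∈ Icc (0 : ℝ) 1, 0 < A x) (hB0 : ∀ x ∈ Icc (0 : ℝ) 1, 0 < B x)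
    (h₁₁ : ContinuousOn m₁₁ (Icc 0 1)) (h₁₂ : ContinuousOn m₁₂ (Icc 0 1))
    (h₂₁ : ContinuousOn m₂₁ (Icc 0 1)) (h₂₂ : ContinuousOn m₂₂ (Icc 0 1))
    {F G : ℝ → ℝ → ℝ} {Ft Gt : ℝ × ℝ → ℝ} (hFt : Continuous Ft) (hGt : Continuous Gt)
    (hF : ∀ x ξ, (x, ξ) ∈ kernelTriangle → F x ξ = Ft (x, ξ))
    (hG : ∀ x ξ, (x, ξ) ∈ kernelTriangle → G x ξ = Gt (x, ξ)) :
    IsGoursat A B κ D m₁₁ m₁₂ m₂₁ m₂₂ F G ↔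
      EqOn Ft (goursatFst (A ∘ clamp) κ (m₁₁ ∘ clamp) (m₁₂ ∘ clamp) Ft Gt) kernelTriangle ∧
      EqOn Gt (goursatSnd (A ∘ clamp) (B ∘ clamp) (D ∘ clamp) (m₂₁ ∘ clamp) (m₂₂ ∘ clamp) Ft Gt)
        kernelTriangle := by
  have ha : IsSpeed (A ∘ clamp) := isSpeed_clamp hA hA0
  have hb : IsSpeed (B ∘ clamp) := isSpeed_clamp hB hB0
  have eA : ∀ x ∈ Icc (0 : ℝ) 1, A x = (A ∘ clamp) x := fun x hx => by simp [clamp_of_mem hx]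
  have eA' : ∀ x ∈ Icc (0 : ℝ) 1, A x = 1 * (A ∘ clamp) x := fun x hx => by simp [clamp_of_mem hx]
  have eB : ∀ x ∈ Icc (0 : ℝ) 1, -B x = -1 * (B ∘ clamp) x := fun x hx => by simp [clamp_of_mem hx]
  have cR : Continuous (goursatRhs (m₁₁ ∘ clamp) (m₁₂ ∘ clamp) Ft Gt) :=
    continuous_goursatRhs (continuous_comp_clamp h₁₁) (continuous_comp_clamp h₁₂) hFt hGt
  have cR' : Continuous (goursatRhs (m₂₁ ∘ clamp) (m₂₂ ∘ clamp) Ft Gt) :=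
    continuous_goursatRhs (continuous_comp_clamp h₂₁) (continuous_comp_clamp h₂₂) hFt hGt
  have eR : ∀ x ξ, (x, ξ) ∈ kernelTriangle → m₁₁ ξ * F x ξ + m₁₂ ξ * G x ξ =
      goursatRhs (m₁₁ ∘ clamp) (m₁₂ ∘ clamp) Ft Gt (x, ξ) := fun x ξ h => by
    simp [goursatRhs, clamp_of_mem (mem_snd h), hF x ξ h, hG x ξ h]
  have eR' : ∀ x ξ, (x, ξ) ∈ kernelTriangle → m₂₁ ξ * F x ξ + m₂₂ ξ * G x ξ =
      goursatRhs (m₂₁ ∘ clamp) (m₂₂ ∘ clamp) Ft Gt (x, ξ) := fun x ξ h => by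
    simp [goursatRhs, clamp_of_mem (mem_snd h), hF x ξ h, hG x ξ h]
  constructor
  · intro h
    constructor
    · rintro ⟨x, ξ⟩ hx
      have hle := charLabel_one_le ha hx
      have h1 := SolvesAlongCharacteristics.eq_add_integral ha ha eA eA' cR eR h.eqn_fst hle
        fun r hr => charPoint_one_mem ha hx hr
      rw [charPoint_charLabel ha ha (by norm_num)] at h1
      have hmem := charPoint_one_mem ha hx ⟨le_rfl, hle⟩
      -- At travel time equal to its label the characteristic sits on the side ξ = 0, where the
      -- boundary condition expresses F through G.
      have e0 : charPoint (A ∘ clamp) (A ∘ clamp) 1 (charLabel (A ∘ clamp) (A ∘ clamp) 1 x ξ)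
          (charLabel (A ∘ clamp) (A ∘ clamp) 1 x ξ) =
          (position (A ∘ clamp) (charLabel (A ∘ clamp) (A ∘ clamp) 1 x ξ), 0) := by
        simp [charPoint, ha.position_zero]
      rw [e0] at h1 hmem
      rw [← hF x ξ hx, h1, h.bc_fst _ (mem_fst hmem), hG _ _ hmem]
      rfl
    · rintro ⟨x, ξ⟩ hx
      have hle := travel_diagFoot_le ha hb hx
      have h1 := SolvesAlongCharacteristics.eq_add_integral ha hb eA eB cR' eR' h.eqn_snd hle
        fun r hr => charPoint_neg_one_mem ha hb hx hr
      rw [charPoint_charLabel ha hb (by norm_num), charPoint_diagFoot ha hb] at h1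
      have hmem := diagFoot_mem ha hb hx
      rw [← hG x ξ hx, h1, h.bc_snd _ hmem]
      simp only [goursatSnd, Function.comp_apply, clamp_of_mem hmem]
      rfl
  · rintro ⟨h1, h2⟩
    refine ⟨hFt.continuousOn.congr fun p hp => hF _ _ hp, hGt.continuousOn.congr fun p hp => hG _ _ hp,
      ?_, ?_, ?_, ?_⟩
    · exact solvesAlongCharacteristics_of_eq ha ha (by norm_num) eA eA' cR eR
        (base := fun z => κ * Gt (position (A ∘ clamp) z, 0)) (r₀ := id)
        fun x ξ h => (hF x ξ h).trans (h1 h)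
    · exact solvesAlongCharacteristics_of_eq ha hb (by norm_num) eA eB cR' eR'
        (base := fun z => (D ∘ clamp) (diagFoot (A ∘ clamp) (B ∘ clamp) z))
        (r₀ := fun z => travel (A ∘ clamp) (diagFoot (A ∘ clamp) (B ∘ clamp) z))
        fun x ξ h => (hG x ξ h).trans (h2 h)
    · intro x hx
      have hb := mem_bottom hx
      rw [hF _ _ hb, hG _ _ hb, h1 hb]
      simp [goursatFst, charIntegral, charLabel, ha.position_travel]
    · intro x hx
      have hd := mem_diag hx
      rw [hG _ _ hd, h2 hd]
      simp [goursatSnd, charIntegral, charLabel_neg_one, diagFoot_add ha hb, clamp_of_mem hx]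

end

lemma exists_bound_comp_clamp {f : ℝ → ℝ} (hf : ContinuousOn f (Icc 0 1)) :
    ∃ C, ∀ x, |(f ∘ clamp) x| ≤ C := by
  obtain ⟨C, hC⟩ := isCompact_Icc.exists_bound_of_continuousOn hf
  exact ⟨C, fun x => hC _ (clamp_mem x)⟩

section

variable {A B D m₁₁ m₁₂ m₂₁ m₂₂ : ℝ → ℝ} {κ : ℝ}

/-- The Goursat problem has exactly one continuous solution. -/
theorem exists_isGoursat_unique (hA : ContinuousOn A (Icc 0 1)) (hB : ContinuousOn B (Icc 0 1))
    (hA0 : ∀ x ∈ Icc (0 : ℝ) 1, 0 < A x) (hB0 : ∀ x ∈ Icc (0 : ℝ) 1, 0 < B x)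
    (hD : ContinuousOn D (Icc 0 1))
    (h₁₁ : ContinuousOn m₁₁ (Icc 0 1)) (h₁₂ : ContinuousOn m₁₂ (Icc 0 1))
    (h₂₁ : ContinuousOn m₂₁ (Icc 0 1)) (h₂₂ : ContinuousOn m₂₂ (Icc 0 1)) :
    ∃ F G : ℝ → ℝ → ℝ, IsGoursat A B κ D m₁₁ m₁₂ m₂₁ m₂₂ F G ∧
      ∀ F' G', IsGoursat A B κ D m₁₁ m₁₂ m₂₁ m₂₂ F' G' →
        ∀ x ξ, (x, ξ) ∈ kernelTriangle → F' x ξ = F x ξ ∧ G' x ξ = G x ξ := by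
  have ha : IsSpeed (A ∘ clamp) := isSpeed_clamp hA hA0
  have hb : IsSpeed (B ∘ clamp) := isSpeed_clamp hB hB0
  have cD : Continuous (D ∘ clamp) := continuous_comp_clamp hD
  have c₁₁ : Continuous (m₁₁ ∘ clamp) := continuous_comp_clamp h₁₁
  have c₁₂ : Continuous (m₁₂ ∘ clamp) := continuous_comp_clamp h₁₂
  have c₂₁ : Continuous (m₂₁ ∘ clamp) := continuous_comp_clamp h₂₁
  have c₂₂ : Continuous (m₂₂ ∘ clamp) := continuous_comp_clamp h₂₂
  obtain ⟨C, hC0, hC₁₁, hC₁₂, hC₂₁, hC₂₂⟩ : ∃ C, 0 < C ∧ (∀ x, |(m₁₁ ∘ clamp) x| ≤ C) ∧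
      (∀ x, |(m₁₂ ∘ clamp) x| ≤ C) ∧ (∀ x, |(m₂₁ ∘ clamp) x| ≤ C) ∧
      (∀ x, |(m₂₂ ∘ clamp) x| ≤ C) := by
    obtain ⟨C₁, h1⟩ := exists_bound_comp_clamp h₁₁
    obtain ⟨C₂, h2⟩ := exists_bound_comp_clamp h₁₂
    obtain ⟨C₃, h3⟩ := exists_bound_comp_clamp h₂₁
    obtain ⟨C₄, h4⟩ := exists_bound_comp_clamp h₂₂
    have n1 := (abs_nonneg _).trans (h1 0)
    have n2 := (abs_nonneg _).trans (h2 0)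
    have n3 := (abs_nonneg _).trans (h3 0)
    have n4 := (abs_nonneg _).trans (h4 0)
    exact ⟨C₁ + C₂ + C₃ + C₄ + 1, by positivity, fun x => (h1 x).trans (by linarith),
      fun x => (h2 x).trans (by linarith), fun x => (h3 x).trans (by linarith),
      fun x => (h4 x).trans (by linarith)⟩
  -- The first component is measured on the scale `A₀`. With |κ| ≤ A₀ / 2, A₀ ≥ 1 and γ chosen so
  -- that the integral terms cost 1/4, its Lipschitz bound |κ| + 1/4 is at most (3/4) A₀.
  set A₀ : ℝ := 2 * |κ| + 1 with hA₀
  have hA₀1 : 1 ≤ A₀ := by have := abs_nonneg κ; linarith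
  have hA₀0 : 0 < A₀ := by linarith
  set γ : ℝ := 4 * (C * (A₀ + 1)) with hγ
  have hγ0 : 0 < γ := by positivity
  have hCγ : C * (A₀ + 1) / γ = 1 / 4 := by rw [hγ]; field_simp
  let wt : ℝ × ℝ → ℝ := fun p => Real.exp (γ * travel (A ∘ clamp) p.1)
  have wt0 : ∀ p, 0 < wt p := fun p => Real.exp_pos _
  have cwt : Continuous wt := by
    have := ha.continuous_travel
    fun_prop
  let Ft : C(kernelTriangle, ℝ) × C(kernelTriangle, ℝ) → ℝ × ℝ → ℝ := fun f p => A₀ * wt p * triExtend f.1 p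
  let Gt : C(kernelTriangle, ℝ) × C(kernelTriangle, ℝ) → ℝ × ℝ → ℝ := fun f p => wt p * triExtend f.2 p
  have cF : ∀ f, Continuous (Ft f) := fun f => (continuous_const.mul cwt).mul (continuous_triExtend _)
  have cG : ∀ f, Continuous (Gt f) := fun f => cwt.mul (continuous_triExtend _)
  let S₁ : (ℝ × ℝ → ℝ) → (ℝ × ℝ → ℝ) → ℝ × ℝ → ℝ :=
    goursatFst (A ∘ clamp) κ (m₁₁ ∘ clamp) (m₁₂ ∘ clamp)
  let S₂ : (ℝ × ℝ → ℝ) → (ℝ × ℝ → ℝ) → ℝ × ℝ → ℝ :=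
    goursatSnd (A ∘ clamp) (B ∘ clamp) (D ∘ clamp) (m₂₁ ∘ clamp) (m₂₂ ∘ clamp)
  -- The unknowns are divided by their weights, so that the ordinary sup distance on the product
  -- plays the part of the weighted norm.
  let Φ : C(kernelTriangle, ℝ) × C(kernelTriangle, ℝ) → C(kernelTriangle, ℝ) × C(kernelTriangle, ℝ) := fun f =>
    (⟨fun p => (A₀ * wt p)⁻¹ * S₁ (Ft f) (Gt f) p,
        ((continuous_const.mul cwt).inv₀ (fun p => (mul_pos hA₀0 (wt0 p)).ne') |>.mul
          (continuous_goursatFst ha c₁₁ c₁₂ (cF f) (cG f))).comp continuous_subtype_val⟩,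
      ⟨fun p => (wt p)⁻¹ * S₂ (Ft f) (Gt f) p,
        (cwt.inv₀ (fun p => (wt0 p).ne') |>.mul
          (continuous_goursatSnd ha hb cD c₂₁ c₂₂ (cF f) (cG f))).comp continuous_subtype_val⟩)
  have hFd : ∀ f g p, |Ft f p - Ft g p| ≤ A₀ * dist f g * Real.exp (γ * travel (A ∘ clamp) p.1) := by
    intro f g p
    have h1 := (abs_triExtend_sub_le f.1 g.1 p).trans (le_max_left _ (dist f.2 g.2))
    have e : Ft f p - Ft g p = A₀ * wt p * (triExtend f.1 p - triExtend g.1 p) := by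
      simp only [Ft]; ring
    rw [e, abs_mul, abs_of_pos (mul_pos hA₀0 (wt0 p)), Prod.dist_eq]
    calc _ ≤ A₀ * wt p * max (dist f.1 g.1) (dist f.2 g.2) :=
          mul_le_mul_of_nonneg_left h1 (mul_pos hA₀0 (wt0 p)).le
      _ = _ := by ring
  have hGd : ∀ f g p, |Gt f p - Gt g p| ≤ dist f g * Real.exp (γ * travel (A ∘ clamp) p.1) := by
    intro f g p
    have h1 := (abs_triExtend_sub_le f.2 g.2 p).trans (le_max_right (dist f.1 g.1) _)
    have e : Gt f p - Gt g p = wt p * (triExtend f.2 p - triExtend g.2 p) := by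
      simp only [Gt]; ring
    rw [e, abs_mul, abs_of_pos (wt0 p), Prod.dist_eq]
    calc _ ≤ wt p * max (dist f.1 g.1) (dist f.2 g.2) :=
          mul_le_mul_of_nonneg_left h1 (wt0 p).le
      _ = _ := by ring
  have hcontr : ContractingWith (3 / 4) Φ := by
    refine ⟨by rw [div_lt_one] <;> norm_num, LipschitzWith.of_dist_le_mul fun f g => ?_⟩
    have hd : 0 ≤ dist f g := dist_nonneg
    rw [Prod.dist_eq (x := Φ f)]
    have h34 : ((3 / 4 : NNReal) : ℝ) = 3 / 4 := by norm_num
    rw [h34]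
    refine max_le ?_ ?_
    · refine (ContinuousMap.dist_le (by positivity)).2 fun p => ?_
      have h1 := abs_goursatFst_sub_le (κ := κ) ha c₁₁ c₁₂ (cF f) (cG f) (cF g) (cG g) hC₁₁ hC₁₂
        hA₀0.le hd hγ0 (hFd f g) (hGd f g) p.2
      have hκ : |κ| ≤ A₀ / 2 := by linarith
      rw [Real.dist_eq]
      change |(A₀ * wt p)⁻¹ * _ - (A₀ * wt p)⁻¹ * _| ≤ _
      rw [← mul_sub, abs_mul, abs_of_pos (inv_pos.2 (mul_pos hA₀0 (wt0 p))),
        inv_mul_le_iff₀ (mul_pos hA₀0 (wt0 p))]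
      refine h1.trans ?_
      rw [hCγ]
      calc _ ≤ (A₀ * (3 / 4)) * dist f g * wt p := by
            refine mul_le_mul_of_nonneg_right (mul_le_mul_of_nonneg_right ?_ hd) (wt0 p).le
            linarith
        _ = _ := by ring
    · refine (ContinuousMap.dist_le (by positivity)).2 fun p => ?_
      have h1 := abs_goursatSnd_sub_le (D := D ∘ clamp) ha hb c₂₁ c₂₂ (cF f) (cG f) (cF g) (cG g)
        hC₂₁ hC₂₂ hA₀0.le hd hγ0 (hFd f g) (hGd f g) p.2
      rw [Real.dist_eq]
      change |(wt p)⁻¹ * _ - (wt p)⁻¹ * _| ≤ _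
      rw [← mul_sub, abs_mul, abs_of_pos (inv_pos.2 (wt0 p)), inv_mul_le_iff₀ (wt0 p)]
      refine h1.trans ?_
      rw [hCγ]
      calc _ ≤ (3 / 4) * dist f g * wt p := by
            refine mul_le_mul_of_nonneg_right (mul_le_mul_of_nonneg_right ?_ hd) (wt0 p).le
            norm_num
        _ = _ := by ring
  have hfix : ∀ f, Function.IsFixedPt Φ f ↔
      EqOn (Ft f) (S₁ (Ft f) (Gt f)) kernelTriangle ∧ EqOn (Gt f) (S₂ (Ft f) (Gt f)) kernelTriangle := by
    intro f
    rw [Function.IsFixedPt, Prod.ext_iff, ContinuousMap.ext_iff, ContinuousMap.ext_iff]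
    refine and_congr ⟨fun h p hp => ?_, fun h p => ?_⟩ ⟨fun h p hp => ?_, fun h p => ?_⟩
    · have h1 : (A₀ * wt p)⁻¹ * S₁ (Ft f) (Gt f) p = f.1 ⟨p, hp⟩ := h ⟨p, hp⟩
      simp only [Ft, triExtend_of_mem _ hp]
      rw [← h1, mul_inv_cancel_left₀ (mul_pos hA₀0 (wt0 p)).ne']
    · change (A₀ * wt p)⁻¹ * S₁ (Ft f) (Gt f) p = f.1 p
      rw [← h p.2]
      simp only [Ft, triExtend_of_mem _ p.2]
      rw [inv_mul_cancel_left₀ (mul_pos hA₀0 (wt0 p)).ne']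
    · have h1 : (wt p)⁻¹ * S₂ (Ft f) (Gt f) p = f.2 ⟨p, hp⟩ := h ⟨p, hp⟩
      simp only [Gt, triExtend_of_mem _ hp]
      rw [← h1, mul_inv_cancel_left₀ (wt0 p).ne']
    · change (wt p)⁻¹ * S₂ (Ft f) (Gt f) p = f.2 p
      rw [← h p.2]
      simp only [Gt, triExtend_of_mem _ p.2]
      rw [inv_mul_cancel_left₀ (wt0 p).ne']
  set f₀ := hcontr.fixedPoint with hf₀
  refine ⟨fun x ξ => Ft f₀ (x, ξ), fun x ξ => Gt f₀ (x, ξ), ?_, ?_⟩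
  · rw [isGoursat_iff hA hB hA0 hB0 h₁₁ h₁₂ h₂₁ h₂₂ (cF f₀) (cG f₀) (fun _ _ _ => rfl)
      (fun _ _ _ => rfl)]
    exact (hfix f₀).1 hcontr.fixedPoint_isFixedPt
  · intro F' G' h
    -- Any other continuous solution, divided by the weights, is again a fixed point of `Φ`.
    let f : C(kernelTriangle, ℝ) × C(kernelTriangle, ℝ) :=
      (⟨fun p => (A₀ * wt p)⁻¹ * F' p.1.1 p.1.2,
        ((continuous_const.mul cwt).inv₀ (fun p => (mul_pos hA₀0 (wt0 p)).ne')).comp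
          continuous_subtype_val |>.mul (continuousOn_iff_continuous_domRestrict.1 h.cont_fst)⟩,
       ⟨fun p => (wt p)⁻¹ * G' p.1.1 p.1.2,
        (cwt.inv₀ (fun p => (wt0 p).ne')).comp
          continuous_subtype_val |>.mul (continuousOn_iff_continuous_domRestrict.1 h.cont_snd)⟩)
    have e1 : ∀ x ξ, (x, ξ) ∈ kernelTriangle → F' x ξ = Ft f (x, ξ) := by
      intro x ξ hx
      simp only [Ft, triExtend_of_mem _ hx]
      exact (mul_inv_cancel_left₀ (mul_pos hA₀0 (wt0 _)).ne' _).symm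
    have e2 : ∀ x ξ, (x, ξ) ∈ kernelTriangle → G' x ξ = Gt f (x, ξ) := by
      intro x ξ hx
      simp only [Gt, triExtend_of_mem _ hx]
      exact (mul_inv_cancel_left₀ (wt0 _).ne' _).symm
    rw [isGoursat_iff hA hB hA0 hB0 h₁₁ h₁₂ h₂₁ h₂₂ (cF f) (cG f) e1 e2] at h
    have hf : f = f₀ := hcontr.fixedPoint_unique ((hfix f).2 h)
    intro x ξ hx
    rw [e1 x ξ hx, e2 x ξ hx, hf]
    exact ⟨rfl, rfl⟩

end

/-! ### The kernel equations -/

/-- Exchanging the roles of the two components of the state. -/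
noncomputable def swapPlant (P : HyperbolicPlant) : HyperbolicPlant where
  ε₁ := P.ε₂
  ε₂ := P.ε₁
  c₁ := fun x => -P.c₂ x
  c₂ := fun x => -P.c₁ x
  q := P.q⁻¹

/-- The kernels of the plant with the two components exchanged. -/
def swapKernel (K : KernelMatrix) : KernelMatrix where
  uu := K.vv
  uv := K.vu
  vu := K.uv
  vv := K.uu

/-- The assumptions of the theorem on the coefficients. -/
structure IsRegular (P : HyperbolicPlant) : Prop where
  c₁ : ContinuousOn P.c₁ (Icc 0 1)
  c₂ : ContinuousOn P.c₂ (Icc 0 1)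
  ε₁ : ContDiffOn ℝ 1 P.ε₁ (Icc 0 1)
  ε₂ : ContDiffOn ℝ 1 P.ε₂ (Icc 0 1)
  ε₁_pos : ∀ x ∈ Icc (0 : ℝ) 1, 0 < P.ε₁ x
  ε₂_pos : ∀ x ∈ Icc (0 : ℝ) 1, 0 < P.ε₂ x
  q : P.q ≠ 0

namespace IsRegular

variable {P : HyperbolicPlant}

lemma swap (h : IsRegular P) : IsRegular (swapPlant P) :=
  ⟨h.c₂.neg, h.c₁.neg, h.ε₂, h.ε₁, h.ε₂_pos, h.ε₁_pos, inv_ne_zero h.q⟩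

lemma dε₁ (h : IsRegular P) : ContinuousOn P.dε₁ (Icc 0 1) :=
  h.ε₁.continuousOn_derivWithin (uniqueDiffOn_Icc zero_lt_one) le_rfl

lemma dε₂ (h : IsRegular P) : ContinuousOn P.dε₂ (Icc 0 1) :=
  h.ε₂.continuousOn_derivWithin (uniqueDiffOn_Icc zero_lt_one) le_rfl

end IsRegular

/-- The first pair of kernels solves a Goursat problem, and so does the second pair. -/
lemma isBacksteppingKernel_iff (P : HyperbolicPlant) (K : KernelMatrix) :
    P.IsBacksteppingKernel K ↔
      IsGoursat P.ε₁ P.ε₂ (P.ε₂ 0 / (P.q * P.ε₁ 0)) (fun x => P.c₁ x / (P.ε₁ x + P.ε₂ x))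
        (fun ξ => -P.dε₁ ξ) (fun ξ => -P.c₂ ξ) (fun ξ => -P.c₁ ξ) P.dε₂ K.uu K.uv ∧
      IsGoursat P.ε₂ P.ε₁ (P.q * P.ε₁ 0 / P.ε₂ 0) (fun x => -(P.c₂ x / (P.ε₁ x + P.ε₂ x)))
        (fun ξ => -P.dε₂ ξ) P.c₁ P.c₂ P.dε₁ K.vv K.vu := by
  constructor
  · intro h
    refine ⟨⟨h.cont_uu, h.cont_uv, ?_, ?_, h.bc_uu, h.bc_uv⟩,
      ⟨h.cont_vv, h.cont_vu, h.eqn_vv, ?_, h.bc_vv, h.bc_vu⟩⟩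
    · convert h.eqn_uu using 3; ring
    · convert h.eqn_uv using 3; ring
    · convert h.eqn_vu using 3; ring
  · rintro ⟨h, h'⟩
    refine ⟨h.cont_fst, h.cont_snd, h'.cont_snd, h'.cont_fst, ?_, ?_, ?_, h'.eqn_fst, h.bc_fst,
      h.bc_snd, h'.bc_snd, h'.bc_fst⟩
    · convert h.eqn_fst using 3; ring
    · convert h.eqn_snd using 3; ring
    · convert h'.eqn_snd using 3; ring

/-- The kernel equations have exactly one continuous solution. -/
theorem existsUnique_kernel {P : HyperbolicPlant} (hP : IsRegular P) :
    ∃ K : KernelMatrix, P.IsBacksteppingKernel K ∧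
      ∀ K' : KernelMatrix, P.IsBacksteppingKernel K' →
        ∀ x ξ : ℝ, (x, ξ) ∈ kernelTriangle →
          K'.uu x ξ = K.uu x ξ ∧ K'.uv x ξ = K.uv x ξ ∧
          K'.vu x ξ = K.vu x ξ ∧ K'.vv x ξ = K.vv x ξ := by
  have hsum : ∀ x ∈ Icc (0 : ℝ) 1, P.ε₁ x + P.ε₂ x ≠ 0 := fun x hx =>
    (add_pos (hP.ε₁_pos x hx) (hP.ε₂_pos x hx)).ne'
  have e1 := hP.ε₁.continuousOn
  have e2 := hP.ε₂.continuousOn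
  obtain ⟨uu, uv, h1, u1⟩ := exists_isGoursat_unique (κ := P.ε₂ 0 / (P.q * P.ε₁ 0)) e1 e2
    hP.ε₁_pos hP.ε₂_pos (hP.c₁.div (e1.add e2) hsum) hP.dε₁.neg hP.c₂.neg hP.c₁.neg hP.dε₂
  obtain ⟨vv, vu, h2, u2⟩ := exists_isGoursat_unique (κ := P.q * P.ε₁ 0 / P.ε₂ 0) e2 e1
    hP.ε₂_pos hP.ε₁_pos (hP.c₂.div (e1.add e2) hsum).neg hP.dε₂.neg hP.c₁ hP.c₂ hP.dε₁
  refine ⟨⟨uu, uv, vu, vv⟩, (isBacksteppingKernel_iff _ _).2 ⟨h1, h2⟩, fun K' hK' x ξ hx => ?_⟩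
  obtain ⟨h1', h2'⟩ := (isBacksteppingKernel_iff _ _).1 hK'
  obtain ⟨a1, a2⟩ := u1 _ _ h1' x ξ hx
  obtain ⟨a3, a4⟩ := u2 _ _ h2' x ξ hx
  exact ⟨a1, a2, a4, a3⟩

/-- Exchanging the two components and reversing time gives a plant of the same form; the time
reversal accounts for the signs of the coupling coefficients, and solving the boundary condition for
the other component gives q⁻¹. The two Goursat problems trade places, so an identity for the first
component yields the one for the second. -/
lemma isBacksteppingKernel_swap {P : HyperbolicPlant} {K : KernelMatrix}
    (h : P.IsBacksteppingKernel K) : (swapPlant P).IsBacksteppingKernel (swapKernel K) := by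
  rw [isBacksteppingKernel_iff] at h ⊢
  have e1 : P.ε₁ 0 / (P.q⁻¹ * P.ε₂ 0) = P.q * P.ε₁ 0 / P.ε₂ 0 := by
    rw [inv_mul_eq_div, div_div_eq_mul_div, mul_comm]
  have e2 : P.q⁻¹ * P.ε₂ 0 / P.ε₁ 0 = P.ε₂ 0 / (P.q * P.ε₁ 0) := by
    rw [inv_mul_eq_div, div_div]
  have e3 : (fun x => -P.c₂ x / (P.ε₂ x + P.ε₁ x)) =
      fun x => -(P.c₂ x / (P.ε₁ x + P.ε₂ x)) := by
    funext x; rw [neg_div, add_comm]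
  have e4 : (fun x => -(-P.c₁ x / (P.ε₂ x + P.ε₁ x))) = fun x => P.c₁ x / (P.ε₁ x + P.ε₂ x) := by
    funext x; rw [neg_div, neg_neg, add_comm]
  have e5 : ∀ f : ℝ → ℝ, (fun ξ => - -f ξ) = f := fun f => by simp
  change IsGoursat P.ε₂ P.ε₁ (P.ε₁ 0 / (P.q⁻¹ * P.ε₂ 0))
      (fun x => -P.c₂ x / (P.ε₂ x + P.ε₁ x)) (fun ξ => -P.dε₂ ξ) (fun ξ => - -P.c₁ ξ)
      (fun ξ => - -P.c₂ ξ) P.dε₁ K.vv K.vu ∧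
    IsGoursat P.ε₁ P.ε₂ (P.q⁻¹ * P.ε₂ 0 / P.ε₁ 0)
      (fun x => -(-P.c₁ x / (P.ε₂ x + P.ε₁ x))) (fun ξ => -P.dε₁ ξ) (fun ξ => -P.c₂ ξ)
      (fun ξ => -P.c₁ ξ) P.dε₂ K.uu K.uv
  rw [e1, e2, e3, e4, e5, e5]
  exact h.symm

/-! ### Differentiating Volterra integrals along characteristics -/

lemma uIcc_subset_unit {ξ : ℝ} (hξ : ξ ∈ Icc (0 : ℝ) 1) {x : ℝ} (hx : x ∈ uIcc ξ 1) :
    (x, ξ) ∈ kernelTriangle := by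
  rw [uIcc_of_le hξ.2] at hx
  exact ⟨hξ.1, hx.1, hx.2⟩

lemma continuousOn_volterra {M : ℝ → ℝ → ℝ}
    (hM : ContinuousOn (fun p : ℝ × ℝ => M p.1 p.2) kernelTriangle) :
    ContinuousOn (fun ξ => ∫ x in ξ..1, M x ξ) (Icc 0 1) := by
  have hc := continuous_comp_triRetract hM
  have h1 : Continuous fun ξ : ℝ =>
      -∫ x in (1 : ℝ)..ξ, M (triRetract (x, ξ)).1 (triRetract (x, ξ)).2 :=
    (intervalIntegral.continuous_parametric_intervalIntegral_of_continuous
      (f := fun ξ x => M (triRetract (x, ξ)).1 (triRetract (x, ξ)).2)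
      (hc.comp continuous_swap) continuous_id).neg
  refine h1.continuousOn.congr fun ξ hξ => ?_
  change ∫ x in ξ..1, M x ξ = -∫ x in (1 : ℝ)..ξ, M (triRetract (x, ξ)).1 (triRetract (x, ξ)).2
  rw [← intervalIntegral.integral_symm]
  refine intervalIntegral.integral_congr fun x hx => ?_
  rw [triRetract_of_mem (uIcc_subset_unit hξ hx)]

lemma continuousOn_slice {M : ℝ → ℝ → ℝ}
    (hM : ContinuousOn (fun p : ℝ × ℝ => M p.1 p.2) kernelTriangle) {ξ : ℝ}
    (hξ : ξ ∈ Icc (0 : ℝ) 1) : ContinuousOn (fun x => M x ξ) (uIcc ξ 1) :=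
  hM.comp (by fun_prop : Continuous fun x : ℝ => (x, ξ)).continuousOn
    fun _ hx => uIcc_subset_unit hξ hx

/-- A function on the triangle extended along the characteristics of `(a, ςb)`, where `R` is its
derivative along them. -/
structure ExtendsAlong (a b : ℝ → ℝ) (ς : ℝ) (K R : ℝ → ℝ → ℝ) (k k' : ℝ → ℝ → ℝ) : Prop where
  cont : Continuous k.uncurry
  cont' : Continuous k'.uncurry
  deriv : ∀ z η, HasDerivAt (k z) (k' z η) η
  eq : ∀ x ξ, (x, ξ) ∈ kernelTriangle → K x ξ = k (charLabel a b ς x ξ) (travel b ξ)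
  eq' : ∀ x ξ, (x, ξ) ∈ kernelTriangle → ς * R x ξ = k' (charLabel a b ς x ξ) (travel b ξ)

/-- In the coordinates z (label) and η = `travel b ξ`, a point has `travel a x = z + ς η`. The
integral formula makes sense for all z and η, which removes the triangle from the differentiation
below; for fixed z, varying η means moving along a single characteristic. -/
lemma exists_extendsAlong {a b : ℝ → ℝ} {ς : ℝ} (ha : IsSpeed a) (hb : IsSpeed b)
    (hς : ς * ς = 1) {K R : ℝ → ℝ → ℝ} {base r₀ : ℝ → ℝ} {Rt : ℝ × ℝ → ℝ}
    (hbase : Continuous base) (hr₀ : Continuous r₀) (hRt : Continuous Rt)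
    (hR : ∀ x ξ, (x, ξ) ∈ kernelTriangle → R x ξ = Rt (x, ξ))
    (hK : ∀ x ξ, (x, ξ) ∈ kernelTriangle →
      K x ξ = base (charLabel a b ς x ξ) + charIntegral a b ς r₀ Rt (x, ξ)) :
    ∃ k k', ExtendsAlong a b ς K R k k' := by
  have hlab : ∀ x ξ, charLabel a b ς x ξ + ς * travel b ξ = travel a x := fun x ξ => by
    simp [charLabel]
  have hc : ∀ z, Continuous fun r => Rt (charPoint a b ς z r) := fun z =>
    hRt.comp (continuous_charPoint_right ha hb z)
  have hj : Continuous (Function.uncurry fun (p : ℝ × ℝ) r => Rt (charPoint a b ς p.1 r)) :=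
    hRt.comp ((continuous_charPoint ha hb).comp (by fun_prop : Continuous fun q : (ℝ × ℝ) × ℝ =>
      (q.1.1, q.2)))
  refine ⟨fun z η => base z + ∫ r in (r₀ z)..(z + ς * η), Rt (charPoint a b ς z r),
    fun z η => ς * Rt (charPoint a b ς z (z + ς * η)), ?_, ?_, ?_, ?_, ?_⟩
  · have h1 := intervalIntegral.continuous_parametric_intervalIntegral_of_continuous (μ := volume)
      (a₀ := 0) hj (s := fun p => p.1 + ς * p.2) (by fun_prop)
    have h2 := intervalIntegral.continuous_parametric_intervalIntegral_of_continuous (μ := volume)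
      (a₀ := 0) hj (s := fun p => r₀ p.1) (by fun_prop)
    refine ((hbase.comp continuous_fst).add (h1.sub h2)).congr fun p => ?_
    exact congrArg (base p.1 + ·) (intervalIntegral.integral_interval_sub_left (μ := volume)
      ((hc p.1).intervalIntegrable _ _) ((hc p.1).intervalIntegrable _ _))
  · exact continuous_const.mul (hRt.comp ((continuous_charPoint ha hb).comp
      (by fun_prop : Continuous fun p : ℝ × ℝ => (p.1, p.1 + ς * p.2))))
  · intro z η
    have h1 : HasDerivAt (fun η => z + ς * η) ς η := by
      simpa using ((hasDerivAt_id η).const_mul ς).const_add z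
    have h2 := ((hc z).integral_hasStrictDerivAt (r₀ z) (z + ς * η)).hasDerivAt.comp η h1
    exact (h2.const_add (base z)).congr_deriv (mul_comm _ _)
  · intro x ξ h
    rw [hK x ξ h, hlab]
    rfl
  · intro x ξ h
    rw [hlab, charPoint_charLabel ha hb hς, hR x ξ h]

/-- If `K` has derivative `R` along the characteristics of `(a, ςb)`, then
`ξ ↦ ∫_ξ^1 K(x,ξ) h(x) / a(x) dx` is differentiable. -/
lemma hasDerivWithinAt_volterra {a b : ℝ → ℝ} {ς : ℝ} (ha : IsSpeed a) (hb : IsSpeed b)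
    {K R k k' : ℝ → ℝ → ℝ} (hk : ExtendsAlong a b ς K R k k')
    {h h' : ℝ → ℝ} (hh : ∀ x ∈ Icc (0 : ℝ) 1, HasDerivWithinAt h (h' x) (Icc 0 1) x)
    (hh' : ContinuousOn h' (Icc 0 1)) {ξ : ℝ} (hξ : ξ ∈ Icc (0 : ℝ) 1) :
    HasDerivWithinAt (fun ξ => ∫ x in ξ..1, K x ξ * (h x / a x))
      ((b ξ)⁻¹ * (ς * (-(K 1 ξ * h 1)) + (ς - b ξ / a ξ) * (K ξ ξ * h ξ) +
        ∫ x in ξ..1, ς * (R x ξ * (h x / a x) + K x ξ * h' x))) (Icc 0 1) ξ := by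
  have chc : Continuous fun x => h' (clamp x) := continuous_comp_clamp hh'
  -- A continuously differentiable extension of `h` to the line, needed because the characteristic
  -- coordinates are not confined to [0,1].
  let H : ℝ → ℝ := fun x => h 0 + ∫ t in (0 : ℝ)..x, h' (clamp t)
  have dH : ∀ x, HasDerivAt H (h' (clamp x)) x := fun x =>
    (chc.integral_hasStrictDerivAt 0 x).hasDerivAt.const_add _
  have eH : ∀ x ∈ Icc (0 : ℝ) 1, H x = h x := by
    intro x hx
    have := intervalIntegral.integral_eq_sub_of_hasDerivAt_of_le (f := h)
      (f' := fun t => h' (clamp t)) hx.1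
      (fun y hy => (hh y ⟨hy.1, hy.2.trans hx.2⟩).continuousWithinAt.mono
        (Icc_subset_Icc_right hx.2))
      (fun y hy => by
        have hy' : y ∈ Icc (0 : ℝ) 1 := ⟨hy.1.le, hy.2.le.trans hx.2⟩
        rw [clamp_of_mem hy']
        exact (hh y hy').hasDerivAt (Icc_mem_nhds hy.1 (hy.2.trans_le hx.2)))
      (chc.intervalIntegrable _ _)
    simp only [H, this]; ring
  have cH : Continuous H := continuous_iff_continuousAt.2 fun x => (dH x).continuousAt
  let g : ℝ → ℝ := fun y => H (position a y)
  let g' : ℝ → ℝ := fun y => h' (clamp (position a y)) * a (position a y)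
  have cp := ha.continuous_position
  have ca := ha.cont
  have cg : Continuous g := cH.comp cp
  have cg' : Continuous g' := (chc.comp cp).mul (ca.comp cp)
  have dg : ∀ y, HasDerivAt g (g' y) y := fun y => (dH _).comp y (ha.hasDerivAt_position y)
  -- The integrand in the coordinates (z, η). At fixed z it is differentiable in η, although at
  -- fixed x the kernel need not be differentiable in ξ.
  let f : ℝ → ℝ → ℝ := fun z η => k z η * g (z + ς * η)
  let f' : ℝ → ℝ → ℝ := fun z η => k' z η * g (z + ς * η) + k z η * (ς * g' (z + ς * η))
  have cf : Continuous f.uncurry :=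
    hk.cont.mul (cg.comp (by fun_prop : Continuous fun p : ℝ × ℝ => p.1 + ς * p.2))
  have cf' : Continuous f'.uncurry :=
    (hk.cont'.mul (cg.comp (by fun_prop : Continuous fun p : ℝ × ℝ => p.1 + ς * p.2))).add
      (hk.cont.mul (continuous_const.mul
        (cg'.comp (by fun_prop : Continuous fun p : ℝ × ℝ => p.1 + ς * p.2))))
  have df : ∀ z η, HasDerivAt (f z) (f' z η) η := by
    intro z η
    have h1 : HasDerivAt (fun η => z + ς * η) ς η := by
      simpa using ((hasDerivAt_id η).const_mul ς).const_add z
    exact ((hk.deriv z η).mul ((dg _).comp η h1)).congr_deriv (by simp only [f', Function.comp]; ring)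
  -- `α` and `β` are the labels of the two ends (ξ, ξ) and (1, ξ) of the horizontal segment at
  -- height ξ, as functions of η = `travel b ξ`.
  let α : ℝ → ℝ := fun η => travel a (position b η) - ς * η
  let β : ℝ → ℝ := fun η => travel a 1 - ς * η
  have dα : ∀ η, HasDerivAt α ((a (position b η))⁻¹ * b (position b η) - ς) η := fun η =>
    ((ha.hasDerivAt_travel _).comp η (hb.hasDerivAt_position η)).sub
      (by simpa using (hasDerivAt_id η).const_mul ς)
  have dβ : ∀ η, HasDerivAt β (-ς) η := fun η => by
    simpa using ((hasDerivAt_id η).const_mul ς).const_sub (travel a 1)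
  -- At fixed ξ the substitution x ↦ z satisfies dz = dx / a(x). This is why the integrals carry the
  -- factor 1 / a.
  have subst : ∀ ξ ∈ Icc (0 : ℝ) 1, ∀ u : ℝ → ℝ, Continuous u → ∀ w : ℝ → ℝ,
      (∀ x, (x, ξ) ∈ kernelTriangle → w x = u (charLabel a b ς x ξ) * (a x)⁻¹) →
      ∫ x in ξ..1, w x = ∫ z in (α (travel b ξ))..(β (travel b ξ)), u z := by
    intro ξ hξ u hu w hw
    have e1 : α (travel b ξ) = charLabel a b ς ξ ξ := by simp [α, charLabel, hb.position_travel]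
    have e2 : β (travel b ξ) = charLabel a b ς 1 ξ := rfl
    rw [e1, e2, ← intervalIntegral.integral_comp_mul_deriv
      (f := fun x => charLabel a b ς x ξ) (f' := fun x => (a x)⁻¹) (g := u)
      (fun x _ => (ha.hasDerivAt_travel x).sub_const _) ha.continuous_inv.continuousOn hu]
    exact intervalIntegral.integral_congr fun x hx => hw x (uIcc_subset_unit hξ hx)
  have hlab : ∀ x ξ, charLabel a b ς x ξ + ς * travel b ξ = travel a x := fun x ξ => by
    simp [charLabel]
  have eg : ∀ x ∈ Icc (0 : ℝ) 1, g (travel a x) = h x := fun x hx => by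
    simp only [g, ha.position_travel, eH x hx]
  have hmain : ∀ ξ ∈ Icc (0 : ℝ) 1, ∫ x in ξ..1, K x ξ * (h x / a x) =
      ∫ z in (α (travel b ξ))..(β (travel b ξ)), f z (travel b ξ) := by
    intro ξ hξ
    refine subst ξ hξ (fun z => f z (travel b ξ))
      (cf.comp (by fun_prop : Continuous fun z : ℝ => (z, travel b ξ))) _ fun x hx => ?_
    simp only [f, hlab, eg x (mem_fst hx), hk.eq x ξ hx]
    ring
  have hmain' : ∫ x in ξ..1, ς * (R x ξ * (h x / a x) + K x ξ * h' x) =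
      ∫ z in (α (travel b ξ))..(β (travel b ξ)), f' z (travel b ξ) := by
    refine subst ξ hξ (fun z => f' z (travel b ξ))
      (cf'.comp (by fun_prop : Continuous fun z : ℝ => (z, travel b ξ))) _ fun x hx => ?_
    have := (ha.pos x).ne'
    simp only [f', hlab, eg x (mem_fst hx), ← hk.eq x ξ hx, ← hk.eq' x ξ hx, g',
      ha.position_travel, clamp_of_mem (mem_fst hx)]
    field_simp
  have hd := (hasDerivAt_integral_moving cf cf' df (dα (travel b ξ)) (dβ (travel b ξ))).comp ξ
    (hb.hasDerivAt_travel ξ)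
  refine (hd.hasDerivWithinAt.congr (fun y hy => hmain y hy) (hmain ξ hξ)).congr_deriv ?_
  rw [hmain']
  have e1 : f (β (travel b ξ)) (travel b ξ) = K 1 ξ * h 1 := by
    have h1 : ((1 : ℝ), ξ) ∈ kernelTriangle := ⟨hξ.1, hξ.2, le_rfl⟩
    have e : β (travel b ξ) = charLabel a b ς 1 ξ := rfl
    simp only [f, e, hlab, eg 1 ⟨zero_le_one, le_rfl⟩, hk.eq _ _ h1]
  have e2 : f (α (travel b ξ)) (travel b ξ) = K ξ ξ * h ξ := by
    have e : α (travel b ξ) = charLabel a b ς ξ ξ := by simp [α, charLabel, hb.position_travel]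
    simp only [f, e, hlab, eg ξ hξ, hk.eq _ _ (mem_diag hξ)]
  rw [e1, e2, hb.position_travel]
  ring

section

variable {A B D m₁₁ m₁₂ m₂₁ m₂₂ : ℝ → ℝ} {κ : ℝ} {F G : ℝ → ℝ → ℝ}

/-- The integral equations supply the entry value and the entry time as continuous functions of the
label. -/
lemma IsGoursat.exists_extendsAlong (hA : ContinuousOn A (Icc 0 1)) (hB : ContinuousOn B (Icc 0 1))
    (hA0 : ∀ x ∈ Icc (0 : ℝ) 1, 0 < A x) (hB0 : ∀ x ∈ Icc (0 : ℝ) 1, 0 < B x)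
    (hD : ContinuousOn D (Icc 0 1))
    (h₁₁ : ContinuousOn m₁₁ (Icc 0 1)) (h₁₂ : ContinuousOn m₁₂ (Icc 0 1))
    (h₂₁ : ContinuousOn m₂₁ (Icc 0 1)) (h₂₂ : ContinuousOn m₂₂ (Icc 0 1))
    (h : IsGoursat A B κ D m₁₁ m₁₂ m₂₁ m₂₂ F G) :
    (∃ k k', ExtendsAlong (A ∘ clamp) (A ∘ clamp) 1 F
      (fun x ξ => m₁₁ ξ * F x ξ + m₁₂ ξ * G x ξ) k k') ∧
    ∃ k k', ExtendsAlong (A ∘ clamp) (B ∘ clamp) (-1) G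
      (fun x ξ => m₂₁ ξ * F x ξ + m₂₂ ξ * G x ξ) k k' := by
  have ha : IsSpeed (A ∘ clamp) := isSpeed_clamp hA hA0
  have hb : IsSpeed (B ∘ clamp) := isSpeed_clamp hB hB0
  let Ft : ℝ × ℝ → ℝ := fun p => F (triRetract p).1 (triRetract p).2
  let Gt : ℝ × ℝ → ℝ := fun p => G (triRetract p).1 (triRetract p).2
  have cF : Continuous Ft := continuous_comp_triRetract h.cont_fst
  have cG : Continuous Gt := continuous_comp_triRetract h.cont_snd
  have eF : ∀ x ξ, (x, ξ) ∈ kernelTriangle → F x ξ = Ft (x, ξ) := fun x ξ hx => by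
    simp only [Ft, triRetract_of_mem hx]
  have eG : ∀ x ξ, (x, ξ) ∈ kernelTriangle → G x ξ = Gt (x, ξ) := fun x ξ hx => by
    simp only [Gt, triRetract_of_mem hx]
  obtain ⟨h1, h2⟩ := (isGoursat_iff hA hB hA0 hB0 h₁₁ h₁₂ h₂₁ h₂₂ cF cG eF eG).1 h
  refine ⟨Backstepping.exists_extendsAlong ha ha (by norm_num)
      (base := fun z => κ * Gt (position (A ∘ clamp) z, 0)) (r₀ := id)
      (continuous_const.mul (cG.comp (ha.continuous_position.prodMk continuous_const)))
      continuous_id (continuous_goursatRhs (continuous_comp_clamp h₁₁) (continuous_comp_clamp h₁₂)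
        cF cG) (fun x ξ hx => ?_) fun x ξ hx => (eF x ξ hx).trans (h1 hx),
    Backstepping.exists_extendsAlong ha hb (by norm_num)
      (base := fun z => (D ∘ clamp) (diagFoot (A ∘ clamp) (B ∘ clamp) z))
      (r₀ := fun z => travel (A ∘ clamp) (diagFoot (A ∘ clamp) (B ∘ clamp) z))
      ((continuous_comp_clamp hD).comp (continuous_diagFoot ha hb))
      (ha.continuous_travel.comp (continuous_diagFoot ha hb))
      (continuous_goursatRhs (continuous_comp_clamp h₂₁) (continuous_comp_clamp h₂₂)
        cF cG) (fun x ξ hx => ?_) fun x ξ hx => (eG x ξ hx).trans (h2 hx)⟩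
  · simp [goursatRhs, clamp_of_mem (mem_snd hx), eF x ξ hx, eG x ξ hx]
  · simp [goursatRhs, clamp_of_mem (mem_snd hx), eF x ξ hx, eG x ξ hx]

end

/-! ### The adjoint of the backstepping transformation on functions -/

/-- The first component of the adjoint backstepping transformation. -/
noncomputable def adjFst (K : KernelMatrix) (φ ψ : ℝ → ℝ) (ξ : ℝ) : ℝ :=
  φ ξ - ∫ x in ξ..1, (K.uu x ξ * φ x + K.vu x ξ * ψ x)

/-- The second component of the adjoint backstepping transformation. -/
noncomputable def adjSnd (K : KernelMatrix) (φ ψ : ℝ → ℝ) (ξ : ℝ) : ℝ :=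
  ψ ξ - ∫ x in ξ..1, (K.uv x ξ * φ x + K.vv x ξ * ψ x)

lemma adjFst_swapKernel (K : KernelMatrix) (φ ψ : ℝ → ℝ) :
    adjFst (swapKernel K) ψ φ = adjSnd K φ ψ := by
  funext ξ; simp only [adjFst, adjSnd, swapKernel, add_comm]

lemma adjSnd_swapKernel (K : KernelMatrix) (φ ψ : ℝ → ℝ) :
    adjSnd (swapKernel K) ψ φ = adjFst K φ ψ := by
  funext ξ; simp only [adjFst, adjSnd, swapKernel, add_comm]

section

variable {P : HyperbolicPlant} {K : KernelMatrix} {φ ψ p' r' : ℝ → ℝ}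

lemma continuousOn_mul_fst {M : ℝ → ℝ → ℝ}
    (hM : ContinuousOn (fun p : ℝ × ℝ => M p.1 p.2) kernelTriangle) {f : ℝ → ℝ}
    (hf : ContinuousOn f (Icc 0 1)) :
    ContinuousOn (fun p : ℝ × ℝ => M p.1 p.2 * f p.1) kernelTriangle :=
  hM.mul (hf.comp continuous_fst.continuousOn fun _ hp => mem_fst hp)

lemma intervalIntegrable_slice {M : ℝ → ℝ → ℝ}
    (hM : ContinuousOn (fun p : ℝ × ℝ => M p.1 p.2) kernelTriangle) {f : ℝ → ℝ}
    (hf : ContinuousOn f (Icc 0 1)) {ξ : ℝ} (hξ : ξ ∈ Icc (0 : ℝ) 1) :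
    IntervalIntegrable (fun x => M x ξ * f x) volume ξ 1 :=
  (continuousOn_slice (M := fun x ξ => M x ξ * f x) (continuousOn_mul_fst hM hf)
    hξ).intervalIntegrable

lemma continuousOn_adjFst (hK : P.IsBacksteppingKernel K) (hφ : ContinuousOn φ (Icc 0 1))
    (hψ : ContinuousOn ψ (Icc 0 1)) : ContinuousOn (adjFst K φ ψ) (Icc 0 1) :=
  hφ.sub (continuousOn_volterra (M := fun x ξ => K.uu x ξ * φ x + K.vu x ξ * ψ x)
    ((continuousOn_mul_fst hK.cont_uu hφ).add (continuousOn_mul_fst hK.cont_vu hψ)))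

lemma continuousOn_adjSnd (hK : P.IsBacksteppingKernel K) (hφ : ContinuousOn φ (Icc 0 1))
    (hψ : ContinuousOn ψ (Icc 0 1)) : ContinuousOn (adjSnd K φ ψ) (Icc 0 1) :=
  hψ.sub (continuousOn_volterra (M := fun x ξ => K.uv x ξ * φ x + K.vv x ξ * ψ x)
    ((continuousOn_mul_fst hK.cont_uv hφ).add (continuousOn_mul_fst hK.cont_vv hψ)))

lemma adjFst_one : adjFst K φ ψ 1 = φ 1 := by simp [adjFst]

lemma adjSnd_one : adjSnd K φ ψ 1 = ψ 1 := by simp [adjSnd]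

/-- This is where the kernel equations were designed to be used. Differentiating under the integral
along characteristics, the terms with ε₁' cancel. The diagonal contributes nothing for K^{uu}, whose
two speeds agree, and produces the local coupling c₂ ψ through the prescribed value of K^{vu}. The
end x = 1 leaves the terms with K(1, ξ), one of which is the feedback; the other disappears when
φ(1) = 0. In that case the formula is the first row of the intertwining relation for the adjoint
generators. -/
lemma hasDerivWithinAt_adjFst (hP : IsRegular P) (hK : P.IsBacksteppingKernel K)
    (hφ : ContinuousOn φ (Icc 0 1)) (hψ : ContinuousOn ψ (Icc 0 1))
    (hp : ∀ x ∈ Icc (0 : ℝ) 1, HasDerivWithinAt (fun y => P.ε₁ y * φ y) (p' x) (Icc 0 1) x)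
    (hr : ∀ x ∈ Icc (0 : ℝ) 1, HasDerivWithinAt (fun y => P.ε₂ y * ψ y) (r' x) (Icc 0 1) x)
    (hp' : ContinuousOn p' (Icc 0 1)) (hr' : ContinuousOn r' (Icc 0 1))
    {ξ : ℝ} (hξ : ξ ∈ Icc (0 : ℝ) 1) :
    HasDerivWithinAt (fun y => P.ε₁ y * adjFst K φ ψ y)
      (adjFst K p' (fun x => -r' x) ξ - P.c₂ ξ * adjSnd K φ ψ ξ - P.ε₂ 1 * ψ 1 * K.vu 1 ξ +
        P.ε₁ 1 * φ 1 * K.uu 1 ξ) (Icc 0 1) ξ := by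
  have e1 := hP.ε₁.continuousOn
  have e2 := hP.ε₂.continuousOn
  have hsum : ∀ x ∈ Icc (0 : ℝ) 1, P.ε₁ x + P.ε₂ x ≠ 0 := fun x hx =>
    (add_pos (hP.ε₁_pos x hx) (hP.ε₂_pos x hx)).ne'
  have ha : IsSpeed (P.ε₁ ∘ clamp) := isSpeed_clamp e1 hP.ε₁_pos
  have hb : IsSpeed (P.ε₂ ∘ clamp) := isSpeed_clamp e2 hP.ε₂_pos
  obtain ⟨h1, h2⟩ := (isBacksteppingKernel_iff _ _).1 hK
  obtain ⟨⟨k₁, k₁', hk₁⟩, -⟩ := h1.exists_extendsAlong e1 e2 hP.ε₁_pos hP.ε₂_pos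
    (hP.c₁.div (e1.add e2) hsum) hP.dε₁.neg hP.c₂.neg hP.c₁.neg hP.dε₂
  obtain ⟨-, k₂, k₂', hk₂⟩ := h2.exists_extendsAlong e2 e1 hP.ε₂_pos hP.ε₁_pos
    (hP.c₂.div (e1.add e2) hsum).neg hP.dε₂.neg hP.c₁ hP.c₂ hP.dε₁
  have d1 := hasDerivWithinAt_volterra ha ha hk₁ hp hp' hξ
  simp only [Pi.neg_apply] at d1
  have d2 := hasDerivWithinAt_volterra hb ha hk₂ hr hr' hξ
  have q1 : ∀ x ∈ Icc (0 : ℝ) 1, P.ε₁ x * φ x / (P.ε₁ ∘ clamp) x = φ x := fun x hx => by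
    have := (hP.ε₁_pos x hx).ne'
    simp only [Function.comp_apply, clamp_of_mem hx]; field_simp
  have q2 : ∀ x ∈ Icc (0 : ℝ) 1, P.ε₂ x * ψ x / (P.ε₂ ∘ clamp) x = ψ x := fun x hx => by
    have := (hP.ε₂_pos x hx).ne'
    simp only [Function.comp_apply, clamp_of_mem hx]; field_simp
  have i1 : ∀ ξ ∈ Icc (0 : ℝ) 1, ∫ x in ξ..1, K.uu x ξ * (P.ε₁ x * φ x / (P.ε₁ ∘ clamp) x) =
      ∫ x in ξ..1, K.uu x ξ * φ x := fun ξ hξ => intervalIntegral.integral_congr fun x hx => by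
    simp only [q1 x (mem_fst (uIcc_subset_unit hξ hx))]
  have i2 : ∀ ξ ∈ Icc (0 : ℝ) 1, ∫ x in ξ..1, K.vu x ξ * (P.ε₂ x * ψ x / (P.ε₂ ∘ clamp) x) =
      ∫ x in ξ..1, K.vu x ξ * ψ x := fun ξ hξ => intervalIntegral.integral_congr fun x hx => by
    simp only [q2 x (mem_fst (uIcc_subset_unit hξ hx))]
  have dε : HasDerivWithinAt P.ε₁ (P.dε₁ ξ) (Icc 0 1) ξ :=
    ((hP.ε₁.differentiableOn one_ne_zero) ξ hξ).hasDerivWithinAt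
  have htot := (hp ξ hξ).sub (dε.mul (d1.add d2))
  have hu := fun {f : ℝ → ℝ} (hf : ContinuousOn f (Icc 0 1)) => intervalIntegrable_slice hK.cont_uu hf hξ
  have huv := fun {f : ℝ → ℝ} (hf : ContinuousOn f (Icc 0 1)) => intervalIntegrable_slice hK.cont_uv hf hξ
  have hvu := fun {f : ℝ → ℝ} (hf : ContinuousOn f (Icc 0 1)) => intervalIntegrable_slice hK.cont_vu hf hξ
  have hvv := fun {f : ℝ → ℝ} (hf : ContinuousOn f (Icc 0 1)) => intervalIntegrable_slice hK.cont_vv hf hξ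
  refine (htot.congr (fun y hy => ?_) ?_).congr_deriv ?_
  · simp only [Pi.sub_apply, Pi.add_apply, Pi.mul_apply, i1 y hy, i2 y hy, adjFst]
    rw [intervalIntegral.integral_add (intervalIntegrable_slice hK.cont_uu hφ hy)
      (intervalIntegrable_slice hK.cont_vu hψ hy)]
    ring
  · simp only [Pi.sub_apply, Pi.add_apply, Pi.mul_apply, i1 ξ hξ, i2 ξ hξ, adjFst]
    rw [intervalIntegral.integral_add (hu hφ) (hvu hψ)]
    ring
  · have j1 : ∫ x in ξ..1, (1 : ℝ) * ((-P.dε₁ ξ * K.uu x ξ + -P.c₂ ξ * K.uv x ξ) *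
        (P.ε₁ x * φ x / (P.ε₁ ∘ clamp) x) + K.uu x ξ * p' x) =
        -P.dε₁ ξ * (∫ x in ξ..1, K.uu x ξ * φ x) - P.c₂ ξ * (∫ x in ξ..1, K.uv x ξ * φ x) +
          ∫ x in ξ..1, K.uu x ξ * p' x := by
      rw [← intervalIntegral.integral_const_mul, ← intervalIntegral.integral_const_mul,
        ← intervalIntegral.integral_sub ((hu hφ).const_mul _) ((huv hφ).const_mul _),
        ← intervalIntegral.integral_add (((hu hφ).const_mul _).sub ((huv hφ).const_mul _)) (hu hp')]
      refine intervalIntegral.integral_congr fun x hx => ?_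
      simp only [q1 x (mem_fst (uIcc_subset_unit hξ hx))]
      ring
    have j2 : ∫ x in ξ..1, (-1 : ℝ) * ((P.c₂ ξ * K.vv x ξ + P.dε₁ ξ * K.vu x ξ) *
        (P.ε₂ x * ψ x / (P.ε₂ ∘ clamp) x) + K.vu x ξ * r' x) =
        -P.c₂ ξ * (∫ x in ξ..1, K.vv x ξ * ψ x) - P.dε₁ ξ * (∫ x in ξ..1, K.vu x ξ * ψ x) -
          ∫ x in ξ..1, K.vu x ξ * r' x := by
      rw [← intervalIntegral.integral_const_mul, ← intervalIntegral.integral_const_mul,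
        ← intervalIntegral.integral_sub ((hvv hψ).const_mul _) ((hvu hψ).const_mul _),
        ← intervalIntegral.integral_sub (((hvv hψ).const_mul _).sub ((hvu hψ).const_mul _)) (hvu hr')]
      refine intervalIntegral.integral_congr fun x hx => ?_
      simp only [q2 x (mem_fst (uIcc_subset_unit hξ hx))]
      ring
    have j3 : ∫ x in ξ..1, (K.uu x ξ * p' x + K.vu x ξ * -r' x) =
        (∫ x in ξ..1, K.uu x ξ * p' x) - ∫ x in ξ..1, K.vu x ξ * r' x := by
      rw [← intervalIntegral.integral_sub (hu hp') (hvu hr')]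
      exact intervalIntegral.integral_congr fun x _ => by ring
    simp only [i1 ξ hξ, i2 ξ hξ, j1, j2, Pi.add_apply, adjFst, adjSnd]
    -- Inserting the diagonal value of K^{vu} cancels the factor ε₁ + ε₂ created by the opposite
    -- directions of travel. The rest is algebra with the integrals as unknowns.
    rw [j3, intervalIntegral.integral_add (huv hφ) (hvv hψ), hK.bc_vu ξ hξ]
    simp only [Function.comp_apply, clamp_of_mem hξ]
    have n1 := (hP.ε₁_pos ξ hξ).ne'
    have n2 := (hP.ε₂_pos ξ hξ).ne'
    have n3 := hsum ξ hξ
    generalize (∫ x in ξ..1, K.uu x ξ * φ x) = a1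
    generalize (∫ x in ξ..1, K.uv x ξ * φ x) = a2
    generalize (∫ x in ξ..1, K.uu x ξ * p' x) = a3
    generalize (∫ x in ξ..1, K.vu x ξ * ψ x) = b1
    generalize (∫ x in ξ..1, K.vv x ξ * ψ x) = b2
    generalize (∫ x in ξ..1, K.vu x ξ * r' x) = b3
    field_simp
    ring

/-- The first-component formula for the exchanged plant, with the test functions and the derivatives
of their fluxes exchanged as well. -/
lemma hasDerivWithinAt_adjSnd (hP : IsRegular P) (hK : P.IsBacksteppingKernel K)
    (hφ : ContinuousOn φ (Icc 0 1)) (hψ : ContinuousOn ψ (Icc 0 1))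
    (hp : ∀ x ∈ Icc (0 : ℝ) 1, HasDerivWithinAt (fun y => P.ε₁ y * φ y) (p' x) (Icc 0 1) x)
    (hr : ∀ x ∈ Icc (0 : ℝ) 1, HasDerivWithinAt (fun y => P.ε₂ y * ψ y) (r' x) (Icc 0 1) x)
    (hp' : ContinuousOn p' (Icc 0 1)) (hr' : ContinuousOn r' (Icc 0 1))
    {ξ : ℝ} (hξ : ξ ∈ Icc (0 : ℝ) 1) :
    HasDerivWithinAt (fun y => P.ε₂ y * adjSnd K φ ψ y)
      (-adjSnd K p' (fun x => -r' x) ξ + P.c₁ ξ * adjFst K φ ψ ξ + P.ε₂ 1 * ψ 1 * K.vv 1 ξ -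
        P.ε₁ 1 * φ 1 * K.uv 1 ξ) (Icc 0 1) ξ := by
  have h := hasDerivWithinAt_adjFst hP.swap (isBacksteppingKernel_swap hK) hψ hφ hr hp hr' hp' hξ
  rw [adjFst_swapKernel, adjSnd_swapKernel, adjFst_swapKernel] at h
  refine h.congr_deriv ?_
  have : adjSnd K (fun x => -p' x) r' ξ = -adjSnd K p' (fun x => -r' x) ξ := by
    have e : ∫ x in ξ..1, (K.uv x ξ * -p' x + K.vv x ξ * r' x) =
        -∫ x in ξ..1, (K.uv x ξ * p' x + K.vv x ξ * -r' x) := by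
      rw [← intervalIntegral.integral_neg]
      exact intervalIntegral.integral_congr fun x _ => by ring
    simp only [adjSnd, e]
    ring
  rw [this]
  simp only [swapPlant, swapKernel]
  ring

end

/-! ### Operators on `L²([0,1])` -/

/-- Lebesgue measure on `[0,1]`. -/
noncomputable abbrev unitMeasure : Measure ℝ := volume.restrict (Icc (0 : ℝ) 1)

instance : IsProbabilityMeasure unitMeasure := ⟨by simp⟩

lemma integrable_coe (u : L2unit) : Integrable u unitMeasure :=
  (Lp.memLp u).integrable one_le_two

lemma inner_eq_integral (u v : L2unit) : inner ℝ u v = ∫ x in Icc (0 : ℝ) 1, u x * v x := by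
  rw [L2.inner_def]
  exact integral_congr_ae (Eventually.of_forall fun x => by simp [mul_comm])

/-- The class in `L²` of a function, zero if it is not square integrable. -/
noncomputable def toL2 (f : ℝ → ℝ) : L2unit :=
  open Classical in if h : MemLp f 2 unitMeasure then h.toLp f else 0

lemma toL2_ae {f : ℝ → ℝ} (h : MemLp f 2 unitMeasure) : toL2 f =ᵐ[unitMeasure] f := by
  rw [toL2, dif_pos h]
  exact h.coeFn_toLp

lemma memLp_of_continuousOn {f : ℝ → ℝ} (hf : ContinuousOn f (Icc 0 1)) :
    MemLp f 2 unitMeasure := by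
  obtain ⟨C, hC⟩ := isCompact_Icc.exists_bound_of_continuousOn hf
  refine MemLp.of_bound (hf.aestronglyMeasurable measurableSet_Icc) C ?_
  exact (ae_restrict_iff' measurableSet_Icc).2 (Eventually.of_forall hC)

lemma toL2_ae_of_continuousOn {f : ℝ → ℝ} (hf : ContinuousOn f (Icc 0 1)) :
    toL2 f =ᵐ[unitMeasure] f := toL2_ae (memLp_of_continuousOn hf)

lemma inner_toL2 (u : L2unit) {f : ℝ → ℝ} (hf : MemLp f 2 unitMeasure) :
    inner ℝ u (toL2 f) = ∫ x in Icc (0 : ℝ) 1, u x * f x := by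
  rw [inner_eq_integral]
  refine integral_congr_ae ?_
  filter_upwards [toL2_ae hf] with x hx
  rw [hx]

lemma ae_unit_mem : ∀ᵐ x ∂unitMeasure, x ∈ Icc (0 : ℝ) 1 := ae_restrict_mem measurableSet_Icc

lemma toL2_congr {f g : ℝ → ℝ} (h : EqOn f g (Icc 0 1)) : toL2 f = toL2 g := by
  have hae : f =ᵐ[unitMeasure] g := ae_unit_mem.mono fun x hx => h hx
  by_cases hf : MemLp f 2 unitMeasure
  · have hg := (memLp_congr_ae hae).1 hf
    exact Lp.ext (((toL2_ae hf).trans hae).trans (toL2_ae hg).symm)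
  · have hg := fun hg => hf ((memLp_congr_ae hae).2 hg)
    rw [toL2, toL2, dif_neg hf, dif_neg hg]

/-- Measurable bounded integral kernels. -/
structure BddKernel (k : ℝ → ℝ → ℝ) : Prop where
  meas : Measurable k.uncurry
  bdd : ∃ M, ∀ x ξ, |k x ξ| ≤ M

namespace BddKernel

variable {k : ℝ → ℝ → ℝ}

lemma transpose (hk : BddKernel k) : BddKernel fun x ξ => k ξ x :=
  ⟨hk.meas.comp measurable_swap, hk.bdd.imp fun _ h x ξ => h ξ x⟩

lemma slice (hk : BddKernel k) (x : ℝ) : Measurable (k x) :=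
  hk.meas.comp measurable_prodMk_left

lemma memLp (hk : BddKernel k) (x : ℝ) : MemLp (k x) 2 unitMeasure := by
  obtain ⟨M, hM⟩ := hk.bdd
  exact MemLp.of_bound (hk.slice x).aestronglyMeasurable M (Eventually.of_forall (hM x))

end BddKernel

/-- The function `x ↦ ∫ k(x,ξ) u(ξ) dξ`. -/
noncomputable def intFun (k : ℝ → ℝ → ℝ) (u : L2unit) (x : ℝ) : ℝ :=
  ∫ ξ in Icc (0 : ℝ) 1, k x ξ * u ξ

lemma intFun_eq_inner {k : ℝ → ℝ → ℝ} (hk : BddKernel k) (u : L2unit) (x : ℝ) :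
    intFun k u x = inner ℝ u (toL2 (k x)) := by
  rw [inner_toL2 u (hk.memLp x), intFun]
  simp only [mul_comm]

lemma norm_toL2_sq {f : ℝ → ℝ} (hf : MemLp f 2 unitMeasure) :
    ‖toL2 f‖ ^ 2 = ∫ x in Icc (0 : ℝ) 1, f x ^ 2 := by
  rw [← real_inner_self_eq_norm_sq, inner_toL2 _ hf]
  refine integral_congr_ae ?_
  filter_upwards [toL2_ae hf] with x hx
  rw [hx, sq]

lemma abs_intFun_le {k : ℝ → ℝ → ℝ} (hk : BddKernel k) {C : ℝ} (hC : 0 ≤ C) {x : ℝ}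
    (h : ∫ ξ in Icc (0 : ℝ) 1, k x ξ ^ 2 ≤ C ^ 2) (u : L2unit) : |intFun k u x| ≤ C * ‖u‖ := by
  rw [intFun_eq_inner hk, mul_comm]
  refine (abs_real_inner_le_norm _ _).trans (mul_le_mul_of_nonneg_left ?_ (norm_nonneg _))
  rw [← norm_toL2_sq (hk.memLp x)] at h
  exact (pow_le_pow_iff_left₀ (norm_nonneg _) hC two_ne_zero).1 h

lemma integral_sq_le {k : ℝ → ℝ → ℝ} (hk : BddKernel k) {M : ℝ} (hM : ∀ x ξ, |k x ξ| ≤ M) (x : ℝ) :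
    ∫ ξ in Icc (0 : ℝ) 1, k x ξ ^ 2 ≤ M ^ 2 := by
  calc _ ≤ ∫ ξ in Icc (0 : ℝ) 1, M ^ 2 := by
        refine integral_mono (hk.memLp x).integrable_sq (integrable_const _) fun ξ => ?_
        exact sq_le_sq' (abs_le.1 (hM x ξ)).1 (abs_le.1 (hM x ξ)).2
    _ = _ := by simp

lemma stronglyMeasurable_intFun {k : ℝ → ℝ → ℝ} (hk : BddKernel k) (u : L2unit) :
    StronglyMeasurable (intFun k u) := by
  have : StronglyMeasurable (Function.uncurry fun x ξ => k x ξ * u ξ) :=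
    hk.meas.stronglyMeasurable.mul ((Lp.stronglyMeasurable u).comp_measurable measurable_snd)
  exact this.integral_prod_right

lemma memLp_intFun {k : ℝ → ℝ → ℝ} (hk : BddKernel k) (u : L2unit) :
    MemLp (intFun k u) 2 unitMeasure := by
  obtain ⟨M, hM⟩ := hk.bdd
  exact MemLp.of_bound (stronglyMeasurable_intFun hk u).aestronglyMeasurable (M * ‖u‖)
    (Eventually.of_forall fun x => abs_intFun_le hk ((abs_nonneg _).trans (hM 0 0))
      (integral_sq_le hk hM x) u)

/-- Cauchy–Schwarz bounds the image pointwise, and on a probability space a pointwise bound is an L²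
bound. Only the square integrals of the rows of the kernel enter, which makes the concentration of
weighted kernels near the diagonal count. -/
lemma norm_toL2_intFun_le {k : ℝ → ℝ → ℝ} (hk : BddKernel k) {C : ℝ} (hC : 0 ≤ C)
    (h : ∀ x ∈ Icc (0 : ℝ) 1, ∫ ξ in Icc (0 : ℝ) 1, k x ξ ^ 2 ≤ C ^ 2) (u : L2unit) :
    ‖toL2 (intFun k u)‖ ≤ C * ‖u‖ := by
  have := Lp.norm_le_of_ae_bound (f := toL2 (intFun k u)) (C := C * ‖u‖) (by positivity) (by
    filter_upwards [toL2_ae (memLp_intFun hk u), ae_unit_mem] with x hx hx'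
    rw [hx]
    exact abs_intFun_le hk hC (h x hx') u)
  simpa [measureUnivNNReal] using this

/-- The integral operator with a bounded measurable kernel (zero for other kernels). -/
noncomputable def intOp (k : ℝ → ℝ → ℝ) : L2unit →L[ℝ] L2unit :=
  open Classical in
  if hk : BddKernel k then
    LinearMap.mkContinuous
      { toFun := fun u => toL2 (intFun k u)
        map_add' := fun u v => by
          refine Lp.ext ?_
          filter_upwards [toL2_ae (memLp_intFun hk (u + v)), toL2_ae (memLp_intFun hk u),
            toL2_ae (memLp_intFun hk v), Lp.coeFn_add (toL2 (intFun k u)) (toL2 (intFun k v))]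
            with x h1 h2 h3 h4
          rw [h1, h4, Pi.add_apply, h2, h3, intFun_eq_inner hk, intFun_eq_inner hk,
            intFun_eq_inner hk, inner_add_left]
        map_smul' := fun c u => by
          refine Lp.ext ?_
          filter_upwards [toL2_ae (memLp_intFun hk (c • u)), toL2_ae (memLp_intFun hk u),
            Lp.coeFn_smul c (toL2 (intFun k u))] with x h1 h2 h3
          rw [h1, RingHom.id_apply, h3, Pi.smul_apply, h2, intFun_eq_inner hk, intFun_eq_inner hk,
            real_inner_smul_left, smul_eq_mul] }
      (Classical.choose hk.bdd)
      (fun u => norm_toL2_intFun_le hk ((abs_nonneg _).trans (Classical.choose_spec hk.bdd 0 0))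
        (fun x _ => integral_sq_le hk (Classical.choose_spec hk.bdd) x) u)
  else 0

lemma intOp_apply {k : ℝ → ℝ → ℝ} (hk : BddKernel k) (u : L2unit) :
    intOp k u = toL2 (intFun k u) := by
  rw [intOp, dif_pos hk]; rfl

lemma intOp_ae {k : ℝ → ℝ → ℝ} (hk : BddKernel k) (u : L2unit) :
    intOp k u =ᵐ[unitMeasure] intFun k u := by
  rw [intOp_apply hk]
  exact toL2_ae (memLp_intFun hk u)

lemma norm_intOp_le {k : ℝ → ℝ → ℝ} (hk : BddKernel k) {C : ℝ} (hC : 0 ≤ C)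
    (h : ∀ x ∈ Icc (0 : ℝ) 1, ∫ ξ in Icc (0 : ℝ) 1, k x ξ ^ 2 ≤ C ^ 2) : ‖intOp k‖ ≤ C :=
  ContinuousLinearMap.opNorm_le_bound _ hC fun u => by
    rw [intOp_apply hk]
    exact norm_toL2_intFun_le hk hC h u

lemma inner_intOp_left {k : ℝ → ℝ → ℝ} (hk : BddKernel k) (u v : L2unit) :
    inner ℝ (intOp k u) v = inner ℝ u (intOp (fun x ξ => k ξ x) v) := by
  have hint : Integrable (Function.uncurry fun x ξ => k x ξ * u ξ * v x)
      (unitMeasure.prod unitMeasure) := by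
    obtain ⟨M, hM⟩ := hk.bdd
    have h1 : Integrable (fun p : ℝ × ℝ => v p.1 * u p.2) (unitMeasure.prod unitMeasure) :=
      (integrable_coe v).mul_prod (integrable_coe u)
    refine (h1.bdd_mul (c := M) hk.meas.aestronglyMeasurable
      (Eventually.of_forall fun p => hM p.1 p.2)).congr (Eventually.of_forall fun p => ?_)
    simp only [Function.uncurry]; ring
  calc inner ℝ (intOp k u) v = ∫ x in Icc (0 : ℝ) 1, ∫ ξ in Icc (0 : ℝ) 1, k x ξ * u ξ * v x := by
        rw [inner_eq_integral]
        refine integral_congr_ae ?_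
        filter_upwards [intOp_ae hk u] with x hx
        rw [hx, intFun, ← integral_mul_const]
    _ = ∫ ξ in Icc (0 : ℝ) 1, ∫ x in Icc (0 : ℝ) 1, k x ξ * u ξ * v x := integral_integral_swap hint
    _ = _ := by
        rw [inner_eq_integral]
        refine integral_congr_ae ?_
        filter_upwards [intOp_ae hk.transpose v] with x hx
        rw [hx, intFun, ← integral_const_mul]
        exact integral_congr_ae (Eventually.of_forall fun ξ => by ring)

/-! ### Multiplication operators -/

/-- Bounded continuous multipliers. -/
structure BddMul (f : ℝ → ℝ) : Prop where
  cont : Continuous f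
  bdd : ∃ M, ∀ x, |f x| ≤ M

lemma memLp_mul {f : ℝ → ℝ} (hf : BddMul f) (u : L2unit) :
    MemLp (fun x => f x * u x) 2 unitMeasure := by
  obtain ⟨M, hM⟩ := hf.bdd
  refine (Lp.memLp u).of_le_mul (c := M)
    (hf.cont.aestronglyMeasurable.mul (Lp.aestronglyMeasurable u)) (Eventually.of_forall fun x => ?_)
  rw [norm_mul]
  exact mul_le_mul_of_nonneg_right (hM x) (norm_nonneg _)

/-- Multiplication by a bounded continuous function (zero for other functions). -/
noncomputable def mulOp (f : ℝ → ℝ) : L2unit →L[ℝ] L2unit :=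
  open Classical in
  if hf : BddMul f then
    LinearMap.mkContinuous
      { toFun := fun u => toL2 fun x => f x * u x
        map_add' := fun u v => by
          refine Lp.ext ?_
          filter_upwards [toL2_ae (memLp_mul hf (u + v)), toL2_ae (memLp_mul hf u),
            toL2_ae (memLp_mul hf v), Lp.coeFn_add u v,
            Lp.coeFn_add (toL2 fun x => f x * u x) (toL2 fun x => f x * v x)]
            with x h1 h2 h3 h4 h5
          rw [h1, h5, Pi.add_apply, h2, h3, h4, Pi.add_apply, mul_add]
        map_smul' := fun c u => by
          refine Lp.ext ?_
          filter_upwards [toL2_ae (memLp_mul hf (c • u)), toL2_ae (memLp_mul hf u),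
            Lp.coeFn_smul c u, Lp.coeFn_smul c (toL2 fun x => f x * u x)] with x h1 h2 h3 h4
          rw [h1, RingHom.id_apply, h4, Pi.smul_apply, h2, h3, Pi.smul_apply, smul_eq_mul,
            smul_eq_mul]
          ring }
      (Classical.choose hf.bdd)
      (fun u => by
        refine Lp.norm_le_mul_norm_of_ae_le_mul ?_
        filter_upwards [toL2_ae (memLp_mul hf u)] with x hx
        change ‖toL2 (fun x => f x * u x) x‖ ≤ _
        rw [hx, norm_mul]
        exact mul_le_mul_of_nonneg_right (Classical.choose_spec hf.bdd x) (norm_nonneg _))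
  else 0

lemma mulOp_ae {f : ℝ → ℝ} (hf : BddMul f) (u : L2unit) :
    mulOp f u =ᵐ[unitMeasure] fun x => f x * u x := by
  rw [mulOp, dif_pos hf]
  exact toL2_ae (memLp_mul hf u)

lemma inner_mulOp_left {f : ℝ → ℝ} (hf : BddMul f) (u v : L2unit) :
    inner ℝ (mulOp f u) v = inner ℝ u (mulOp f v) := by
  rw [inner_eq_integral, inner_eq_integral]
  refine integral_congr_ae ?_
  filter_upwards [mulOp_ae hf u, mulOp_ae hf v] with x h1 h2
  rw [h1, h2]; ring

/-! ### Block operators and Volterra operators -/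

/-- A `2 × 2` matrix of operators. -/
noncomputable def blockOp (A B C D : L2unit →L[ℝ] L2unit) : (L2unit × L2unit) →L[ℝ] (L2unit × L2unit) :=
  (A.coprod B).prod (C.coprod D)

@[simp]
lemma blockOp_apply (A B C D : L2unit →L[ℝ] L2unit) (w : L2unit × L2unit) :
    blockOp A B C D w = (A w.1 + B w.2, C w.1 + D w.2) := rfl

lemma norm_blockOp_le {A B C D : L2unit →L[ℝ] L2unit} {c : ℝ} (hA : ‖A‖ ≤ c) (hB : ‖B‖ ≤ c)
    (hC : ‖C‖ ≤ c) (hD : ‖D‖ ≤ c) : ‖blockOp A B C D‖ ≤ 2 * c := by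
  have hc : 0 ≤ c := (norm_nonneg _).trans hA
  refine ContinuousLinearMap.opNorm_le_bound _ (by positivity) fun w => ?_
  have h1 : ‖w.1‖ ≤ ‖w‖ := norm_fst_le w
  have h2 : ‖w.2‖ ≤ ‖w‖ := norm_snd_le w
  have key : ∀ {S T : L2unit →L[ℝ] L2unit}, ‖S‖ ≤ c → ‖T‖ ≤ c → ‖S w.1 + T w.2‖ ≤ 2 * c * ‖w‖ := by
    intro S T hS hT
    calc ‖S w.1 + T w.2‖ ≤ ‖S w.1‖ + ‖T w.2‖ := norm_add_le _ _
      _ ≤ c * ‖w‖ + c * ‖w‖ := add_le_add (S.le_of_opNorm_le_of_le hS h1)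
          (T.le_of_opNorm_le_of_le hT h2)
      _ = _ := by ring
  exact max_le (key hA hB) (key hC hD)

lemma integral_exp_neg_abs_le {γ : ℝ} (hγ : 0 < γ) {x : ℝ} (hx : x ∈ Icc (0 : ℝ) 1) :
    ∫ ξ in Icc (0 : ℝ) 1, Real.exp (-(2 * γ * |x - ξ|)) ≤ 1 / γ := by
  have hc : Continuous fun ξ => Real.exp (-(2 * γ * |x - ξ|)) := by fun_prop
  rw [integral_Icc_eq_integral_Ioc, ← intervalIntegral.integral_of_le zero_le_one,
    ← intervalIntegral.integral_add_adjacent_intervals (b := x) (hc.intervalIntegrable _ _)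
      (hc.intervalIntegrable _ _)]
  have h1 : ∫ ξ in (0 : ℝ)..x, Real.exp (-(2 * γ * |x - ξ|)) ≤ 1 / (2 * γ) := by
    have : ∫ ξ in (0 : ℝ)..x, Real.exp (-(2 * γ * |x - ξ|)) =
        Real.exp (-(2 * γ * (x - x))) / (2 * γ) - Real.exp (-(2 * γ * (x - 0))) / (2 * γ) := by
      rw [← intervalIntegral.integral_eq_sub_of_hasDerivAt
        (f := fun ξ => Real.exp (-(2 * γ * (x - ξ))) / (2 * γ))
        (f' := fun ξ => Real.exp (-(2 * γ * (x - ξ))))]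
      · refine intervalIntegral.integral_congr fun ξ hξ => ?_
        rw [uIcc_of_le hx.1] at hξ
        simp only [abs_of_nonneg (sub_nonneg.2 hξ.2)]
      · intro ξ _
        have h := ((((hasDerivAt_id ξ).const_sub x).const_mul (2 * γ)).neg.exp).div_const (2 * γ)
        refine h.congr_deriv ?_
        simp only [id, Pi.neg_apply]
        field_simp
      · exact (by fun_prop : Continuous fun ξ => Real.exp (-(2 * γ * (x - ξ)))).intervalIntegrable _ _
    rw [this]
    have : 0 ≤ Real.exp (-(2 * γ * (x - 0))) / (2 * γ) := by positivity
    simp only [sub_self, mul_zero, neg_zero, Real.exp_zero] at this ⊢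
    linarith
  have h2 : ∫ ξ in x..1, Real.exp (-(2 * γ * |x - ξ|)) ≤ 1 / (2 * γ) := by
    have : ∫ ξ in x..1, Real.exp (-(2 * γ * |x - ξ|)) =
        -Real.exp (-(2 * γ * (1 - x))) / (2 * γ) - -Real.exp (-(2 * γ * (x - x))) / (2 * γ) := by
      rw [← intervalIntegral.integral_eq_sub_of_hasDerivAt
        (f := fun ξ => -Real.exp (-(2 * γ * (ξ - x))) / (2 * γ))
        (f' := fun ξ => Real.exp (-(2 * γ * (ξ - x))))]
      · refine intervalIntegral.integral_congr fun ξ hξ => ?_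
        rw [uIcc_of_le hx.2] at hξ
        simp only [abs_of_nonpos (sub_nonpos.2 hξ.1), neg_sub]
      · intro ξ _
        have h := ((((hasDerivAt_id ξ).sub_const x).const_mul (2 * γ)).neg.exp).neg.div_const (2 * γ)
        refine h.congr_deriv ?_
        simp only [id, Pi.neg_apply]
        field_simp
      · exact (by fun_prop : Continuous fun ξ => Real.exp (-(2 * γ * (ξ - x)))).intervalIntegrable _ _
    rw [this]
    have : 0 ≤ Real.exp (-(2 * γ * (1 - x))) / (2 * γ) := by positivity
    simp only [sub_self, mul_zero, neg_zero, Real.exp_zero, neg_div] at this ⊢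
    linarith
  calc _ ≤ 1 / (2 * γ) + 1 / (2 * γ) := add_le_add h1 h2
    _ = 1 / γ := by field_simp; norm_num

/-- A kernel is of Volterra type if it vanishes on one side of the diagonal. -/
structure VolterraKernel (ς : ℝ) (k : ℝ → ℝ → ℝ) : Prop extends BddKernel k where
  supp : ∀ x ξ, k x ξ ≠ 0 → 0 ≤ ς * (x - ξ)

lemma VolterraKernel.transpose {ς : ℝ} {k : ℝ → ℝ → ℝ} (hk : VolterraKernel ς k) :
    VolterraKernel (-ς) fun x ξ => k ξ x :=
  ⟨hk.toBddKernel.transpose, fun x ξ h => by have := hk.supp ξ x h; linarith⟩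

/-- The kernel of a Volterra operator conjugated by an exponential weight. -/
noncomputable def weightedKernel (ς γ : ℝ) (k : ℝ → ℝ → ℝ) (x ξ : ℝ) : ℝ :=
  Real.exp (-(γ * (ς * (x - ξ)))) * k x ξ

lemma abs_weightedKernel_le {ς γ M : ℝ} {k : ℝ → ℝ → ℝ} (hς : |ς| = 1) (hk : VolterraKernel ς k)
    (hM : ∀ x ξ, |k x ξ| ≤ M) (x ξ : ℝ) :
    |weightedKernel ς γ k x ξ| ≤ M * Real.exp (-(γ * |x - ξ|)) := by
  rw [weightedKernel, abs_mul, abs_of_pos (Real.exp_pos _), mul_comm]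
  by_cases h : k x ξ = 0
  · have hM0 : 0 ≤ M := (abs_nonneg _).trans (hM 0 0)
    rw [h, abs_zero, zero_mul]
    positivity
  · have : ς * (x - ξ) = |x - ξ| := by
      rw [← abs_of_nonneg (hk.supp x ξ h), abs_mul, hς, one_mul]
    rw [this]
    exact mul_le_mul_of_nonneg_right (hM x ξ) (Real.exp_pos _).le

lemma bddKernel_weightedKernel {ς γ : ℝ} {k : ℝ → ℝ → ℝ} (hς : |ς| = 1) (hγ : 0 < γ)
    (hk : VolterraKernel ς k) : BddKernel (weightedKernel ς γ k) := by
  obtain ⟨M, hM⟩ := hk.bdd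
  have hM0 : 0 ≤ M := (abs_nonneg _).trans (hM 0 0)
  refine ⟨?_, M, fun x ξ => (abs_weightedKernel_le hς hk hM x ξ).trans ?_⟩
  · exact (by fun_prop : Continuous fun p : ℝ × ℝ =>
      Real.exp (-(γ * (ς * (p.1 - p.2))))).measurable.mul hk.meas
  · have : 0 ≤ γ * |x - ξ| := by positivity
    exact mul_le_of_le_one_right hM0 (Real.exp_le_one_iff.2 (by linarith))

/-- On the support of a Volterra kernel the weight is exp(-γ|x - ξ|), and the integral of its square
over [0,1] is at most 1 / γ. -/
lemma norm_intOp_weightedKernel_le {ς γ M c : ℝ} {k : ℝ → ℝ → ℝ} (hς : |ς| = 1) (hγ : 0 < γ)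
    (hk : VolterraKernel ς k) (hM : ∀ x ξ, |k x ξ| ≤ M) (hc : 0 ≤ c) (hMc : M ^ 2 / γ ≤ c ^ 2) :
    ‖intOp (weightedKernel ς γ k)‖ ≤ c := by
  have hb := bddKernel_weightedKernel hς hγ hk
  refine norm_intOp_le hb hc fun x hx => ?_
  have hci : Integrable (fun ξ => M ^ 2 * Real.exp (-(2 * γ * |x - ξ|))) unitMeasure :=
    (by fun_prop : Continuous fun ξ => M ^ 2 * Real.exp (-(2 * γ * |x - ξ|))).integrableOn_Icc
  calc _ ≤ ∫ ξ in Icc (0 : ℝ) 1, M ^ 2 * Real.exp (-(2 * γ * |x - ξ|)) := by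
        refine integral_mono (hb.memLp x).integrable_sq hci fun ξ => ?_
        have h := abs_weightedKernel_le (γ := γ) hς hk hM x ξ
        calc weightedKernel ς γ k x ξ ^ 2 ≤ (M * Real.exp (-(γ * |x - ξ|))) ^ 2 :=
              sq_le_sq' (abs_le.1 h).1 (abs_le.1 h).2
          _ = _ := by rw [mul_pow, ← Real.exp_nat_mul]; congr 2; push_cast; ring
    _ = M ^ 2 * ∫ ξ in Icc (0 : ℝ) 1, Real.exp (-(2 * γ * |x - ξ|)) := integral_const_mul _ _
    _ ≤ M ^ 2 * (1 / γ) := mul_le_mul_of_nonneg_left (integral_exp_neg_abs_le hγ hx) (sq_nonneg _)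
    _ ≤ c ^ 2 := by rwa [mul_one_div]

/-- The weight used to conjugate Volterra operators. -/
noncomputable def expWeight (a : ℝ) (x : ℝ) : ℝ := Real.exp (a * clamp x)

lemma bddMul_expWeight (a : ℝ) : BddMul (expWeight a) := by
  refine ⟨by unfold expWeight; fun_prop, Real.exp |a|, fun x => ?_⟩
  rw [expWeight, abs_of_pos (Real.exp_pos _), Real.exp_le_exp]
  obtain ⟨h0, h1⟩ := clamp_mem x
  calc a * clamp x ≤ |a| * clamp x := mul_le_mul_of_nonneg_right (le_abs_self a) h0
    _ ≤ |a| := mul_le_of_le_one_right (abs_nonneg a) h1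

lemma mulOp_expWeight_neg (a : ℝ) : mulOp (expWeight a) * mulOp (expWeight (-a)) = 1 := by
  refine ContinuousLinearMap.ext fun u => Lp.ext ?_
  filter_upwards [mulOp_ae (bddMul_expWeight a) (mulOp (expWeight (-a)) u),
    mulOp_ae (bddMul_expWeight (-a)) u] with x h1 h2
  change mulOp (expWeight a) (mulOp (expWeight (-a)) u) x = u x
  rw [h1, h2, ← mul_assoc, expWeight, expWeight, ← Real.exp_add]
  simp

/-- The weight factors as a product of a function of x and a function of ξ, so weighting a kernel is
conjugation by multiplication operators and does not affect invertibility of the identity minus the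
operator. -/
lemma intOp_eq_conj {ς γ : ℝ} {k : ℝ → ℝ → ℝ} (hς : |ς| = 1) (hγ : 0 < γ)
    (hk : VolterraKernel ς k) : intOp k =
      mulOp (expWeight (γ * ς)) * intOp (weightedKernel ς γ k) * mulOp (expWeight (-(γ * ς))) := by
  refine ContinuousLinearMap.ext fun u => Lp.ext ?_
  have hb := bddKernel_weightedKernel hς hγ hk
  change intOp k u =ᵐ[unitMeasure] mulOp (expWeight (γ * ς))
    (intOp (weightedKernel ς γ k) (mulOp (expWeight (-(γ * ς))) u))
  filter_upwards [mulOp_ae (bddMul_expWeight (γ * ς))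
    (intOp (weightedKernel ς γ k) (mulOp (expWeight (-(γ * ς))) u)),
    intOp_ae hb (mulOp (expWeight (-(γ * ς))) u), intOp_ae hk.toBddKernel u, ae_unit_mem]
    with x h1 h2 h3 hx
  rw [h1, h2, h3, intFun, intFun, ← integral_const_mul]
  refine integral_congr_ae ?_
  filter_upwards [mulOp_ae (bddMul_expWeight (-(γ * ς))) u, ae_unit_mem] with ξ h4 hξ
  rw [h4, expWeight, expWeight, weightedKernel, clamp_of_mem hx, clamp_of_mem hξ]
  have : Real.exp (γ * ς * x) * Real.exp (-(γ * (ς * (x - ξ)))) * Real.exp (-(γ * ς) * ξ) = 1 := by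
    rw [← Real.exp_add, ← Real.exp_add, Real.exp_eq_one_iff]
    ring
  linear_combination (-(k x ξ * u ξ)) * this

/-- The identity minus a matrix of Volterra operators is invertible. -/
lemma isUnit_one_sub_volterra {ς : ℝ} (hς : |ς| = 1) {k₁₁ k₁₂ k₂₁ k₂₂ : ℝ → ℝ → ℝ}
    (h₁₁ : VolterraKernel ς k₁₁) (h₁₂ : VolterraKernel ς k₁₂) (h₂₁ : VolterraKernel ς k₂₁)
    (h₂₂ : VolterraKernel ς k₂₂) :
    IsUnit (1 - blockOp (intOp k₁₁) (intOp k₁₂) (intOp k₂₁) (intOp k₂₂)) := by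
  obtain ⟨M, hM₁₁, hM₁₂, hM₂₁, hM₂₂⟩ : ∃ M, (∀ x ξ, |k₁₁ x ξ| ≤ M) ∧ (∀ x ξ, |k₁₂ x ξ| ≤ M) ∧
      (∀ x ξ, |k₂₁ x ξ| ≤ M) ∧ (∀ x ξ, |k₂₂ x ξ| ≤ M) := by
    obtain ⟨M₁, h1⟩ := h₁₁.bdd
    obtain ⟨M₂, h2⟩ := h₁₂.bdd
    obtain ⟨M₃, h3⟩ := h₂₁.bdd
    obtain ⟨M₄, h4⟩ := h₂₂.bdd
    have n1 := (abs_nonneg _).trans (h1 0 0)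
    have n2 := (abs_nonneg _).trans (h2 0 0)
    have n3 := (abs_nonneg _).trans (h3 0 0)
    have n4 := (abs_nonneg _).trans (h4 0 0)
    exact ⟨M₁ + M₂ + M₃ + M₄, fun x ξ => (h1 x ξ).trans (by linarith),
      fun x ξ => (h2 x ξ).trans (by linarith), fun x ξ => (h3 x ξ).trans (by linarith),
      fun x ξ => (h4 x ξ).trans (by linarith)⟩
  -- With this γ each weighted entry has norm at most 1/4, hence the block operator at most 1/2, and
  -- the Neumann series converges.
  set γ : ℝ := 16 * M ^ 2 + 1 with hγ
  have hγ0 : 0 < γ := by positivity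
  have hMγ : M ^ 2 / γ ≤ (1 / 4 : ℝ) ^ 2 := by
    rw [div_le_iff₀ hγ0, hγ]; linarith
  set V := blockOp (intOp (weightedKernel ς γ k₁₁)) (intOp (weightedKernel ς γ k₁₂))
    (intOp (weightedKernel ς γ k₂₁)) (intOp (weightedKernel ς γ k₂₂)) with hV
  set E := blockOp (mulOp (expWeight (γ * ς))) 0 0 (mulOp (expWeight (γ * ς))) with hE
  set E' := blockOp (mulOp (expWeight (-(γ * ς)))) 0 0 (mulOp (expWeight (-(γ * ς)))) with hE'
  have m1 : ∀ a (u : L2unit), mulOp (expWeight a) (mulOp (expWeight (-a)) u) = u := fun a u =>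
    DFunLike.congr_fun (mulOp_expWeight_neg a) u
  have m2 : ∀ a (u : L2unit), mulOp (expWeight (-a)) (mulOp (expWeight a) u) = u := fun a u => by
    simpa using m1 (-a) u
  have hEE' : E * E' = 1 := ContinuousLinearMap.ext fun w => by
    change E (E' w) = w
    simp [hE, hE', m1]
  have hE'E : E' * E = 1 := ContinuousLinearMap.ext fun w => by
    change E' (E w) = w
    simp [hE, hE', m2]
  have hconj : blockOp (intOp k₁₁) (intOp k₁₂) (intOp k₂₁) (intOp k₂₂) = E * V * E' := by
    refine ContinuousLinearMap.ext fun w => ?_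
    change _ = E (V (E' w))
    rw [intOp_eq_conj hς hγ0 h₁₁, intOp_eq_conj hς hγ0 h₁₂, intOp_eq_conj hς hγ0 h₂₁,
      intOp_eq_conj hς hγ0 h₂₂]
    simp [hE, hE', hV]
  have hVn : ‖V‖ < 1 := by
    refine (norm_blockOp_le (norm_intOp_weightedKernel_le hς hγ0 h₁₁ hM₁₁ (by norm_num) hMγ)
      (norm_intOp_weightedKernel_le hς hγ0 h₁₂ hM₁₂ (by norm_num) hMγ)
      (norm_intOp_weightedKernel_le hς hγ0 h₂₁ hM₂₁ (by norm_num) hMγ)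
      (norm_intOp_weightedKernel_le hς hγ0 h₂₂ hM₂₂ (by norm_num) hMγ)).trans_lt ?_
    norm_num
  have hu : IsUnit (1 - V) := isUnit_one_sub_of_norm_lt_one hVn
  have hEu : IsUnit E := ⟨⟨E, E', hEE', hE'E⟩, rfl⟩
  have hEu' : IsUnit E' := ⟨⟨E', E, hE'E, hEE'⟩, rfl⟩
  have : 1 - blockOp (intOp k₁₁) (intOp k₁₂) (intOp k₂₁) (intOp k₂₂) = E * (1 - V) * E' := by
    rw [hconj, mul_sub, sub_mul, mul_one, hEE']
  rw [this]
  exact (hEu.mul hu).mul hEu'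

/-! ### The backstepping transformation and its adjoint on `L²` -/

/-- A kernel on the triangle, extended by zero. -/
noncomputable def triKernel (M : ℝ → ℝ → ℝ) (x ξ : ℝ) : ℝ :=
  kernelTriangle.indicator (fun p => M p.1 p.2) (x, ξ)

lemma triKernel_of_mem {M : ℝ → ℝ → ℝ} {x ξ : ℝ} (h : (x, ξ) ∈ kernelTriangle) :
    triKernel M x ξ = M x ξ := indicator_of_mem h _

lemma triKernel_of_notMem {M : ℝ → ℝ → ℝ} {x ξ : ℝ} (h : (x, ξ) ∉ kernelTriangle) :
    triKernel M x ξ = 0 := indicator_of_notMem h _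

lemma volterraKernel_triKernel {M : ℝ → ℝ → ℝ}
    (hM : ContinuousOn (fun p : ℝ × ℝ => M p.1 p.2) kernelTriangle) :
    VolterraKernel 1 (triKernel M) := by
  refine ⟨⟨?_, ?_⟩, fun x ξ h => ?_⟩
  · have : Function.uncurry (triKernel M) =
        kernelTriangle.indicator fun p => M (triRetract p).1 (triRetract p).2 := by
      funext ⟨x, ξ⟩
      by_cases h : (x, ξ) ∈ kernelTriangle
      · simp only [Function.uncurry, triKernel_of_mem h, indicator_of_mem h, triRetract_of_mem h]
      · simp only [Function.uncurry, triKernel_of_notMem h, indicator_of_notMem h]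
    rw [this]
    exact (continuous_comp_triRetract hM).measurable.indicator
      isCompact_kernelTriangle.isClosed.measurableSet
  · obtain ⟨C, hC⟩ := isCompact_kernelTriangle.exists_bound_of_continuousOn hM
    have hC0 : 0 ≤ C := (norm_nonneg _).trans (hC (0, 0) ⟨le_rfl, le_rfl, zero_le_one⟩)
    refine ⟨C, fun x ξ => ?_⟩
    by_cases h : (x, ξ) ∈ kernelTriangle
    · rw [triKernel_of_mem h]; exact hC _ h
    · rwa [triKernel_of_notMem h, abs_zero]
  · have hx : (x, ξ) ∈ kernelTriangle := by
      by_contra h'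
      exact h (triKernel_of_notMem h')
    linarith [hx.2.1]

lemma intFun_triKernel_transpose {M : ℝ → ℝ → ℝ} (u : L2unit) {ξ : ℝ} (hξ : ξ ∈ Icc (0 : ℝ) 1) :
    intFun (fun ξ x => triKernel M x ξ) u ξ = ∫ x in ξ..1, M x ξ * u x := by
  rw [intFun, intervalIntegral.integral_of_le hξ.2, ← integral_Icc_eq_integral_Ioc]
  have h1 : Icc ξ 1 ⊆ Icc (0 : ℝ) 1 := Icc_subset_Icc_left hξ.1
  rw [setIntegral_eq_of_subset_of_forall_sdiff_eq_zero measurableSet_Icc h1]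
  · refine setIntegral_congr_fun measurableSet_Icc fun x hx => ?_
    simp only [triKernel_of_mem (show (x, ξ) ∈ kernelTriangle from ⟨hξ.1, hx.1, hx.2⟩)]
  · intro x hx
    rw [triKernel_of_notMem, zero_mul]
    exact fun h => hx.2 ⟨h.2.1, h.2.2⟩

lemma intOp_triKernel_transpose {M : ℝ → ℝ → ℝ}
    (hM : ContinuousOn (fun p : ℝ × ℝ => M p.1 p.2) kernelTriangle) {f : ℝ → ℝ}
    (hf : ContinuousOn f (Icc 0 1)) :
    intOp (fun ξ x => triKernel M x ξ) (toL2 f) = toL2 fun ξ => ∫ x in ξ..1, M x ξ * f x := by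
  rw [intOp_apply (volterraKernel_triKernel hM).toBddKernel.transpose]
  refine toL2_congr fun ξ hξ => ?_
  rw [intFun_triKernel_transpose _ hξ, intervalIntegral.integral_of_le hξ.2,
    intervalIntegral.integral_of_le hξ.2]
  refine setIntegral_congr_ae measurableSet_Ioc ?_
  have := (ae_restrict_iff' measurableSet_Icc).1 (toL2_ae_of_continuousOn hf)
  filter_upwards [this] with x hx hx'
  rw [hx ⟨hξ.1.trans hx'.1.le, hx'.2⟩]

/-- For fixed x the extended kernel jumps in ξ only at ξ = x. Dominated convergence therefore makes
the image continuous even for a merely square integrable argument. -/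
lemma exists_continuousOn_intOp {M : ℝ → ℝ → ℝ}
    (hM : ContinuousOn (fun p : ℝ × ℝ => M p.1 p.2) kernelTriangle) (u : L2unit) :
    ∃ f, ContinuousOn f (Icc 0 1) ∧ intOp (fun ξ x => triKernel M x ξ) u = toL2 f := by
  have hc := continuous_comp_triRetract hM
  obtain ⟨C, hC⟩ := isCompact_kernelTriangle.exists_bound_of_continuousOn hM
  let G : ℝ → ℝ → ℝ := fun ξ x =>
    (Ici ξ).indicator (fun x => M (triRetract (x, ξ)).1 (triRetract (x, ξ)).2 * u x) x
  refine ⟨fun ξ => ∫ x in Icc (0 : ℝ) 1, G ξ x, Continuous.continuousOn ?_, ?_⟩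
  · refine continuous_iff_continuousAt.2 fun ξ₀ => ?_
    refine continuousAt_of_dominated (bound := fun x => C * ‖u x‖) ?_ ?_
      ((integrable_coe u).norm.const_mul C) ?_
    · refine Eventually.of_forall fun ξ => AEStronglyMeasurable.indicator ?_ measurableSet_Ici
      exact (hc.comp (by fun_prop : Continuous fun x : ℝ => (x, ξ))).aestronglyMeasurable.mul
        (Lp.aestronglyMeasurable u)
    · refine Eventually.of_forall fun ξ => Eventually.of_forall fun x => ?_
      refine (norm_indicator_le_norm_self _ _).trans ?_
      rw [norm_mul]
      exact mul_le_mul_of_nonneg_right (hC _ (triRetract_mem _)) (norm_nonneg _)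
    · have : ∀ᵐ x ∂unitMeasure, x ≠ ξ₀ := ae_restrict_of_ae (Measure.ae_ne volume ξ₀)
      filter_upwards [this] with x hx
      have hcx : Continuous fun ξ => M (triRetract (x, ξ)).1 (triRetract (x, ξ)).2 * u x :=
        (hc.comp (by fun_prop : Continuous fun ξ : ℝ => (x, ξ))).mul continuous_const
      rcases lt_or_gt_of_ne hx with h | h
      · refine (continuousAt_const (y := (0 : ℝ))).congr ?_
        filter_upwards [lt_mem_nhds h] with ξ hξ
        have : x ∉ Ici ξ := not_le.2 hξ
        simp only [G, indicator_of_notMem (M := ℝ) this]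
      · refine hcx.continuousAt.congr ?_
        filter_upwards [gt_mem_nhds h] with ξ hξ
        have : x ∈ Ici ξ := hξ.le
        simp only [G, indicator_of_mem (M := ℝ) this]
  · rw [intOp_apply (volterraKernel_triKernel hM).toBddKernel.transpose]
    refine toL2_congr fun ξ hξ => ?_
    refine setIntegral_congr_fun measurableSet_Icc fun x hx => ?_
    by_cases h : ξ ≤ x
    · have hT : (x, ξ) ∈ kernelTriangle := ⟨hξ.1, h, hx.2⟩
      simp only [G, indicator_of_mem (show x ∈ Ici ξ from h), triKernel_of_mem hT,
        triRetract_of_mem hT]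
    · have hT : (x, ξ) ∉ kernelTriangle := fun hT => h hT.2.1
      simp only [G, indicator_of_notMem (show x ∉ Ici ξ from h), triKernel_of_notMem hT, zero_mul]

/-- The backstepping transformation. -/
noncomputable def backOp (K : KernelMatrix) : (L2unit × L2unit) →L[ℝ] (L2unit × L2unit) :=
  1 - blockOp (intOp (triKernel K.uu)) (intOp (triKernel K.uv)) (intOp (triKernel K.vu))
    (intOp (triKernel K.vv))

/-- The adjoint of the backstepping transformation. -/
noncomputable def adjOp (K : KernelMatrix) : (L2unit × L2unit) →L[ℝ] (L2unit × L2unit) :=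
  1 - blockOp (intOp fun ξ x => triKernel K.uu x ξ) (intOp fun ξ x => triKernel K.vu x ξ)
    (intOp fun ξ x => triKernel K.uv x ξ) (intOp fun ξ x => triKernel K.vv x ξ)

/-- The pairing of two states. -/
noncomputable def pairing (w Φ : L2unit × L2unit) : ℝ := inner ℝ w.1 Φ.1 + inner ℝ w.2 Φ.2

/-! ### Invertibility, duality, and regularity of the adjoint transformation -/

section

variable {P : HyperbolicPlant} {K : KernelMatrix}

lemma isUnit_backOp (hK : P.IsBacksteppingKernel K) : IsUnit (backOp K) :=
  isUnit_one_sub_volterra (abs_one) (volterraKernel_triKernel hK.cont_uu)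
    (volterraKernel_triKernel hK.cont_uv) (volterraKernel_triKernel hK.cont_vu)
    (volterraKernel_triKernel hK.cont_vv)

lemma isUnit_adjOp (hK : P.IsBacksteppingKernel K) : IsUnit (adjOp K) :=
  isUnit_one_sub_volterra (ς := -1) (by simp) (volterraKernel_triKernel hK.cont_uu).transpose
    (volterraKernel_triKernel hK.cont_vu).transpose (volterraKernel_triKernel hK.cont_uv).transpose
    (volterraKernel_triKernel hK.cont_vv).transpose

lemma pairing_backOp (hK : P.IsBacksteppingKernel K) (w Φ : L2unit × L2unit) :
    pairing (backOp K w) Φ = pairing w (adjOp K Φ) := by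
  simp only [pairing, backOp, adjOp, sub_apply, one_apply_eq_self,
    blockOp_apply, Prod.fst_sub, Prod.snd_sub, inner_sub_left, inner_sub_right, inner_add_left,
    inner_add_right]
  rw [inner_intOp_left (volterraKernel_triKernel hK.cont_uu).toBddKernel,
    inner_intOp_left (volterraKernel_triKernel hK.cont_uv).toBddKernel,
    inner_intOp_left (volterraKernel_triKernel hK.cont_vu).toBddKernel,
    inner_intOp_left (volterraKernel_triKernel hK.cont_vv).toBddKernel]
  ring

lemma toL2_add {f g : ℝ → ℝ} (hf : MemLp f 2 unitMeasure) (hg : MemLp g 2 unitMeasure) :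
    toL2 f + toL2 g = toL2 fun x => f x + g x := by
  refine Lp.ext ?_
  filter_upwards [Lp.coeFn_add (toL2 f) (toL2 g), toL2_ae hf, toL2_ae hg, toL2_ae (hf.add hg)]
    with x h1 h2 h3 h4
  rw [h1, Pi.add_apply, h2, h3]
  exact h4.symm

lemma toL2_sub {f g : ℝ → ℝ} (hf : MemLp f 2 unitMeasure) (hg : MemLp g 2 unitMeasure) :
    toL2 f - toL2 g = toL2 fun x => f x - g x := by
  refine Lp.ext ?_
  filter_upwards [Lp.coeFn_sub (toL2 f) (toL2 g), toL2_ae hf, toL2_ae hg, toL2_ae (hf.sub hg)]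
    with x h1 h2 h3 h4
  rw [h1, Pi.sub_apply, h2, h3]
  exact h4.symm

lemma adjOp_toL2 (hK : P.IsBacksteppingKernel K) {φ ψ : ℝ → ℝ} (hφ : ContinuousOn φ (Icc 0 1))
    (hψ : ContinuousOn ψ (Icc 0 1)) :
    adjOp K (toL2 φ, toL2 ψ) = (toL2 (adjFst K φ ψ), toL2 (adjSnd K φ ψ)) := by
  have key : ∀ {M N : ℝ → ℝ → ℝ}, ContinuousOn (fun p : ℝ × ℝ => M p.1 p.2) kernelTriangle →
      ContinuousOn (fun p : ℝ × ℝ => N p.1 p.2) kernelTriangle → ∀ {f}, ContinuousOn f (Icc 0 1) →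
      toL2 f - (toL2 (fun ξ => ∫ x in ξ..1, M x ξ * φ x) + toL2 fun ξ => ∫ x in ξ..1, N x ξ * ψ x) =
        toL2 fun ξ => f ξ - ∫ x in ξ..1, (M x ξ * φ x + N x ξ * ψ x) := by
    intro M N hM hN f hf
    have c1 := continuousOn_volterra (M := fun x ξ => M x ξ * φ x) (continuousOn_mul_fst hM hφ)
    have c2 := continuousOn_volterra (M := fun x ξ => N x ξ * ψ x) (continuousOn_mul_fst hN hψ)
    rw [toL2_add (memLp_of_continuousOn c1) (memLp_of_continuousOn c2),
      toL2_sub (g := fun ξ => (∫ x in ξ..1, M x ξ * φ x) + ∫ x in ξ..1, N x ξ * ψ x)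
        (memLp_of_continuousOn hf) (memLp_of_continuousOn (c1.add c2))]
    refine toL2_congr fun ξ hξ => ?_
    rw [intervalIntegral.integral_add (intervalIntegrable_slice hM hφ hξ)
      (intervalIntegrable_slice hN hψ hξ)]
  simp only [adjOp, sub_apply, one_apply_eq_self, blockOp_apply]
  rw [intOp_triKernel_transpose hK.cont_uu hφ, intOp_triKernel_transpose hK.cont_vu hψ,
    intOp_triKernel_transpose hK.cont_uv hφ, intOp_triKernel_transpose hK.cont_vv hψ]
  exact Prod.ext (key hK.cont_uu hK.cont_vu hφ) (key hK.cont_uv hK.cont_vv hψ)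

/-- The inverse of the adjoint transformation preserves continuity. -/
lemma exists_continuousOn_adjOp_eq (hK : P.IsBacksteppingKernel K) {φ ψ : ℝ → ℝ}
    (hφ : ContinuousOn φ (Icc 0 1)) (hψ : ContinuousOn ψ (Icc 0 1)) :
    ∃ f g, ContinuousOn f (Icc 0 1) ∧ ContinuousOn g (Icc 0 1) ∧
      adjOp K (toL2 f, toL2 g) = (toL2 φ, toL2 ψ) := by
  obtain ⟨T, hT⟩ := isUnit_adjOp hK
  set h : L2unit × L2unit := (↑T⁻¹ : (L2unit × L2unit) →L[ℝ] (L2unit × L2unit)) (toL2 φ, toL2 ψ) with hh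
  have hTh : adjOp K h = (toL2 φ, toL2 ψ) := by
    rw [← hT, hh]
    exact DFunLike.congr_fun T.mul_inv (toL2 φ, toL2 ψ)
  obtain ⟨f₁, c1, e1⟩ := exists_continuousOn_intOp hK.cont_uu h.1
  obtain ⟨f₂, c2, e2⟩ := exists_continuousOn_intOp hK.cont_vu h.2
  obtain ⟨f₃, c3, e3⟩ := exists_continuousOn_intOp hK.cont_uv h.1
  obtain ⟨f₄, c4, e4⟩ := exists_continuousOn_intOp hK.cont_vv h.2
  have m := fun {f : ℝ → ℝ} (hf : ContinuousOn f (Icc 0 1)) => memLp_of_continuousOn hf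
  -- The preimage equals (φ, ψ) plus its own image under the Volterra part. That image is
  -- continuous, so the preimage has a continuous representative.
  have hfix := hTh
  simp only [adjOp, sub_apply, one_apply_eq_self, blockOp_apply,
    e1, e2, e3, e4] at hfix
  refine ⟨fun x => φ x + (f₁ x + f₂ x), fun x => ψ x + (f₃ x + f₄ x), hφ.add (c1.add c2),
    hψ.add (c3.add c4), ?_⟩
  rw [← toL2_add (g := fun x => f₁ x + f₂ x) (m hφ) (m (c1.add c2)),
    ← toL2_add (g := fun x => f₃ x + f₄ x) (m hψ) (m (c3.add c4)),
    ← toL2_add (m c1) (m c2), ← toL2_add (m c3) (m c4), ← hTh]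
  congr 1
  have h1 := congrArg Prod.fst hfix
  have h2 := congrArg Prod.snd hfix
  simp only [Prod.fst_sub, Prod.snd_sub] at h1 h2
  exact Prod.ext (sub_eq_iff_eq_add.1 h1).symm (sub_eq_iff_eq_add.1 h2).symm

end

/-! ### The generator of the closed loop and of the target system -/

lemma IsSpeed.bddMul_inv {e : ℝ → ℝ} (he : IsSpeed e) : BddMul fun x => (e x)⁻¹ := by
  obtain ⟨m, M, hm, h⟩ := he.bdd
  refine ⟨he.continuous_inv, m⁻¹, fun x => ?_⟩
  rw [abs_of_pos (inv_pos.2 (he.pos x))]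
  exact inv_anti₀ hm (h x).1

/-- The kernel of `u ↦ ∫_x^1 u`. -/
noncomputable def upKernel (x ξ : ℝ) : ℝ := {p : ℝ × ℝ | p.1 ≤ p.2}.indicator 1 (x, ξ)

lemma upKernel_eq (x ξ : ℝ) : upKernel x ξ = if x ≤ ξ then 1 else 0 := by
  classical
  simp [upKernel, indicator_apply]

lemma bddKernel_upKernel : BddKernel upKernel := by
  refine ⟨measurable_one.indicator (isClosed_le continuous_fst continuous_snd).measurableSet,
    1, fun x ξ => ?_⟩
  rw [upKernel_eq]
  split_ifs <;> simp

lemma bddKernel_one : BddKernel fun _ _ => 1 := ⟨measurable_const, 1, fun _ _ => by simp⟩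

/-- The operator `u ↦ ∫_x^1 u`. -/
noncomputable def integralUp : L2unit →L[ℝ] L2unit := intOp upKernel

/-- The operator `u ↦ ∫_0^x u`. -/
noncomputable def integralDown : L2unit →L[ℝ] L2unit := intOp fun x ξ => upKernel ξ x

/-- The operator `u ↦ ∫_0^1 u`. -/
noncomputable def integralTotal : L2unit →L[ℝ] L2unit := intOp fun _ _ => 1

lemma intFun_upKernel (u : L2unit) {x : ℝ} (hx : x ∈ Icc (0 : ℝ) 1) :
    intFun upKernel u x = ∫ ξ in x..1, u ξ := by
  rw [intFun, intervalIntegral.integral_of_le hx.2, ← integral_Icc_eq_integral_Ioc]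
  rw [setIntegral_eq_of_subset_of_forall_sdiff_eq_zero measurableSet_Icc
    (Icc_subset_Icc_left hx.1)]
  · refine setIntegral_congr_fun measurableSet_Icc fun ξ hξ => ?_
    simp only [upKernel_eq, if_pos hξ.1, one_mul]
  · intro ξ hξ
    rw [upKernel_eq, if_neg fun h => hξ.2 ⟨h, hξ.1.2⟩, zero_mul]

lemma intFun_upKernel_transpose (u : L2unit) {x : ℝ} (hx : x ∈ Icc (0 : ℝ) 1) :
    intFun (fun x ξ => upKernel ξ x) u x = ∫ ξ in 0..x, u ξ := by
  rw [intFun, intervalIntegral.integral_of_le hx.1, ← integral_Icc_eq_integral_Ioc]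
  rw [setIntegral_eq_of_subset_of_forall_sdiff_eq_zero measurableSet_Icc
    (Icc_subset_Icc_right hx.2)]
  · refine setIntegral_congr_fun measurableSet_Icc fun ξ hξ => ?_
    simp only [upKernel_eq, if_pos hξ.2, one_mul]
  · intro ξ hξ
    rw [upKernel_eq, if_neg fun h => hξ.2 ⟨hξ.1.1, h⟩, zero_mul]

lemma intFun_one (u : L2unit) (x : ℝ) : intFun (fun _ _ => 1) u x = ∫ ξ in (0 : ℝ)..1, u ξ := by
  rw [intFun, intervalIntegral.integral_of_le zero_le_one, ← integral_Icc_eq_integral_Ioc]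
  simp only [one_mul]

lemma integralUp_ae (u : L2unit) :
    integralUp u =ᵐ[unitMeasure] fun x => ∫ ξ in x..1, u ξ := by
  filter_upwards [intOp_ae bddKernel_upKernel u, ae_unit_mem] with x h hx
  rw [integralUp, h, intFun_upKernel u hx]

lemma integralDown_ae (u : L2unit) :
    integralDown u =ᵐ[unitMeasure] fun x => ∫ ξ in 0..x, u ξ := by
  filter_upwards [intOp_ae bddKernel_upKernel.transpose u, ae_unit_mem] with x h hx
  rw [integralDown, h, intFun_upKernel_transpose u hx]

lemma integralTotal_ae (u : L2unit) :
    integralTotal u =ᵐ[unitMeasure] fun _ => ∫ ξ in (0 : ℝ)..1, u ξ := by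
  filter_upwards [intOp_ae bddKernel_one u] with x h
  rw [integralTotal, h, intFun_one]

lemma inner_integralUp_left (u v : L2unit) :
    inner ℝ (integralUp u) v = inner ℝ u (integralDown v) :=
  inner_intOp_left bddKernel_upKernel u v

lemma inner_integralDown_left (u v : L2unit) :
    inner ℝ (integralDown u) v = inner ℝ u (integralUp v) :=
  inner_intOp_left bddKernel_upKernel.transpose u v

lemma inner_integralTotal_left (u v : L2unit) :
    inner ℝ (integralTotal u) v = inner ℝ u (integralTotal v) :=
  inner_intOp_left bddKernel_one u v

/-- The inverse of `(φ,ψ) ↦ ((e₁ φ)', -(e₂ ψ)')`, `φ(1) = 0`, `e₂(0) ψ(0) = q e₁(0) φ(0)`. -/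
noncomputable def sourceOp (e₁ e₂ : ℝ → ℝ) (q : ℝ) : (L2unit × L2unit) →L[ℝ] (L2unit × L2unit) :=
  blockOp (-(mulOp fun x => (e₁ x)⁻¹) ∘L integralUp) 0
    (-(q • (mulOp fun x => (e₂ x)⁻¹) ∘L integralTotal))
    (-(mulOp fun x => (e₂ x)⁻¹) ∘L integralDown)

/-- The adjoint of `sourceOp`. -/
noncomputable def targetOp (e₁ e₂ : ℝ → ℝ) (q : ℝ) : (L2unit × L2unit) →L[ℝ] (L2unit × L2unit) :=
  blockOp (-integralDown ∘L mulOp fun x => (e₁ x)⁻¹)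
    (-(q • integralTotal ∘L mulOp fun x => (e₂ x)⁻¹)) 0
    (-integralUp ∘L mulOp fun x => (e₂ x)⁻¹)

lemma pairing_targetOp {e₁ e₂ : ℝ → ℝ} {q : ℝ} (h₁ : IsSpeed e₁) (h₂ : IsSpeed e₂)
    (w F : L2unit × L2unit) :
    pairing (targetOp e₁ e₂ q w) F = pairing w (sourceOp e₁ e₂ q F) := by
  simp only [pairing, targetOp, sourceOp, blockOp_apply, ContinuousLinearMap.comp_apply, neg_apply,
    smul_apply, zero_apply, inner_add_left, inner_add_right, inner_neg_left, inner_neg_right,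
    inner_zero_left, inner_zero_right, real_inner_smul_left, real_inner_smul_right,
    inner_integralDown_left, inner_integralUp_left, inner_integralTotal_left,
    inner_mulOp_left h₁.bddMul_inv, inner_mulOp_left h₂.bddMul_inv]
  ring

lemma hasDerivWithinAt_integral_unit {f : ℝ → ℝ} (hf : ContinuousOn f (Icc 0 1)) {x : ℝ}
    (hx : x ∈ Icc (0 : ℝ) 1) :
    HasDerivWithinAt (fun x => ∫ y in (0 : ℝ)..x, f y) (f x) (Icc 0 1) x := by
  have h := ((continuous_comp_clamp hf).integral_hasStrictDerivAt 0 x).hasDerivAt.hasDerivWithinAt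
    (s := Icc 0 1)
  rw [clamp_of_mem hx] at h
  refine h.congr (fun y hy => ?_) ?_
  all_goals
    refine intervalIntegral.integral_congr fun z hz => ?_
    rw [uIcc_of_le (by first | exact hy.1 | exact hx.1)] at hz
  · simp only [clamp_of_mem (show z ∈ Icc (0 : ℝ) 1 from ⟨hz.1, hz.2.trans hy.2⟩)]
  · simp only [clamp_of_mem (show z ∈ Icc (0 : ℝ) 1 from ⟨hz.1, hz.2.trans hx.2⟩)]

lemma integral_eq_sub_unit {f : ℝ → ℝ} (hf : IntegrableOn f (Icc 0 1)) {x : ℝ}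
    (hx : x ∈ Icc (0 : ℝ) 1) :
    ∫ y in x..1, f y = (∫ y in (0 : ℝ)..1, f y) - ∫ y in (0 : ℝ)..x, f y := by
  have h : ∀ {a b : ℝ}, a ∈ Icc (0 : ℝ) 1 → b ∈ Icc (0 : ℝ) 1 → IntervalIntegrable f volume a b :=
    fun ha hb => (hf.mono_set (uIcc_subset_Icc ha hb)).intervalIntegrable
  rw [intervalIntegral.integral_interval_sub_left (h ⟨le_rfl, zero_le_one⟩ ⟨zero_le_one, le_rfl⟩)
    (h ⟨le_rfl, zero_le_one⟩ hx)]

/-- The first component of `sourceOp`. -/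
noncomputable def sourceFst (P : HyperbolicPlant) (f : ℝ → ℝ) (x : ℝ) : ℝ :=
  (P.ε₁ x)⁻¹ * ((∫ y in (0 : ℝ)..x, f y) - ∫ y in (0 : ℝ)..1, f y)

/-- The second component of `sourceOp`. -/
noncomputable def sourceSnd (P : HyperbolicPlant) (f g : ℝ → ℝ) (x : ℝ) : ℝ :=
  (P.ε₂ x)⁻¹ * (-(P.q * ∫ y in (0 : ℝ)..1, f y) - ∫ y in (0 : ℝ)..x, g y)

/-- The operator `sourceOp` of a plant. -/
noncomputable abbrev plantSource (P : HyperbolicPlant) : (L2unit × L2unit) →L[ℝ] (L2unit × L2unit) :=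
  sourceOp (fun x => P.ε₁ (clamp x)) (fun x => P.ε₂ (clamp x)) P.q

/-! ### The domains of the two adjoint generators -/

section

variable {P : HyperbolicPlant} {K : KernelMatrix} {φ ψ f g : ℝ → ℝ}

lemma continuousOn_integral_unit (hf : ContinuousOn f (Icc 0 1)) :
    ContinuousOn (fun x => ∫ y in (0 : ℝ)..x, f y) (Icc 0 1) := fun _ hx =>
  (hasDerivWithinAt_integral_unit hf hx).continuousWithinAt

lemma IsRegular.ε₁_ne (hP : IsRegular P) : ∀ x ∈ Icc (0 : ℝ) 1, P.ε₁ x ≠ 0 := fun x hx =>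
  (hP.ε₁_pos x hx).ne'

lemma IsRegular.ε₂_ne (hP : IsRegular P) : ∀ x ∈ Icc (0 : ℝ) 1, P.ε₂ x ≠ 0 := fun x hx =>
  (hP.ε₂_pos x hx).ne'

lemma IsRegular.speed₁ (hP : IsRegular P) : IsSpeed fun x => P.ε₁ (clamp x) :=
  isSpeed_clamp hP.ε₁.continuousOn hP.ε₁_pos

lemma IsRegular.speed₂ (hP : IsRegular P) : IsSpeed fun x => P.ε₂ (clamp x) :=
  isSpeed_clamp hP.ε₂.continuousOn hP.ε₂_pos

lemma continuousOn_sourceFst (hP : IsRegular P) (hf : ContinuousOn f (Icc 0 1)) :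
    ContinuousOn (sourceFst P f) (Icc 0 1) :=
  (hP.ε₁.continuousOn.inv₀ hP.ε₁_ne).mul ((continuousOn_integral_unit hf).sub continuousOn_const)

lemma continuousOn_sourceSnd (hP : IsRegular P) (hg : ContinuousOn g (Icc 0 1)) :
    ContinuousOn (sourceSnd P f g) (Icc 0 1) :=
  (hP.ε₂.continuousOn.inv₀ hP.ε₂_ne).mul (continuousOn_const.sub (continuousOn_integral_unit hg))

lemma hasDerivWithinAt_sourceFst (hP : IsRegular P) (hf : ContinuousOn f (Icc 0 1)) {x : ℝ}
    (hx : x ∈ Icc (0 : ℝ) 1) :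
    HasDerivWithinAt (fun y => P.ε₁ y * sourceFst P f y) (f x) (Icc 0 1) x := by
  refine ((hasDerivWithinAt_integral_unit hf hx).sub_const (∫ y in (0 : ℝ)..1, f y)).congr
    (fun y hy => ?_) ?_
  · rw [sourceFst, mul_inv_cancel_left₀ (hP.ε₁_ne y hy)]
  · rw [sourceFst, mul_inv_cancel_left₀ (hP.ε₁_ne x hx)]

lemma hasDerivWithinAt_sourceSnd (hP : IsRegular P) (hg : ContinuousOn g (Icc 0 1)) {x : ℝ}
    (hx : x ∈ Icc (0 : ℝ) 1) :
    HasDerivWithinAt (fun y => P.ε₂ y * sourceSnd P f g y) (-g x) (Icc 0 1) x := by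
  refine ((hasDerivWithinAt_integral_unit hg hx).const_sub
    (-(P.q * ∫ y in (0 : ℝ)..1, f y))).congr (fun y hy => ?_) ?_
  · rw [sourceSnd, mul_inv_cancel_left₀ (hP.ε₂_ne y hy)]
  · rw [sourceSnd, mul_inv_cancel_left₀ (hP.ε₂_ne x hx)]

lemma integral_toL2 (hf : ContinuousOn f (Icc 0 1)) {a b : ℝ} (ha : a ∈ Icc (0 : ℝ) 1)
    (hb : b ∈ Icc (0 : ℝ) 1) : ∫ y in a..b, toL2 f y = ∫ y in a..b, f y := by
  refine intervalIntegral.integral_congr_ae ?_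
  filter_upwards [(ae_restrict_iff' measurableSet_Icc).1 (toL2_ae_of_continuousOn hf)] with x hx hx'
  exact hx (uIcc_subset_Icc ha hb (uIoc_subset_uIcc hx'))

lemma plantSource_toL2 (hP : IsRegular P) (hf : ContinuousOn f (Icc 0 1))
    (hg : ContinuousOn g (Icc 0 1)) :
    plantSource P (toL2 f, toL2 g) = (toL2 (sourceFst P f), toL2 (sourceSnd P f g)) := by
  have h0 : (0 : ℝ) ∈ Icc (0 : ℝ) 1 := by simp
  have h1 : (1 : ℝ) ∈ Icc (0 : ℝ) 1 := by simp
  refine Prod.ext (Lp.ext ?_) (Lp.ext ?_)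
  · have e : (plantSource P (toL2 f, toL2 g)).1 =
        -mulOp (fun x => (P.ε₁ (clamp x))⁻¹) (integralUp (toL2 f)) := by
      simp [plantSource, sourceOp]
    rw [e]
    filter_upwards [Lp.coeFn_neg (mulOp (fun x => (P.ε₁ (clamp x))⁻¹) (integralUp (toL2 f))),
      mulOp_ae hP.speed₁.bddMul_inv (integralUp (toL2 f)), integralUp_ae (toL2 f), ae_unit_mem,
      toL2_ae_of_continuousOn (continuousOn_sourceFst hP hf)] with x a1 a2 a3 hx a4
    rw [a1, Pi.neg_apply, a2, a3, a4, integral_toL2 hf hx h1, sourceFst, clamp_of_mem hx,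
      integral_eq_sub_unit hf.integrableOn_Icc hx]
    ring
  · set m := mulOp (fun x => (P.ε₂ (clamp x))⁻¹) with hm
    have e : (plantSource P (toL2 f, toL2 g)).2 =
        (-(P.q • m (integralTotal (toL2 f)))) - m (integralDown (toL2 g)) := by
      simp [plantSource, sourceOp, hm, sub_eq_add_neg]
    rw [e]
    filter_upwards [Lp.coeFn_sub (-(P.q • m (integralTotal (toL2 f)))) (m (integralDown (toL2 g))),
      Lp.coeFn_neg (P.q • m (integralTotal (toL2 f))), Lp.coeFn_smul P.q (m (integralTotal (toL2 f))),
      mulOp_ae hP.speed₂.bddMul_inv (integralTotal (toL2 f)), integralTotal_ae (toL2 f),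
      mulOp_ae hP.speed₂.bddMul_inv (integralDown (toL2 g)), integralDown_ae (toL2 g), ae_unit_mem,
      toL2_ae_of_continuousOn (continuousOn_sourceSnd (f := f) hP hg)]
      with x a1 a2 a3 a4 a5 a6 a7 hx a8
    rw [a1, Pi.sub_apply, a2, Pi.neg_apply, a3, Pi.smul_apply, a4, a5, a6, a7, a8,
      integral_toL2 hf h0 h1, integral_toL2 hg h0 hx, sourceSnd, clamp_of_mem hx, smul_eq_mul]
    ring

/-- Pairs of test functions. -/
structure IsTestPair (P : HyperbolicPlant) (φ ψ : ℝ → ℝ) : Prop where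
  fst : ContDiffOn ℝ 1 φ (Icc 0 1)
  snd : ContDiffOn ℝ 1 ψ (Icc 0 1)
  one : φ 1 = 0
  zero : P.ε₂ 0 * ψ 0 = P.q * P.ε₁ 0 * φ 0

/-- The first component of the adjoint generator of the closed loop. -/
noncomputable def genFst (P : HyperbolicPlant) (K : KernelMatrix) (φ ψ : ℝ → ℝ) (x : ℝ) : ℝ :=
  derivWithin (fun y => P.ε₁ y * φ y) (Icc 0 1) x + P.c₂ x * ψ x + P.ε₂ 1 * ψ 1 * K.vu 1 x

/-- The second component of the adjoint generator of the closed loop. -/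
noncomputable def genSnd (P : HyperbolicPlant) (K : KernelMatrix) (φ ψ : ℝ → ℝ) (x : ℝ) : ℝ :=
  -derivWithin (fun y => P.ε₂ y * ψ y) (Icc 0 1) x + P.c₁ x * φ x + P.ε₂ 1 * ψ 1 * K.vv 1 x

lemma continuousOn_kernel_one {M : ℝ → ℝ → ℝ}
    (hM : ContinuousOn (fun p : ℝ × ℝ => M p.1 p.2) kernelTriangle) :
    ContinuousOn (M 1) (Icc 0 1) :=
  hM.comp (by fun_prop : ContinuousOn (fun ξ : ℝ => ((1 : ℝ), ξ)) (Icc 0 1))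
    fun _ hξ => ⟨hξ.1, hξ.2, le_rfl⟩

lemma continuousOn_genFst (hP : IsRegular P) (hK : P.IsBacksteppingKernel K)
    (h : IsTestPair P φ ψ) : ContinuousOn (genFst P K φ ψ) (Icc 0 1) :=
  (((hP.ε₁.mul h.fst).continuousOn_derivWithin (uniqueDiffOn_Icc zero_lt_one) le_rfl).add
    (hP.c₂.mul h.snd.continuousOn)).add
    (continuousOn_const.mul (continuousOn_kernel_one hK.cont_vu))

lemma continuousOn_genSnd (hP : IsRegular P) (hK : P.IsBacksteppingKernel K)
    (h : IsTestPair P φ ψ) : ContinuousOn (genSnd P K φ ψ) (Icc 0 1) :=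
  (((hP.ε₂.mul h.snd).continuousOn_derivWithin (uniqueDiffOn_Icc zero_lt_one) le_rfl).neg.add
    (hP.c₁.mul h.fst.continuousOn)).add
    (continuousOn_const.mul (continuousOn_kernel_one hK.cont_vv))

/-- The conditions on the kernels at ξ = 0 say ε₂(0) K^{uv}(x,0) = q ε₁(0) K^{uu}(x,0) and ε₂(0)
K^{vv}(x,0) = q ε₁(0) K^{vu}(x,0). So the Volterra integrals at 0 satisfy the adjoint boundary
condition by themselves and drop out. -/
lemma bc_adj_iff (hP : IsRegular P) (hK : P.IsBacksteppingKernel K) :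
    P.ε₂ 0 * adjSnd K φ ψ 0 = P.q * P.ε₁ 0 * adjFst K φ ψ 0 ↔
      P.ε₂ 0 * ψ 0 = P.q * P.ε₁ 0 * φ 0 := by
  have h0 : (0 : ℝ) ∈ Icc (0 : ℝ) 1 := by simp
  have e1 := hP.ε₁_ne 0 h0
  have e2 := hP.ε₂_ne 0 h0
  have hq := hP.q
  have : P.ε₂ 0 * ∫ x in (0 : ℝ)..1, (K.uv x 0 * φ x + K.vv x 0 * ψ x) =
      P.q * P.ε₁ 0 * ∫ x in (0 : ℝ)..1, (K.uu x 0 * φ x + K.vu x 0 * ψ x) := by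
    rw [← intervalIntegral.integral_const_mul, ← intervalIntegral.integral_const_mul]
    refine intervalIntegral.integral_congr fun x hx => ?_
    rw [uIcc_of_le zero_le_one] at hx
    simp only [hK.bc_uu x hx, hK.bc_vv x hx]
    field_simp
  rw [adjSnd, adjFst, mul_sub, mul_sub, this, sub_left_inj]

lemma contDiffOn_of_mul {e φ p : ℝ → ℝ} (he : ContDiffOn ℝ 1 e (Icc 0 1))
    (he0 : ∀ x ∈ Icc (0 : ℝ) 1, e x ≠ 0)
    (hp : ∀ x ∈ Icc (0 : ℝ) 1, HasDerivWithinAt (fun y => e y * φ y) (p x) (Icc 0 1) x)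
    (hc : ContinuousOn p (Icc 0 1)) : ContDiffOn ℝ 1 φ (Icc 0 1) := by
  have hu := uniqueDiffOn_Icc (zero_lt_one (α := ℝ))
  have h : ContDiffOn ℝ 1 (fun y => e y * φ y) (Icc 0 1) :=
    (contDiffOn_one_iff_derivWithin hu).2 ⟨fun x hx => (hp x hx).differentiableWithinAt,
      hc.congr fun x hx => (hp x hx).derivWithin (hu x hx)⟩
  refine (h.div he he0).congr fun x hx => ?_
  rw [Pi.div_apply, mul_div_cancel_left₀ _ (he0 x hx)]

/-- The adjoint transformation maps the domain of the target generator into that of the closed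
loop. -/
lemma exists_isTestPair (hP : IsRegular P) (hK : P.IsBacksteppingKernel K)
    (hf : ContinuousOn f (Icc 0 1)) (hg : ContinuousOn g (Icc 0 1)) :
    ∃ φ ψ, IsTestPair P φ ψ ∧
      adjOp K (plantSource P (toL2 f, toL2 g)) = (toL2 φ, toL2 ψ) ∧
      adjOp K (toL2 f, toL2 g) = (toL2 (genFst P K φ ψ), toL2 (genSnd P K φ ψ)) := by
  have hu := uniqueDiffOn_Icc (zero_lt_one (α := ℝ))
  have hθ₁ := continuousOn_sourceFst hP hf
  have hθ₂ := continuousOn_sourceSnd (f := f) hP hg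
  have hθ₁1 : sourceFst P f 1 = 0 := by simp [sourceFst]
  have d1 := fun x (hx : x ∈ Icc (0 : ℝ) 1) => hasDerivWithinAt_adjFst hP hK hθ₁ hθ₂
    (fun x => hasDerivWithinAt_sourceFst hP hf) (fun x => hasDerivWithinAt_sourceSnd hP hg) hf hg.neg hx
  have d2 := fun x (hx : x ∈ Icc (0 : ℝ) 1) => hasDerivWithinAt_adjSnd hP hK hθ₁ hθ₂
    (fun x => hasDerivWithinAt_sourceFst hP hf) (fun x => hasDerivWithinAt_sourceSnd hP hg) hf hg.neg hx
  simp only [hθ₁1, mul_zero, zero_mul, add_zero, sub_zero, neg_neg] at d1 d2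
  have c1 := continuousOn_adjFst hK hθ₁ hθ₂
  have c2 := continuousOn_adjSnd hK hθ₁ hθ₂
  refine ⟨adjFst K (sourceFst P f) (sourceSnd P f g), adjSnd K (sourceFst P f) (sourceSnd P f g),
    ⟨contDiffOn_of_mul hP.ε₁ hP.ε₁_ne d1 ?_, contDiffOn_of_mul hP.ε₂ hP.ε₂_ne d2 ?_, ?_, ?_⟩, ?_, ?_⟩
  · exact ((continuousOn_adjFst hK hf hg).sub (hP.c₂.mul c2)).sub
      (continuousOn_const.mul (continuousOn_kernel_one hK.cont_vu))
  · exact ((continuousOn_adjSnd hK hf hg).neg.add (hP.c₁.mul c1)).add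
      (continuousOn_const.mul (continuousOn_kernel_one hK.cont_vv))
  · rw [adjFst_one, hθ₁1]
  · rw [bc_adj_iff hP hK]
    have h0 : (0 : ℝ) ∈ Icc (0 : ℝ) 1 := by simp
    have e1 := hP.ε₁_ne 0 h0
    have e2 := hP.ε₂_ne 0 h0
    simp only [sourceFst, sourceSnd, intervalIntegral.integral_same]
    field_simp
    ring
  · rw [plantSource_toL2 hP hf hg, adjOp_toL2 hK hθ₁ hθ₂]
  · rw [adjOp_toL2 hK hf hg]
    refine Prod.ext (toL2_congr fun x hx => ?_) (toL2_congr fun x hx => ?_)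
    · rw [genFst, (d1 x hx).derivWithin (hu x hx), adjSnd_one]; ring
    · rw [genSnd, (d2 x hx).derivWithin (hu x hx), adjSnd_one]; ring

lemma eqOn_of_toL2_eq (hf : ContinuousOn f (Icc 0 1)) (hg : ContinuousOn g (Icc 0 1))
    (h : toL2 f = toL2 g) : EqOn f g (Icc 0 1) :=
  Measure.eqOn_Icc_of_ae_eq volume zero_ne_one ((toL2_ae_of_continuousOn hf).symm.trans
    (h ▸ toL2_ae_of_continuousOn hg)) hf hg

/-- Uniqueness for a planar linear system with data at the right end point. -/
lemma eq_zero_of_hasDerivWithinAt {X Y a b : ℝ → ℝ} (ha : ContinuousOn a (Icc 0 1))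
    (hb : ContinuousOn b (Icc 0 1))
    (hX : ∀ x ∈ Icc (0 : ℝ) 1, HasDerivWithinAt X (a x * Y x) (Icc 0 1) x)
    (hY : ∀ x ∈ Icc (0 : ℝ) 1, HasDerivWithinAt Y (b x * X x) (Icc 0 1) x)
    (hX1 : X 1 = 0) (hY1 : Y 1 = 0) {x : ℝ} (hx : x ∈ Icc (0 : ℝ) 1) : X x = 0 ∧ Y x = 0 := by
  obtain ⟨A, hA⟩ := isCompact_Icc.exists_bound_of_continuousOn ha
  obtain ⟨B, hB⟩ := isCompact_Icc.exists_bound_of_continuousOn hb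
  have key : EqOn (fun x => (X x, Y x)) (fun _ => (0 : ℝ × ℝ)) (Icc 0 1) := by
    refine ODE_solution_unique_of_mem_Icc_left (v := fun t p => (a t * p.2, b t * p.1))
      (s := fun _ => univ) (K := (max A B).toNNReal) ?_ ?_ ?_ (fun _ _ => mem_univ _)
      continuousOn_const ?_ (fun _ _ => mem_univ _) (by simp [hX1, hY1])
    · intro t ht
      have ht' : t ∈ Icc (0 : ℝ) 1 := ⟨ht.1.le, ht.2⟩
      have hM : 0 ≤ max A B := le_max_of_le_left ((norm_nonneg _).trans (hA t ht'))
      refine (LipschitzWith.of_dist_le_mul fun p r => ?_).lipschitzOnWith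
      rw [Real.coe_toNNReal _ hM, Prod.dist_eq, Prod.dist_eq]
      simp only [Real.dist_eq, ← mul_sub, abs_mul]
      refine max_le ?_ ?_
      · exact mul_le_mul ((hA t ht').trans (le_max_left _ _)) (le_max_right _ _) (abs_nonneg _) hM
      · exact mul_le_mul ((hB t ht').trans (le_max_right _ _)) (le_max_left _ _) (abs_nonneg _) hM
    · exact fun t ht => (hX t ht).continuousWithinAt.prodMk (hY t ht).continuousWithinAt
    · intro t ht
      have ht' : t ∈ Icc (0 : ℝ) 1 := ⟨ht.1.le, ht.2⟩
      have hn : Icc (0 : ℝ) 1 ∈ 𝓝[Iic t] t :=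
        mem_of_superset (Ioc_mem_nhdsLE ht.1) fun y hy => ⟨hy.1.le, hy.2.trans ht.2⟩
      exact ((hX t ht').mono_of_mem_nhdsWithin hn).prodMk ((hY t ht').mono_of_mem_nhdsWithin hn)
    · intro t _
      simp only [Prod.fst_zero, Prod.snd_zero, mul_zero]
      exact hasDerivWithinAt_const _ _ _
  have := key hx
  simpa [Prod.ext_iff] using this

/-- Every element of the domain of the generator of the closed loop comes from the domain of the
target generator. -/
lemma IsTestPair.exists_source (hP : IsRegular P) (hK : P.IsBacksteppingKernel K)
    (h : IsTestPair P φ ψ) :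
    ∃ f g, ContinuousOn f (Icc 0 1) ∧ ContinuousOn g (Icc 0 1) ∧
      adjOp K (plantSource P (toL2 f, toL2 g)) = (toL2 φ, toL2 ψ) ∧
      adjOp K (toL2 f, toL2 g) = (toL2 (genFst P K φ ψ), toL2 (genSnd P K φ ψ)) := by
  have hu := uniqueDiffOn_Icc (zero_lt_one (α := ℝ))
  have h0 : (0 : ℝ) ∈ Icc (0 : ℝ) 1 := by simp
  have h1 : (1 : ℝ) ∈ Icc (0 : ℝ) 1 := by simp
  -- The source is determined by the second of the required identities; it is continuous because the
  -- adjoint transformation preserves continuity in both directions. The first identity has then to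
  -- be checked.
  obtain ⟨f, g, hf, hg, hfg⟩ := exists_continuousOn_adjOp_eq hK (continuousOn_genFst hP hK h)
    (continuousOn_genSnd hP hK h)
  refine ⟨f, g, hf, hg, ?_, hfg⟩
  rw [adjOp_toL2 hK hf hg] at hfg
  have g1 := eqOn_of_toL2_eq (continuousOn_adjFst hK hf hg) (continuousOn_genFst hP hK h)
    (congrArg Prod.fst hfg)
  have g2 := eqOn_of_toL2_eq (continuousOn_adjSnd hK hf hg) (continuousOn_genSnd hP hK h)
    (congrArg Prod.snd hfg)
  -- the preimage has the same values at the right end point as the test pair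
  set θ₁ := sourceFst P f with hθ₁
  set θ₂ : ℝ → ℝ := fun x => (P.ε₂ x)⁻¹ *
    (P.ε₂ 1 * ψ 1 + ((∫ y in (0 : ℝ)..1, g y) - ∫ y in (0 : ℝ)..x, g y)) with hθ₂
  have c1 : ContinuousOn θ₁ (Icc 0 1) := continuousOn_sourceFst hP hf
  have c2 : ContinuousOn θ₂ (Icc 0 1) := (hP.ε₂.continuousOn.inv₀ hP.ε₂_ne).mul
    (continuousOn_const.add (continuousOn_const.sub (continuousOn_integral_unit hg)))
  have hθ₁1 : θ₁ 1 = 0 := by simp [hθ₁, sourceFst]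
  have hθ₂1 : θ₂ 1 = ψ 1 := by simp [hθ₂, hP.ε₂_ne 1 h1]
  have hθ₂d : ∀ x ∈ Icc (0 : ℝ) 1, HasDerivWithinAt (fun y => P.ε₂ y * θ₂ y) (-g x) (Icc 0 1) x := by
    intro x hx
    refine (((hasDerivWithinAt_integral_unit hg hx).const_sub
      (∫ y in (0 : ℝ)..1, g y)).const_add (P.ε₂ 1 * ψ 1)).congr (fun y hy => ?_) ?_
    · rw [hθ₂, mul_inv_cancel_left₀ (hP.ε₂_ne y hy)]
    · rw [hθ₂, mul_inv_cancel_left₀ (hP.ε₂_ne x hx)]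
  have d1 := fun x (hx : x ∈ Icc (0 : ℝ) 1) => hasDerivWithinAt_adjFst hP hK c1 c2
    (fun x => hasDerivWithinAt_sourceFst hP hf) hθ₂d hf hg.neg hx
  have d2 := fun x (hx : x ∈ Icc (0 : ℝ) 1) => hasDerivWithinAt_adjSnd hP hK c1 c2
    (fun x => hasDerivWithinAt_sourceFst hP hf) hθ₂d hf hg.neg hx
  simp only [hθ₁1, hθ₂1, mul_zero, zero_mul, add_zero, sub_zero, neg_neg] at d1 d2
  have hφd : ∀ x ∈ Icc (0 : ℝ) 1, HasDerivWithinAt (fun y => P.ε₁ y * φ y)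
      (derivWithin (fun y => P.ε₁ y * φ y) (Icc 0 1) x) (Icc 0 1) x := fun x hx =>
    ((hP.ε₁.mul h.fst).differentiableOn_one x hx).hasDerivWithinAt
  have hψd : ∀ x ∈ Icc (0 : ℝ) 1, HasDerivWithinAt (fun y => P.ε₂ y * ψ y)
      (derivWithin (fun y => P.ε₂ y * ψ y) (Icc 0 1) x) (Icc 0 1) x := fun x hx =>
    ((hP.ε₂.mul h.snd).differentiableOn_one x hx).hasDerivWithinAt
  -- The test pair and the transformed pair obey the same first-order system: their sources agree by
  -- the choice of (f, g), and their feedback terms agree because θ₂(1) = ψ(1). The difference of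
  -- the fluxes solves a homogeneous linear system with zero data at 1.
  have hΔ : ∀ x ∈ Icc (0 : ℝ) 1, φ x = adjFst K θ₁ θ₂ x ∧ ψ x = adjSnd K θ₁ θ₂ x := by
    intro x hx
    have := eq_zero_of_hasDerivWithinAt (X := fun y => P.ε₁ y * φ y - P.ε₁ y * adjFst K θ₁ θ₂ y)
      (Y := fun y => P.ε₂ y * ψ y - P.ε₂ y * adjSnd K θ₁ θ₂ y)
      (a := fun y => -(P.c₂ y / P.ε₂ y)) (b := fun y => P.c₁ y / P.ε₁ y)
      (hP.c₂.div hP.ε₂.continuousOn hP.ε₂_ne).neg (hP.c₁.div hP.ε₁.continuousOn hP.ε₁_ne)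
      (fun y hy => ((hφd y hy).sub (d1 y hy)).congr_deriv ?_)
      (fun y hy => ((hψd y hy).sub (d2 y hy)).congr_deriv ?_) ?_ ?_ hx
    · rw [← mul_sub, ← mul_sub, mul_eq_zero_iff_left (hP.ε₁_ne x hx),
        mul_eq_zero_iff_left (hP.ε₂_ne x hx), sub_eq_zero, sub_eq_zero] at this
      exact this
    · rw [g1 hy, genFst]
      have := hP.ε₂_ne y hy
      field_simp
      ring
    · rw [g2 hy, genSnd]
      have := hP.ε₁_ne y hy
      field_simp
      ring
    · simp only [adjFst_one, hθ₁1, h.one, sub_self]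
    · simp only [adjSnd_one, hθ₂1, sub_self]
  -- `θ₂` was fixed by its value at 1. The boundary condition at 0, inherited from the test pair,
  -- identifies it with the second component of the source solution.
  have hbc : P.ε₂ 0 * θ₂ 0 = P.q * P.ε₁ 0 * θ₁ 0 := by
    rw [← bc_adj_iff hP hK, ← (hΔ 0 h0).1, ← (hΔ 0 h0).2]
    exact h.zero
  have hθ₂' : EqOn (sourceSnd P f g) θ₂ (Icc 0 1) := by
    intro x hx
    have e1 := hP.ε₁_ne 0 h0
    have e2 := hP.ε₂_ne 0 h0
    simp only [hθ₁, hθ₂, sourceFst, intervalIntegral.integral_same, sub_zero, zero_sub] at hbc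
    rw [mul_inv_cancel_left₀ e2, mul_assoc, mul_inv_cancel_left₀ e1] at hbc
    simp only [sourceSnd, hθ₂]
    rw [← add_sub_assoc, hbc, mul_neg]
  rw [plantSource_toL2 hP hf hg, toL2_congr hθ₂', adjOp_toL2 hK c1 c2]
  exact Prod.ext (toL2_congr fun x hx => (hΔ x hx).1.symm) (toL2_congr fun x hx => (hΔ x hx).2.symm)

end

/-! ### Reduction to the target system -/

/-- The operator `targetOp` of a plant. -/
noncomputable abbrev plantTarget (P : HyperbolicPlant) : (L2unit × L2unit) →L[ℝ] (L2unit × L2unit) :=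
  targetOp (fun x => P.ε₁ (clamp x)) (fun x => P.ε₂ (clamp x)) P.q

/-- The pairing with a fixed state as a functional. -/
noncomputable def pairingCLM (Φ : L2unit × L2unit) : (L2unit × L2unit) →L[ℝ] ℝ :=
  (innerSL ℝ Φ.1).coprod (innerSL ℝ Φ.2)

lemma pairingCLM_apply (Φ w : L2unit × L2unit) : pairingCLM Φ w = pairing w Φ := by
  simp [pairingCLM, pairing, real_inner_comm]

lemma pairing_sub_left (w z Φ : L2unit × L2unit) : pairing (w - z) Φ = pairing w Φ - pairing z Φ := by
  simp only [← pairingCLM_apply, map_sub]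

lemma eq_of_pairing_eq {w z : L2unit × L2unit} (h : ∀ F, pairing w F = pairing z F) : w = z := by
  refine Prod.ext (ext_inner_right ℝ fun f => ?_) (ext_inner_right ℝ fun f => ?_)
  · simpa [pairing] using h (f, 0)
  · simpa [pairing] using h (0, f)

lemma continuous_pairing (w : L2unit × L2unit) : Continuous (pairing w) := by
  unfold pairing; fun_prop

lemma pairing_toL2 (w : L2unit × L2unit) {φ ψ : ℝ → ℝ} (hφ : ContinuousOn φ (Icc 0 1))
    (hψ : ContinuousOn ψ (Icc 0 1)) :
    pairing w (toL2 φ, toL2 ψ) = ∫ x in Icc (0 : ℝ) 1, (w.1 x * φ x + w.2 x * ψ x) := by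
  rw [pairing, inner_toL2 _ (memLp_of_continuousOn hφ), inner_toL2 _ (memLp_of_continuousOn hψ)]
  exact (integral_add ((Lp.memLp w.1).integrable_mul (memLp_of_continuousOn hφ))
    ((Lp.memLp w.2).integrable_mul (memLp_of_continuousOn hψ))).symm

/-- Classes of bounded continuous functions are dense in L², and both sides depend continuously on
the tested pair. -/
lemma pairing_eq_of_continuousOn {x y : L2unit × L2unit}
    {S T : (L2unit × L2unit) →L[ℝ] (L2unit × L2unit)}
    (h : ∀ f g, ContinuousOn f (Icc 0 1) → ContinuousOn g (Icc 0 1) →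
      pairing x (S (toL2 f, toL2 g)) = pairing y (T (toL2 f, toL2 g))) (F : L2unit × L2unit) :
    pairing x (S F) = pairing y (T F) := by
  have hd : DenseRange (BoundedContinuousFunction.toLp (E := ℝ) 2 unitMeasure ℝ) :=
    BoundedContinuousFunction.toLp_denseRange ℝ unitMeasure ℝ (by simp)
  refine congrFun ((hd.prodMap hd).equalizer ((continuous_pairing x).comp S.continuous)
    ((continuous_pairing y).comp T.continuous) (funext fun p => ?_)) F
  have e : ∀ f : BoundedContinuousFunction ℝ ℝ,
      BoundedContinuousFunction.toLp 2 unitMeasure ℝ f = toL2 f := fun f => Lp.ext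
    ((BoundedContinuousFunction.coeFn_toLp (p := 2) (μ := unitMeasure) (𝕜 := ℝ) f).trans
      (toL2_ae_of_continuousOn f.continuous.continuousOn).symm)
  have := h p.1 p.2 p.1.continuous.continuousOn p.2.continuous.continuousOn
  rw [← e, ← e] at this
  exact this

/-! ### From the weak formulation to an integrated equation -/

section

variable {P : HyperbolicPlant} {K : KernelMatrix}

/-- Because the input is a feedback, the boundary term is itself a pairing of the state with K(1,
·), and it is absorbed into the adjoint generator of the closed loop. -/
lemma weak_integrand (hP : IsRegular P) (hK : P.IsBacksteppingKernel K) {φ ψ : ℝ → ℝ}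
    (h : IsTestPair P φ ψ) (u v : L2unit) :
    (∫ x in Icc (0 : ℝ) 1,
        (u x * (derivWithin (fun y => P.ε₁ y * φ y) (Icc 0 1) x + P.c₂ x * ψ x) +
          v x * (-derivWithin (fun y => P.ε₂ y * ψ y) (Icc 0 1) x + P.c₁ x * φ x))) +
      P.ε₂ 1 * ψ 1 * HyperbolicPlant.feedback K u v =
    pairing (u, v) (toL2 (genFst P K φ ψ), toL2 (genSnd P K φ ψ)) := by
  have hu := uniqueDiffOn_Icc (zero_lt_one (α := ℝ))
  have k1 := continuousOn_kernel_one hK.cont_vu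
  have k2 := continuousOn_kernel_one hK.cont_vv
  have m : ∀ (w : L2unit) {f : ℝ → ℝ}, ContinuousOn f (Icc 0 1) →
      Integrable (fun x => w x * f x) unitMeasure := fun w f hf =>
    (Lp.memLp w).integrable_mul (memLp_of_continuousOn hf)
  rw [pairing_toL2 _ (continuousOn_genFst hP hK h) (continuousOn_genSnd hP hK h),
    HyperbolicPlant.feedback, mul_add, ← integral_const_mul, ← integral_const_mul,
    ← integral_add, ← integral_add]
  · refine integral_congr_ae (Eventually.of_forall fun x => ?_)
    simp only [genFst, genSnd]
    ring
  · exact (m u (((hP.ε₁.mul h.fst).continuousOn_derivWithin hu le_rfl).add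
      (hP.c₂.mul h.snd.continuousOn))).add (m v
        (((hP.ε₂.mul h.snd).continuousOn_derivWithin hu le_rfl).neg.add
          (hP.c₁.mul h.fst.continuousOn)))
  · refine Integrable.add ?_ ?_
    · exact ((m u k1).const_mul (P.ε₂ 1 * ψ 1)).congr
        (Eventually.of_forall fun x => by simp only; ring)
    · exact ((m v k2).const_mul (P.ε₂ 1 * ψ 1)).congr
        (Eventually.of_forall fun x => by simp only; ring)
  · exact ((m u k1).const_mul (P.ε₂ 1 * ψ 1)).congr
      (Eventually.of_forall fun x => by simp only; ring)
  · exact ((m v k2).const_mul (P.ε₂ 1 * ψ 1)).congr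
      (Eventually.of_forall fun x => by simp only; ring)

lemma intervalIntegrable_of_Ici {E : Type*} [NormedAddCommGroup E] {w : ℝ → E}
    (hw : ContinuousOn w (Ici 0)) {a b : ℝ} (ha : 0 ≤ a) (hb : 0 ≤ b) :
    IntervalIntegrable w volume a b :=
  (hw.mono fun _ hx => (le_min ha hb).trans hx.1).intervalIntegrable

lemma weak_identity_iff (hP : IsRegular P) (hK : P.IsBacksteppingKernel K) {φ ψ : ℝ → ℝ}
    (h : IsTestPair P φ ψ) {w : ℝ → L2unit × L2unit} (hw : ContinuousOn w (Ici 0)) {t : ℝ}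
    (ht : 0 ≤ t) :
    ((∫ x in Icc (0 : ℝ) 1, ((w t).1 x * φ x + (w t).2 x * ψ x)) =
        (∫ x in Icc (0 : ℝ) 1, ((w 0).1 x * φ x + (w 0).2 x * ψ x)) +
        ∫ s in (0 : ℝ)..t,
          ((∫ x in Icc (0 : ℝ) 1,
              ((w s).1 x * (derivWithin (fun y => P.ε₁ y * φ y) (Icc 0 1) x + P.c₂ x * ψ x) +
               (w s).2 x * (-derivWithin (fun y => P.ε₂ y * ψ y) (Icc 0 1) x + P.c₁ x * φ x))) +
            P.ε₂ 1 * ψ 1 * HyperbolicPlant.feedback K (w s).1 (w s).2)) ↔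
      pairing (w t - w 0) (toL2 φ, toL2 ψ) =
        pairing (∫ s in (0 : ℝ)..t, w s) (toL2 (genFst P K φ ψ), toL2 (genSnd P K φ ψ)) := by
  simp only [weak_integrand hP hK h, Prod.mk.eta]
  rw [pairing_sub_left, sub_eq_iff_eq_add', pairing_toL2 _ h.fst.continuousOn h.snd.continuousOn,
    pairing_toL2 _ h.fst.continuousOn h.snd.continuousOn]
  simp only [← pairingCLM_apply]
  rw [ContinuousLinearMap.intervalIntegral_comp_comm _ (intervalIntegrable_of_Ici hw le_rfl ht)]

/-- The backstepping transformation maps the closed loop to the target system. -/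
theorem isClosedLoopSolution_iff (hP : IsRegular P) (hK : P.IsBacksteppingKernel K)
    {u₀ v₀ : L2unit} {u v : ℝ → L2unit} :
    P.IsClosedLoopSolution K u₀ v₀ u v ↔
      ContinuousOn (fun t => (u t, v t)) (Ici 0) ∧ (u 0, v 0) = (u₀, v₀) ∧
      ∀ t, 0 ≤ t → plantTarget P (backOp K (u t, v t) - backOp K (u 0, v 0)) =
        ∫ s in (0 : ℝ)..t, backOp K (u s, v s) := by
  have main : ∀ (w : ℝ → L2unit × L2unit), ContinuousOn w (Ici 0) → ∀ t, 0 ≤ t →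
      ((∀ φ ψ, IsTestPair P φ ψ → pairing (w t - w 0) (toL2 φ, toL2 ψ) =
        pairing (∫ s in (0 : ℝ)..t, w s) (toL2 (genFst P K φ ψ), toL2 (genSnd P K φ ψ))) ↔
      plantTarget P (backOp K (w t) - backOp K (w 0)) = ∫ s in (0 : ℝ)..t, backOp K (w s)) := by
    intro w hw t ht
    rw [ContinuousLinearMap.intervalIntegral_comp_comm _ (intervalIntegrable_of_Ici hw le_rfl ht),
      ← map_sub]
    constructor
    -- Every continuous source (f, g) yields a test pair, so the weak identities give the dual
    -- equation on a dense set.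
    · intro h
      refine eq_of_pairing_eq fun F => ?_
      rw [pairing_targetOp hP.speed₁ hP.speed₂, pairing_backOp hK, pairing_backOp hK]
      refine pairing_eq_of_continuousOn (S := adjOp K ∘L plantSource P) (T := adjOp K)
        (fun f g hf hg => ?_) F
      obtain ⟨φ, ψ, hφψ, e1, e2⟩ := exists_isTestPair hP hK hf hg
      rw [ContinuousLinearMap.comp_apply, e1, e2]
      exact h φ ψ hφψ
    -- Conversely every test pair comes from a source, so the operator equation contains each weak
    -- identity.
    · intro h φ ψ hφψ
      obtain ⟨f, g, -, -, e1, e2⟩ := hφψ.exists_source hP hK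
      rw [← e1, ← e2, ← pairing_backOp hK, ← pairing_backOp hK, ← h,
        pairing_targetOp hP.speed₁ hP.speed₂]
  constructor
  · intro h
    have hw : ContinuousOn (fun t => (u t, v t)) (Ici 0) := h.cont_u.prodMk h.cont_v
    refine ⟨hw, by rw [h.init_u, h.init_v], fun t ht => (main _ hw t ht).1 fun φ ψ hφψ => ?_⟩
    refine (weak_identity_iff hP hK hφψ hw ht).1 ?_
    have := h.weak φ ψ hφψ.fst hφψ.snd hφψ.one hφψ.zero t ht
    rwa [← h.init_u, ← h.init_v] at this
  · rintro ⟨hw, hi, h⟩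
    obtain ⟨hu, hv⟩ := Prod.ext_iff.1 hi
    refine ⟨hw.fst, hw.snd, hu, hv, fun φ ψ h1 h2 h3 h4 t ht => ?_⟩
    have hφψ : IsTestPair P φ ψ := ⟨h1, h2, h3, h4⟩
    have := (weak_identity_iff hP hK hφψ hw ht).2 ((main _ hw t ht).2 (h t ht) φ ψ hφψ)
    simp only at hu hv
    subst hu hv
    exact this

end

/-! ### Uniqueness for the target system -/

lemma integral_zero_one_eq (u : L2unit) : ∫ x in (0 : ℝ)..1, u x = ∫ x in Icc (0 : ℝ) 1, u x := by
  rw [intervalIntegral.integral_of_le zero_le_one, integral_Icc_eq_integral_Ioc]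

lemma inner_integralTotal (u v : L2unit) :
    inner ℝ (integralTotal u) v = (∫ x in (0 : ℝ)..1, u x) * ∫ x in (0 : ℝ)..1, v x := by
  rw [inner_eq_integral, integral_zero_one_eq v, ← integral_const_mul]
  refine integral_congr_ae ?_
  filter_upwards [integralTotal_ae u] with x hx
  rw [hx]

lemma integralUp_add_integralDown (u : L2unit) : integralUp u + integralDown u = integralTotal u := by
  refine Lp.ext ?_
  filter_upwards [Lp.coeFn_add (integralUp u) (integralDown u), integralUp_ae u, integralDown_ae u,
    integralTotal_ae u, ae_unit_mem] with x h1 h2 h3 h4 hx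
  rw [h1, Pi.add_apply, h2, h3, h4, integral_eq_sub_unit (integrable_coe u) hx]
  ring

/-- The two one-sided integration operators are adjoint to each other and add up to integration over
the whole interval, which has rank one. Half of the quadratic form of their sum remains: this is ∫ F
F' = F(1)² / 2 for the primitive F. -/
lemma inner_integralDown_self (u : L2unit) :
    inner ℝ (integralDown u) u = (∫ x in (0 : ℝ)..1, u x) ^ 2 / 2 := by
  have h := congrArg (fun v => inner ℝ v u) (integralUp_add_integralDown u)
  simp only [inner_add_left, inner_integralTotal, inner_integralUp_left] at h
  rw [real_inner_comm] at h
  linarith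

lemma inner_integralUp_self (u : L2unit) :
    inner ℝ (integralUp u) u = (∫ x in (0 : ℝ)..1, u x) ^ 2 / 2 := by
  rw [inner_integralUp_left, real_inner_comm, inner_integralDown_self]

lemma le_inner_mulOp {f : ℝ → ℝ} (hf : BddMul f) {c : ℝ} (hc : ∀ x, c ≤ f x) (u : L2unit) :
    c * ‖u‖ ^ 2 ≤ inner ℝ u (mulOp f u) := by
  rw [← real_inner_self_eq_norm_sq, inner_eq_integral, inner_eq_integral, ← integral_const_mul]
  refine integral_mono_ae (((Lp.memLp u).integrable_mul (Lp.memLp u)).const_mul c)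
    ((Lp.memLp u).integrable_mul (Lp.memLp (mulOp f u))) ?_
  filter_upwards [mulOp_ae hf u] with x hx
  rw [hx]
  nlinarith [mul_le_mul_of_nonneg_right (hc x) (mul_self_nonneg (u x))]

/-- The energy dissipated by the target system. -/
lemma energy_identity {e₁ e₂ : ℝ → ℝ} {q : ℝ} (z : L2unit × L2unit) :
    inner ℝ (targetOp e₁ e₂ q z).1 (mulOp (fun x => (e₁ x)⁻¹) z.1) +
      q ^ 2 * inner ℝ (targetOp e₁ e₂ q z).2 (mulOp (fun x => (e₂ x)⁻¹) z.2) ≤ 0 := by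
  set a := mulOp (fun x => (e₁ x)⁻¹) z.1 with ha
  set b := mulOp (fun x => (e₂ x)⁻¹) z.2 with hb
  have e1 : (targetOp e₁ e₂ q z).1 = -integralDown a - q • integralTotal b := by
    simp [targetOp, ha, hb, sub_eq_add_neg]
  have e2 : (targetOp e₁ e₂ q z).2 = -integralUp b := by
    simp [targetOp, hb]
  rw [e1, e2, inner_sub_left, inner_neg_left, inner_neg_left, real_inner_smul_left,
    inner_integralTotal, inner_integralDown_self, inner_integralUp_self]
  -- With I and J the integrals of `a` and `b` over [0,1], the left side is exactly -(I + qJ)² / 2.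
  -- The weight q² on the second component completes the square.
  nlinarith [sq_nonneg ((∫ x in (0 : ℝ)..1, a x) + q * ∫ x in (0 : ℝ)..1, b x)]

/-- Solutions of the target system. -/
structure IsTargetSolution (e₁ e₂ : ℝ → ℝ) (q : ℝ) (z : ℝ → L2unit × L2unit) : Prop where
  cont : ContinuousOn z (Ici 0)
  eqn : ∀ t, 0 ≤ t → targetOp e₁ e₂ q (z t - z 0) = ∫ s in (0 : ℝ)..t, z s

/-- A weak solution is only continuous in time, but its time integral Z is continuously
differentiable and satisfies N Z' = Z. The energy of Z is nonincreasing by `energy_identity` and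
starts at 0, so Z vanishes and with it z = Z'. -/
lemma IsTargetSolution.eq_zero {e₁ e₂ : ℝ → ℝ} {q : ℝ} (h₁ : IsSpeed e₁) (h₂ : IsSpeed e₂)
    (hq : q ≠ 0) {z : ℝ → L2unit × L2unit} (hz : IsTargetSolution e₁ e₂ q z) (h0 : z 0 = 0)
    {t : ℝ} (ht : 0 ≤ t) : z t = 0 := by
  set m₁ := mulOp (fun x => (e₁ x)⁻¹) with hm₁
  set m₂ := mulOp (fun x => (e₂ x)⁻¹) with hm₂
  -- Freezing z at its initial value for negative times makes Z differentiable on the whole line.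
  set y : ℝ → L2unit × L2unit := fun s => z (max 0 s) with hy
  have hyc : Continuous y := hz.cont.comp_continuous (by fun_prop) fun s => mem_Ici.2 (le_max_left _ _)
  set Z : ℝ → L2unit × L2unit := fun t => ∫ s in (0 : ℝ)..t, y s with hZ
  have hZd : ∀ t, HasDerivAt Z (y t) t := fun t =>
    (hyc.integral_hasStrictDerivAt 0 t).hasDerivAt
  have hyz : ∀ {t}, 0 ≤ t → y t = z t := fun ht => by simp only [hy, max_eq_right ht]
  have hNz : ∀ {t}, 0 ≤ t → targetOp e₁ e₂ q (z t) = Z t := fun {t} ht => by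
    have := hz.eqn t ht
    rw [h0, sub_zero] at this
    rw [this]
    refine intervalIntegral.integral_congr fun s hs => ?_
    rw [uIcc_of_le ht] at hs
    exact (hyz hs.1).symm
  -- The weights 1 / ε₁ and 1 / ε₂ are those under which integration acts as transport in travel
  -- time; they are bounded below, so E controls the norm of Z.
  set E : ℝ → ℝ := fun t => inner ℝ (Z t).1 (m₁ (Z t).1) + q ^ 2 * inner ℝ (Z t).2 (m₂ (Z t).2)
    with hE
  have hEd : ∀ t, HasDerivAt E (2 * (inner ℝ (Z t).1 (m₁ (y t).1) +
      q ^ 2 * inner ℝ (Z t).2 (m₂ (y t).2))) t := by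
    intro t
    have d1 : HasDerivAt (fun t => (Z t).1) (y t).1 t :=
      (ContinuousLinearMap.fst ℝ L2unit L2unit).hasFDerivAt.comp_hasDerivAt t (hZd t)
    have d2 : HasDerivAt (fun t => (Z t).2) (y t).2 t :=
      (ContinuousLinearMap.snd ℝ L2unit L2unit).hasFDerivAt.comp_hasDerivAt t (hZd t)
    refine ((d1.inner ℝ (m₁.hasFDerivAt.comp_hasDerivAt t d1)).add
      ((d2.inner ℝ (m₂.hasFDerivAt.comp_hasDerivAt t d2)).const_mul (q ^ 2))).congr_deriv ?_
    have s1 : inner ℝ (y t).1 (m₁ (Z t).1) = inner ℝ (Z t).1 (m₁ (y t).1) := by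
      rw [← inner_mulOp_left h₁.bddMul_inv, real_inner_comm]
    have s2 : inner ℝ (y t).2 (m₂ (Z t).2) = inner ℝ (Z t).2 (m₂ (y t).2) := by
      rw [← inner_mulOp_left h₂.bddMul_inv, real_inner_comm]
    simp only [Function.comp_apply, s1, s2]
    ring
  have hanti : AntitoneOn E (Ici 0) := by
    refine antitoneOn_of_hasDerivWithinAt_nonpos (convex_Ici 0)
      (fun t _ => (hEd t).continuousAt.continuousWithinAt)
      (fun t _ => (hEd t).hasDerivWithinAt) fun t ht => ?_
    rw [interior_Ici] at ht
    have := energy_identity (e₁ := e₁) (e₂ := e₂) (q := q) (z t)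
    rw [hNz (le_of_lt ht)] at this
    rw [hyz (le_of_lt ht)]
    linarith
  have hZ0 : ∀ t, 0 ≤ t → Z t = 0 := by
    intro t ht
    have hEt : E t ≤ 0 := by
      have := hanti self_mem_Ici ht ht
      simpa [hE, hZ] using this
    obtain ⟨m, M, hm, hb⟩ := h₁.bdd
    obtain ⟨m', M', hm', hb'⟩ := h₂.bdd
    have hM : 0 < M := hm.trans_le ((hb 0).1.trans (hb 0).2)
    have hM' : 0 < M' := hm'.trans_le ((hb' 0).1.trans (hb' 0).2)
    have l1 := le_inner_mulOp h₁.bddMul_inv (c := M⁻¹)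
      (fun x => inv_anti₀ (h₁.pos x) (hb x).2) (Z t).1
    have l2 := le_inner_mulOp h₂.bddMul_inv (c := M'⁻¹)
      (fun x => inv_anti₀ (h₂.pos x) (hb' x).2) (Z t).2
    have p1 : 0 ≤ M⁻¹ * ‖(Z t).1‖ ^ 2 := by positivity
    have p2 : 0 ≤ M'⁻¹ * ‖(Z t).2‖ ^ 2 := by positivity
    have hq2 : 0 < q ^ 2 := by positivity
    have l2' := mul_le_mul_of_nonneg_left l2 hq2.le
    have p2' := mul_nonneg hq2.le p2
    simp only [hE] at hEt
    have z1 : M⁻¹ * ‖(Z t).1‖ ^ 2 = 0 := le_antisymm (by linarith) p1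
    have z2 : q ^ 2 * (M'⁻¹ * ‖(Z t).2‖ ^ 2) = 0 := le_antisymm (by linarith) p2'
    refine Prod.ext ?_ ?_
    · simpa [hM.ne'] using z1
    · simpa [hM'.ne', hq] using z2
  -- Z is known to vanish only for nonnegative times, so at t = 0 only the right derivative can be
  -- compared.
  have hd : HasDerivWithinAt Z 0 (Ici t) t :=
    (hasDerivWithinAt_const t (Ici t) (0 : L2unit × L2unit)).congr
      (fun s hs => hZ0 s (ht.trans hs)) (hZ0 t ht)
  rw [← hyz ht]
  exact (uniqueDiffWithinAt_Ici t).eq_deriv (Ici t) (hZd t).hasDerivWithinAt hd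

lemma IsTargetSolution.sub {e₁ e₂ : ℝ → ℝ} {q : ℝ} {z z' : ℝ → L2unit × L2unit}
    (hz : IsTargetSolution e₁ e₂ q z) (hz' : IsTargetSolution e₁ e₂ q z') :
    IsTargetSolution e₁ e₂ q fun t => z t - z' t := by
  refine ⟨hz.cont.sub hz'.cont, fun t ht => ?_⟩
  rw [intervalIntegral.integral_sub (intervalIntegrable_of_Ici hz.cont le_rfl ht)
    (intervalIntegrable_of_Ici hz'.cont le_rfl ht), ← hz.eqn t ht, ← hz'.eqn t ht, ← map_sub]
  congr 1
  abel

/-! ### Changes of variables in `L²` -/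

/-- A continuous change of variables that contracts lengths at most by a bounded factor. -/
structure Distortion (g : ℝ → ℝ) : Prop where
  cont : Continuous g
  le : ∃ K : NNReal, volume.map g ≤ (K : ENNReal) • (volume : Measure ℝ)

/-- A preimage under g lies in the image under its left inverse h, and a K-Lipschitz map increases
Lebesgue measure, that is one-dimensional Hausdorff measure, by at most the factor K. -/
lemma Distortion.of_leftInverse {g h : ℝ → ℝ} (hg : Continuous g) (hh : ∃ K, LipschitzWith K h)
    (hgh : ∀ x, h (g x) = x) : Distortion g := by
  obtain ⟨K, hK⟩ := hh
  refine ⟨hg, K, Measure.le_iff.2 fun N hN => ?_⟩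
  rw [Measure.map_apply hg.measurable hN, Measure.smul_apply, smul_eq_mul]
  have hsub : g ⁻¹' N ⊆ h '' N := fun x hx => ⟨g x, hx, hgh x⟩
  refine (measure_mono hsub).trans ?_
  have := hK.hausdorffMeasure_image_le (d := 1) zero_le_one N
  simpa [MeasureTheory.hausdorffMeasure_real] using this

namespace Distortion

variable {g f : ℝ → ℝ}

lemma memLp_comp (hg : Distortion g) (hf : MemLp f 2 volume) :
    MemLp (fun x => f (g x)) 2 volume := by
  obtain ⟨K, hK⟩ := hg.le
  exact (hf.of_measure_le_smul (by simp) hK).comp_of_map hg.cont.aemeasurable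

lemma exists_eLpNorm_comp_le (hg : Distortion g) : ∃ C : ℝ, 0 ≤ C ∧ ∀ f : ℝ → ℝ, MemLp f 2 volume →
    (eLpNorm (fun x => f (g x)) 2 volume).toReal ≤ C * (eLpNorm f 2 volume).toReal := by
  obtain ⟨K, hK⟩ := hg.le
  refine ⟨((K : ENNReal) ^ (1 / (2 : ENNReal)).toReal).toReal, ENNReal.toReal_nonneg, fun f hf => ?_⟩
  have hm := hf.of_measure_le_smul (by simp) hK
  rw [← ENNReal.toReal_mul]
  refine ENNReal.toReal_mono (ENNReal.mul_ne_top ?_ hf.2.ne) ?_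
  · exact ENNReal.rpow_ne_top_of_nonneg (by simp) (by simp)
  · have := eLpNorm_le_of_measure_le_smul hK (f := f) (p := 2)
    rwa [eLpNorm_map_measure hm.1 hg.cont.aemeasurable] at this

end Distortion

lemma norm_toL2 {f : ℝ → ℝ} (hf : MemLp f 2 unitMeasure) :
    ‖toL2 f‖ = (eLpNorm f 2 unitMeasure).toReal := by
  rw [toL2, dif_pos hf, Lp.norm_toLp]

lemma norm_toL2_le {f : ℝ → ℝ} (hf : MemLp f 2 volume) :
    ‖toL2 f‖ ≤ (eLpNorm f 2 volume).toReal := by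
  rw [norm_toL2 (hf.restrict _)]
  exact ENNReal.toReal_mono hf.2.ne (eLpNorm_mono_measure _ Measure.restrict_le_self)

lemma memLp_translate {W : ℝ → ℝ} (hW : MemLp W 2 volume) (t : ℝ) :
    MemLp (fun y => W (y + t)) 2 volume :=
  hW.comp_measurePreserving (measurePreserving_add_right volume t)

lemma eLpNorm_translate {W : ℝ → ℝ} (hW : MemLp W 2 volume) (t : ℝ) :
    eLpNorm (fun y => W (y + t)) 2 volume = eLpNorm W 2 volume :=
  eLpNorm_comp_measurePreserving hW.1 (measurePreserving_add_right volume t)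

/-- Strong continuity of the translation group on L²(ℝ), read off from the continuous action of
translations on L² classes. -/
lemma continuous_eLpNorm_translate_sub {W : ℝ → ℝ} (hW : MemLp W 2 volume) (t₀ : ℝ) :
    Tendsto (fun t => (eLpNorm (fun y => W (y + t) - W (y + t₀)) 2 volume).toReal) (𝓝 t₀) (𝓝 0) := by
  have : Fact ((2 : ENNReal) ≠ ⊤) := ⟨by simp⟩
  have hc : Continuous fun t : ℝ => DomAddAct.mk t +ᵥ hW.toLp W :=
    (DomAddAct.continuous_mk).vadd continuous_const
  have h := (hc.sub (continuous_const (y := DomAddAct.mk t₀ +ᵥ hW.toLp W))).norm.tendsto t₀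
  simp only [Pi.sub_apply, sub_self, norm_zero] at h
  refine h.congr fun t => ?_
  rw [DomAddAct.mk_vadd_toLp, DomAddAct.mk_vadd_toLp, ← MemLp.toLp_sub, Lp.norm_toLp]
  congr 2
  funext y
  simp only [Pi.sub_apply, vadd_eq_add, add_comm]

/-! ### Travelling waves -/

/-- The profile `W` observed through the moving window `g + t`. -/
noncomputable def wave (W g : ℝ → ℝ) (t : ℝ) : L2unit := toL2 fun x => W (g x + t)

section

variable {W g : ℝ → ℝ}

lemma memLp_wave (hW : MemLp W 2 volume) (hg : Distortion g) (t : ℝ) :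
    MemLp (fun x => W (g x + t)) 2 unitMeasure :=
  (hg.memLp_comp (memLp_translate hW t)).restrict _

lemma exists_norm_wave_le (hg : Distortion g) : ∃ C : ℝ, 0 ≤ C ∧ ∀ W, MemLp W 2 volume → ∀ t,
    ‖wave W g t‖ ≤ C * (eLpNorm W 2 volume).toReal := by
  obtain ⟨C, hC, h⟩ := hg.exists_eLpNorm_comp_le
  refine ⟨C, hC, fun W hW t => ?_⟩
  have := h _ (memLp_translate hW t)
  rw [eLpNorm_translate hW] at this
  exact (norm_toL2_le (hg.memLp_comp (memLp_translate hW t))).trans this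

/-- In time the profile is only translated, and composition with the window is bounded on L²; so
continuity reduces to that of translations. -/
lemma continuous_wave (hW : MemLp W 2 volume) (hg : Distortion g) : Continuous (wave W g) := by
  refine continuous_iff_continuousAt.2 fun t₀ => ?_
  obtain ⟨C, hC, h⟩ := hg.exists_eLpNorm_comp_le
  refine tendsto_iff_norm_sub_tendsto_zero.2 ?_
  have := (continuous_eLpNorm_translate_sub hW t₀).const_mul C
  rw [mul_zero] at this
  refine squeeze_zero (fun _ => norm_nonneg _) (fun t => ?_) this
  have hm := (memLp_translate hW t).sub (memLp_translate hW t₀)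
  rw [wave, wave, toL2_sub (memLp_wave hW hg t) (memLp_wave hW hg t₀)]
  exact (norm_toL2_le (hg.memLp_comp hm)).trans (h _ hm)

/-- The primitive of the profile. -/
noncomputable def primitive (W : ℝ → ℝ) (y : ℝ) : ℝ := ∫ s in (0 : ℝ)..y, W s

lemma intervalIntegrable_of_memLp (hW : MemLp W 2 volume) (a b : ℝ) :
    IntervalIntegrable W volume a b :=
  ((hW.locallyIntegrable one_le_two).integrableOn_isCompact isCompact_uIcc).intervalIntegrable

lemma primitive_sub (hW : MemLp W 2 volume) (a b : ℝ) :
    primitive W b - primitive W a = ∫ s in a..b, W s :=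
  intervalIntegral.integral_interval_sub_left (intervalIntegrable_of_memLp hW _ _)
    (intervalIntegrable_of_memLp hW _ _)

lemma continuous_primitive (hW : MemLp W 2 volume) : Continuous (primitive W) :=
  intervalIntegral.continuous_primitive (intervalIntegrable_of_memLp hW) 0

lemma integral_translate (hW : MemLp W 2 volume) (y t : ℝ) :
    ∫ s in (0 : ℝ)..t, W (y + s) = primitive W (y + t) - primitive W y := by
  rw [primitive_sub hW, intervalIntegral.integral_comp_add_left, add_zero]

/-- The left side is a Bochner integral in L² and the right side a pointwise formula. They are
compared by pairing with an arbitrary v and exchanging the two integrations; joint measurability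
needs the actual function W to be measurable, not just its class. -/
lemma integral_wave (hm : StronglyMeasurable W) (hW : MemLp W 2 volume) (hg : Distortion g) (t : ℝ) :
    ∫ s in (0 : ℝ)..t, wave W g s = toL2 fun x => primitive W (g x + t) - primitive W (g x) := by
  have hcont : Continuous fun x => primitive W (g x + t) - primitive W (g x) :=
    ((continuous_primitive hW).comp (hg.cont.add continuous_const)).sub
      ((continuous_primitive hW).comp hg.cont)
  refine ext_inner_left ℝ fun v => ?_
  have hint : Integrable (Function.uncurry fun s x => v x * W (g x + s))
      ((volume.restrict (uIoc 0 t)).prod unitMeasure) := by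
    have hmeas : StronglyMeasurable (Function.uncurry fun s x => v x * W (g x + s)) :=
      ((Lp.stronglyMeasurable v).comp_measurable measurable_snd).mul
        (hm.comp_measurable ((hg.cont.comp continuous_snd).add continuous_fst).measurable)
    rw [integrable_prod_iff hmeas.aestronglyMeasurable]
    refine ⟨Eventually.of_forall fun s => (Lp.memLp v).integrable_mul (memLp_wave hW hg s), ?_⟩
    have hv : MemLp (fun x => |v x|) 2 unitMeasure := (Lp.memLp v).norm
    have hc : Continuous fun s => (inner ℝ (toL2 fun x => |v x|) (wave (fun y => ‖W y‖) g s) : ℝ) :=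
      continuous_const.inner (continuous_wave hW.norm hg)
    refine (hc.integrableOn_uIcc.mono_set uIoc_subset_uIcc).congr (Eventually.of_forall fun s => ?_)
    simp only [Function.uncurry]
    rw [wave, inner_toL2 _ (memLp_wave hW.norm hg s)]
    refine integral_congr_ae ?_
    filter_upwards [toL2_ae hv] with x hx
    rw [hx, norm_mul, Real.norm_eq_abs (v x)]
  have h1 : inner ℝ v (∫ s in (0 : ℝ)..t, wave W g s) = ∫ s in (0 : ℝ)..t, inner ℝ v (wave W g s) :=
    ((innerSL ℝ v).intervalIntegral_comp_comm
      ((continuous_wave hW hg).intervalIntegrable _ _)).symm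
  rw [h1, inner_toL2 _ (memLp_of_continuousOn hcont.continuousOn)]
  calc ∫ s in (0 : ℝ)..t, inner ℝ v (wave W g s)
      = ∫ s in (0 : ℝ)..t, ∫ x in Icc (0 : ℝ) 1, v x * W (g x + s) :=
        intervalIntegral.integral_congr fun s _ => inner_toL2 v (memLp_wave hW hg s)
    _ = ∫ x in Icc (0 : ℝ) 1, ∫ s in (0 : ℝ)..t, v x * W (g x + s) :=
        intervalIntegral_integral_swap hint
    _ = _ := by
        refine integral_congr_ae (Eventually.of_forall fun x => ?_)
        simp only [intervalIntegral.integral_const_mul, integral_translate hW]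

end

/-! ### Existence for the target system -/

section

variable {e : ℝ → ℝ} {W g : ℝ → ℝ} {a : ℝ}

lemma distortion_travel_add (he : IsSpeed e) (a : ℝ) : Distortion fun x => a + travel e x := by
  obtain ⟨K, hK⟩ := he.lipschitz_position
  refine .of_leftInverse (h := fun y => position e (y - a)) (by have := he.continuous_travel; fun_prop)
    ⟨K, LipschitzWith.of_dist_le_mul fun x y => ?_⟩ fun x => ?_
  · simpa using hK.dist_le_mul (x - a) (y - a)
  · simp only [add_sub_cancel_left, he.position_travel]

lemma distortion_travel_sub (he : IsSpeed e) (a : ℝ) : Distortion fun x => a - travel e x := by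
  obtain ⟨K, hK⟩ := he.lipschitz_position
  refine .of_leftInverse (h := fun y => position e (a - y)) (by have := he.continuous_travel; fun_prop)
    ⟨K, LipschitzWith.of_dist_le_mul fun x y => ?_⟩ fun x => ?_
  · simpa only [dist_sub_left] using hK.dist_le_mul (a - x) (a - y)
  · simp only [sub_sub_cancel, he.position_travel]

lemma distortion_position_sub (he : IsSpeed e) (a : ℝ) : Distortion fun s => position e (s - a) := by
  obtain ⟨K, hK⟩ := he.lipschitz_travel
  refine .of_leftInverse (h := fun y => travel e y + a) (he.continuous_position.comp (by fun_prop))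
    ⟨K, LipschitzWith.of_dist_le_mul fun x y => ?_⟩ fun x => ?_
  · simpa using hK.dist_le_mul x y
  · simp only [he.travel_position, sub_add_cancel]

lemma distortion_position_rev (he : IsSpeed e) (a : ℝ) : Distortion fun s => position e (a - s) := by
  obtain ⟨K, hK⟩ := he.lipschitz_travel
  refine .of_leftInverse (h := fun y => a - travel e y) (he.continuous_position.comp (by fun_prop))
    ⟨K, LipschitzWith.of_dist_le_mul fun x y => ?_⟩ fun x => ?_
  · simpa only [dist_sub_left] using hK.dist_le_mul x y
  · simp only [he.travel_position, sub_sub_cancel]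

lemma integral_wave_add (he : IsSpeed e) (hW : MemLp W 2 volume) (a t b c : ℝ) :
    ∫ y in b..c, (e y)⁻¹ * W (a + travel e y + t) =
      primitive W (a + travel e c + t) - primitive W (a + travel e b + t) := by
  rw [primitive_sub hW, ← intervalIntegral.integral_deriv_smul_comp_of_deriv_nonneg
    (f := fun y => a + travel e y + t) (f' := fun y => (e y)⁻¹)]
  · rfl
  · exact ((continuous_const.add he.continuous_travel).add continuous_const).continuousOn
  · exact fun y _ => ((he.hasDerivAt_travel y).const_add a).add_const t
  · exact fun y _ => (inv_pos.2 (he.pos y)).le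

lemma integral_wave_sub (he : IsSpeed e) (hW : MemLp W 2 volume) (a t b c : ℝ) :
    ∫ y in b..c, (e y)⁻¹ * W (a - travel e y + t) =
      primitive W (a - travel e b + t) - primitive W (a - travel e c + t) := by
  rw [primitive_sub hW, intervalIntegral.integral_symm,
    ← intervalIntegral.integral_deriv_smul_comp_of_deriv_nonpos
    (f := fun y => a - travel e y + t) (f' := fun y => -(e y)⁻¹), ← intervalIntegral.integral_neg]
  · simp
  · exact ((continuous_const.sub he.continuous_travel).add continuous_const).continuousOn
  · exact fun y _ => ((he.hasDerivAt_travel y).const_sub a).add_const t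
  · exact fun y _ => neg_nonpos.2 (inv_pos.2 (he.pos y)).le

lemma integral_mulOp_wave (he : IsSpeed e) (hW : MemLp W 2 volume) (hg : Distortion g) (t : ℝ)
    {b c : ℝ} (hb : b ∈ Icc (0 : ℝ) 1) (hc : c ∈ Icc (0 : ℝ) 1) :
    ∫ y in b..c, mulOp (fun x => (e x)⁻¹) (wave W g t) y =
      ∫ y in b..c, (e y)⁻¹ * W (g y + t) := by
  refine intervalIntegral.integral_congr_ae ?_
  have h : ∀ᵐ y ∂unitMeasure, mulOp (fun x => (e x)⁻¹) (wave W g t) y = (e y)⁻¹ * W (g y + t) := by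
    filter_upwards [mulOp_ae he.bddMul_inv (wave W g t), toL2_ae (memLp_wave hW hg t)] with y h1 h2
    rw [h1, wave, h2]
  filter_upwards [(ae_restrict_iff' measurableSet_Icc).1 h] with y hy hy'
  exact hy (uIcc_subset_Icc hb hc (uIoc_subset_uIcc hy'))

end

/-! ### The target solution as a single travelling profile -/

section

variable {e₁ e₂ : ℝ → ℝ} {q : ℝ} {W : ℝ → ℝ}

/-- The solution of the target system with profile `W`. -/
noncomputable def targetWave (e₁ e₂ : ℝ → ℝ) (q : ℝ) (W : ℝ → ℝ) (t : ℝ) : L2unit × L2unit :=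
  (q • wave W (fun x => travel e₁ 1 - travel e₁ x) t, wave W (fun x => travel e₁ 1 + travel e₂ x) t)

lemma continuous_targetWave (h₁ : IsSpeed e₁) (h₂ : IsSpeed e₂) (hW : MemLp W 2 volume) :
    Continuous (targetWave e₁ e₂ q W) :=
  ((continuous_wave hW (distortion_travel_sub h₁ _)).const_smul q).prodMk
    (continuous_wave hW (distortion_travel_add h₂ _))

lemma primitive_eq_of_le (hW : MemLp W 2 volume) {L : ℝ} (hL : ∀ s, L ≤ s → W s = 0) {y : ℝ}
    (hy : L ≤ y) : primitive W y = primitive W L := by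
  rw [← sub_eq_zero, primitive_sub hW]
  exact intervalIntegral.integral_zero_ae (Eventually.of_forall fun s hs => hL s (by
    rw [uIoc_of_le hy] at hs; exact hs.1.le))

/-- In travel-time coordinates the integrals become differences of the primitive of W. The values at
the reflection point x = 0 cancel between the two components, and the value at the inflow end x = 1
of the second is constant in time because W vanishes there; this is the condition β(1, t) = 0. -/
lemma targetOp_targetWave (h₁ : IsSpeed e₁) (h₂ : IsSpeed e₂) (hW : MemLp W 2 volume)
    (hL : ∀ s, travel e₁ 1 + travel e₂ 1 ≤ s → W s = 0) {t : ℝ} (ht : 0 ≤ t) :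
    (targetOp e₁ e₂ q (targetWave e₁ e₂ q W t)).1 =ᵐ[unitMeasure] (fun x =>
      q * (primitive W (travel e₁ 1 - travel e₁ x + t) - primitive W (travel e₁ 1 + travel e₂ 1))) ∧
    (targetOp e₁ e₂ q (targetWave e₁ e₂ q W t)).2 =ᵐ[unitMeasure] fun x =>
      primitive W (travel e₁ 1 + travel e₂ x + t) - primitive W (travel e₁ 1 + travel e₂ 1) := by
  have i0 : (0 : ℝ) ∈ Icc (0 : ℝ) 1 := by simp
  have i1 : (1 : ℝ) ∈ Icc (0 : ℝ) 1 := by simp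
  have g1 := distortion_travel_sub h₁ (travel e₁ 1)
  have g2 := distortion_travel_add h₂ (travel e₁ 1)
  have hend : primitive W (travel e₁ 1 + travel e₂ 1 + t) = primitive W (travel e₁ 1 + travel e₂ 1) :=
    primitive_eq_of_le hW hL (by linarith)
  set a := mulOp (fun x => (e₁ x)⁻¹) (wave W (fun x => travel e₁ 1 - travel e₁ x) t) with ha
  set b := mulOp (fun x => (e₂ x)⁻¹) (wave W (fun x => travel e₁ 1 + travel e₂ x) t) with hb
  have E1 : (targetOp e₁ e₂ q (targetWave e₁ e₂ q W t)).1 =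
      -(q • (integralDown a + integralTotal b)) := by
    simp [targetOp, targetWave, ha, hb]
    abel
  have E2 : (targetOp e₁ e₂ q (targetWave e₁ e₂ q W t)).2 = -integralUp b := by
    simp [targetOp, targetWave, hb]
  rw [E1, E2]
  constructor
  · filter_upwards [Lp.coeFn_neg (q • (integralDown a + integralTotal b)),
      Lp.coeFn_smul q (integralDown a + integralTotal b),
      Lp.coeFn_add (integralDown a) (integralTotal b), integralDown_ae a, integralTotal_ae b,
      ae_unit_mem] with x a1 a2 a3 a4 a5 hx
    rw [a1, Pi.neg_apply, a2, Pi.smul_apply, a3, Pi.add_apply, a4, a5, ha, hb,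
      integral_mulOp_wave h₁ hW g1 t i0 hx, integral_mulOp_wave h₂ hW g2 t i0 i1,
      integral_wave_sub h₁ hW, integral_wave_add h₂ hW, hend, IsSpeed.travel_zero, IsSpeed.travel_zero, smul_eq_mul,
      sub_zero, add_zero]
    ring
  · filter_upwards [Lp.coeFn_neg (integralUp b), integralUp_ae b, ae_unit_mem] with x a1 a2 hx
    rw [a1, Pi.neg_apply, a2, hb, integral_mulOp_wave h₂ hW g2 t hx i1, integral_wave_add h₂ hW, hend]
    ring

lemma isTargetSolution_targetWave (h₁ : IsSpeed e₁) (h₂ : IsSpeed e₂) (hm : StronglyMeasurable W)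
    (hW : MemLp W 2 volume) (hL : ∀ s, travel e₁ 1 + travel e₂ 1 ≤ s → W s = 0) :
    IsTargetSolution e₁ e₂ q (targetWave e₁ e₂ q W) := by
  have hc := continuous_targetWave (q := q) h₁ h₂ hW
  refine ⟨hc.continuousOn, fun t ht => ?_⟩
  have g1 := distortion_travel_sub h₁ (travel e₁ 1)
  have g2 := distortion_travel_add h₂ (travel e₁ 1)
  have c : ∀ {g}, Distortion g → MemLp (fun x => primitive W (g x + t) - primitive W (g x)) 2 unitMeasure :=
    fun hg => memLp_of_continuousOn (((continuous_primitive hW).comp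
      (hg.cont.add continuous_const)).sub ((continuous_primitive hW).comp hg.cont)).continuousOn
  have I1 : (∫ s in (0 : ℝ)..t, targetWave e₁ e₂ q W s).1 = q • toL2 fun x =>
      primitive W (travel e₁ 1 - travel e₁ x + t) - primitive W (travel e₁ 1 - travel e₁ x) := by
    rw [← integral_wave hm hW g1, ← intervalIntegral.integral_smul]
    exact ((ContinuousLinearMap.fst ℝ L2unit L2unit).intervalIntegral_comp_comm
      (hc.intervalIntegrable 0 t)).symm
  have I2 : (∫ s in (0 : ℝ)..t, targetWave e₁ e₂ q W s).2 = toL2 fun x =>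
      primitive W (travel e₁ 1 + travel e₂ x + t) - primitive W (travel e₁ 1 + travel e₂ x) := by
    rw [← integral_wave hm hW g2]
    exact ((ContinuousLinearMap.snd ℝ L2unit L2unit).intervalIntegral_comp_comm
      (hc.intervalIntegrable 0 t)).symm
  obtain ⟨b1, b2⟩ := targetOp_targetWave (q := q) h₁ h₂ hW hL ht
  obtain ⟨b3, b4⟩ := targetOp_targetWave (q := q) h₁ h₂ hW hL le_rfl
  rw [map_sub]
  refine Prod.ext (Lp.ext ?_) (Lp.ext ?_)
  · rw [I1, Prod.fst_sub]
    refine (Lp.coeFn_sub _ _).trans ?_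
    filter_upwards [b1, b3, Lp.coeFn_smul q (toL2 fun x =>
      primitive W (travel e₁ 1 - travel e₁ x + t) - primitive W (travel e₁ 1 - travel e₁ x)),
      toL2_ae (c g1)] with x a1 a2 a3 a4
    rw [Pi.sub_apply, a1, a2, a3, Pi.smul_apply, a4, add_zero, smul_eq_mul]
    ring
  · rw [I2, Prod.snd_sub]
    refine (Lp.coeFn_sub _ _).trans ?_
    filter_upwards [b2, b4, toL2_ae (c g2)] with x a1 a2 a3
    rw [Pi.sub_apply, a1, a2, a3, add_zero]
    ring

/-- The extension of an element of `L²([0,1])` by zero. -/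
noncomputable def extendZero (u : L2unit) : ℝ → ℝ := (Ioo (0 : ℝ) 1).indicator u

lemma stronglyMeasurable_extendZero (u : L2unit) : StronglyMeasurable (extendZero u) :=
  (Lp.stronglyMeasurable u).indicator measurableSet_Ioo

lemma memLp_extendZero (u : L2unit) : MemLp (extendZero u) 2 volume := by
  rw [extendZero, memLp_indicator_iff_restrict measurableSet_Ioo]
  exact (Lp.memLp u).mono_measure (Measure.restrict_mono Ioo_subset_Icc_self le_rfl)

lemma eLpNorm_extendZero_le (u : L2unit) : (eLpNorm (extendZero u) 2 volume).toReal ≤ ‖u‖ := by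
  rw [extendZero, eLpNorm_indicator_eq_eLpNorm_restrict measurableSet_Ioo, Lp.norm_def]
  exact ENNReal.toReal_mono (Lp.memLp u).2.ne
    (eLpNorm_mono_measure _ (Measure.restrict_mono Ioo_subset_Icc_self le_rfl))

lemma extendZero_of_mem (u : L2unit) {x : ℝ} (hx : x ∈ Ioo (0 : ℝ) 1) : extendZero u x = u x :=
  indicator_of_mem hx _

lemma extendZero_of_notMem (u : L2unit) {x : ℝ} (hx : x ∉ Ioo (0 : ℝ) 1) : extendZero u x = 0 :=
  indicator_of_notMem hx _

lemma ae_unit_mem_Ioo : ∀ᵐ x ∂unitMeasure, x ∈ Ioo (0 : ℝ) 1 := by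
  filter_upwards [ae_unit_mem, ae_restrict_of_ae (Measure.ae_ne volume (0 : ℝ)),
    ae_restrict_of_ae (Measure.ae_ne volume (1 : ℝ))] with x hx h0 h1
  exact ⟨lt_of_le_of_ne hx.1 h0.symm, lt_of_le_of_ne hx.2 h1⟩

/-- The profile of the solution of the target system with given initial datum. -/
noncomputable def profile (e₁ e₂ : ℝ → ℝ) (q : ℝ) (z₀ : L2unit × L2unit) (s : ℝ) : ℝ :=
  q⁻¹ * extendZero z₀.1 (position e₁ (travel e₁ 1 - s)) +
    extendZero z₀.2 (position e₂ (s - travel e₁ 1))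

lemma stronglyMeasurable_profile (h₁ : IsSpeed e₁) (h₂ : IsSpeed e₂) (z₀ : L2unit × L2unit) :
    StronglyMeasurable (profile e₁ e₂ q z₀) :=
  (stronglyMeasurable_const.mul ((stronglyMeasurable_extendZero z₀.1).comp_measurable
    (distortion_position_rev h₁ _).cont.measurable)).add
    ((stronglyMeasurable_extendZero z₀.2).comp_measurable
    (distortion_position_sub h₂ _).cont.measurable)

lemma memLp_profile (h₁ : IsSpeed e₁) (h₂ : IsSpeed e₂) (z₀ : L2unit × L2unit) :
    MemLp (profile e₁ e₂ q z₀) 2 volume :=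
  (((distortion_position_rev h₁ _).memLp_comp (memLp_extendZero z₀.1)).const_mul q⁻¹).add
    ((distortion_position_sub h₂ _).memLp_comp (memLp_extendZero z₀.2))

lemma exists_eLpNorm_profile_le (h₁ : IsSpeed e₁) (h₂ : IsSpeed e₂) : ∃ C : ℝ, 0 ≤ C ∧
    ∀ z₀, (eLpNorm (profile e₁ e₂ q z₀) 2 volume).toReal ≤ C * ‖z₀‖ := by
  have d1 := distortion_position_rev h₁ (travel e₁ 1)
  have d2 := distortion_position_sub h₂ (travel e₁ 1)
  obtain ⟨C₁, hC₁, b1⟩ := d1.exists_eLpNorm_comp_le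
  obtain ⟨C₂, hC₂, b2⟩ := d2.exists_eLpNorm_comp_le
  refine ⟨|q⁻¹| * C₁ + C₂, by positivity, fun z₀ => ?_⟩
  have m1 := d1.memLp_comp (memLp_extendZero z₀.1)
  have m2 := d2.memLp_comp (memLp_extendZero z₀.2)
  have k1 := (b1 _ (memLp_extendZero z₀.1)).trans (mul_le_mul_of_nonneg_left
    ((eLpNorm_extendZero_le z₀.1).trans (norm_fst_le z₀)) hC₁)
  have k2 := (b2 _ (memLp_extendZero z₀.2)).trans (mul_le_mul_of_nonneg_left
    ((eLpNorm_extendZero_le z₀.2).trans (norm_snd_le z₀)) hC₂)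
  have m1' := m1.const_mul q⁻¹
  have key := ENNReal.toReal_mono (ENNReal.add_ne_top.2 ⟨m1'.2.ne, m2.2.ne⟩)
    (eLpNorm_add_le m1'.1 m2.1 one_le_two)
  rw [ENNReal.toReal_add m1'.2.ne m2.2.ne] at key
  have hs := congrArg ENNReal.toReal (eLpNorm_const_smul q⁻¹
    (fun x => extendZero z₀.1 (position e₁ (travel e₁ 1 - x))) 2 volume)
  rw [ENNReal.toReal_mul] at hs
  have hs' : (eLpNorm (fun x => q⁻¹ * extendZero z₀.1 (position e₁ (travel e₁ 1 - x))) 2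
      volume).toReal = |q⁻¹| * (eLpNorm (fun x => extendZero z₀.1 (position e₁ (travel e₁ 1 - x))) 2
      volume).toReal := by
    rw [← Real.norm_eq_abs, ← toReal_enorm]
    exact hs
  calc (eLpNorm (profile e₁ e₂ q z₀) 2 volume).toReal ≤ _ := key
    _ ≤ |q⁻¹| * (C₁ * ‖z₀‖) + C₂ * ‖z₀‖ := by
        rw [hs']
        exact add_le_add (mul_le_mul_of_nonneg_left k1 (abs_nonneg _)) k2
    _ = _ := by ring

/-- Both positions fall outside the open interval. Extending from the open rather than the closed
interval is what includes the end point s = `travel e₁ 1 + travel e₂ 1`, hence extinction at the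
final time itself. -/
lemma profile_eq_zero (h₁ : IsSpeed e₁) (h₂ : IsSpeed e₂) (z₀ : L2unit × L2unit) {s : ℝ}
    (hs : travel e₁ 1 + travel e₂ 1 ≤ s) : profile e₁ e₂ q z₀ s = 0 := by
  have p2 : 0 < travel e₂ 1 := by
    have := h₂.strictMono_travel zero_lt_one
    rwa [IsSpeed.travel_zero] at this
  have n1 : position e₁ (travel e₁ 1 - s) ∉ Ioo (0 : ℝ) 1 := fun h => by
    have := h₁.strictMono_position (show travel e₁ 1 - s < 0 by linarith)
    rw [h₁.position_zero] at this
    exact lt_asymm this h.1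
  have n2 : position e₂ (s - travel e₁ 1) ∉ Ioo (0 : ℝ) 1 := fun h =>
    h.2.not_ge (h₂.travel_le_iff.1 (by linarith))
  rw [profile, extendZero_of_notMem _ n1, extendZero_of_notMem _ n2, mul_zero, add_zero]

/-- The two summands of the profile live on adjacent intervals: the first component, reversed and
divided by q, before time `travel e₁ 1`, the second component after it. Each initial window sees
only its own summand. -/
lemma targetWave_zero (h₁ : IsSpeed e₁) (h₂ : IsSpeed e₂) (hq : q ≠ 0) (z₀ : L2unit × L2unit) :
    targetWave e₁ e₂ q (profile e₁ e₂ q z₀) 0 = z₀ := by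
  have hW := memLp_profile (q := q) h₁ h₂ z₀
  refine Prod.ext (Lp.ext ?_) (Lp.ext ?_)
  · rw [targetWave, wave]
    filter_upwards [Lp.coeFn_smul q (toL2 fun x =>
        profile e₁ e₂ q z₀ (travel e₁ 1 - travel e₁ x + 0)),
      toL2_ae (memLp_wave hW (distortion_travel_sub h₁ (travel e₁ 1)) 0), ae_unit_mem_Ioo]
      with x a1 a2 hx
    have n2 : position e₂ (travel e₁ 1 - travel e₁ x - travel e₁ 1) ∉ Ioo (0 : ℝ) 1 := fun h => by
      have p : 0 < travel e₁ x := by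
        have := h₁.strictMono_travel hx.1
        rwa [IsSpeed.travel_zero] at this
      have := h₂.strictMono_position
        (show travel e₁ 1 - travel e₁ x - travel e₁ 1 < 0 by linarith)
      rw [h₂.position_zero] at this
      exact lt_asymm this h.1
    rw [a1, Pi.smul_apply, a2, add_zero, profile, sub_sub_cancel, h₁.position_travel,
      extendZero_of_mem _ hx, extendZero_of_notMem _ n2, add_zero, smul_eq_mul,
      mul_inv_cancel_left₀ hq]
  · rw [targetWave, wave, wave]
    filter_upwards [toL2_ae (memLp_wave hW (distortion_travel_add h₂ (travel e₁ 1)) 0),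
      ae_unit_mem_Ioo] with x a2 hx
    have n1 : position e₁ (travel e₁ 1 - (travel e₁ 1 + travel e₂ x)) ∉ Ioo (0 : ℝ) 1 := fun h => by
      have p : 0 < travel e₂ x := by
        have := h₂.strictMono_travel hx.1
        rwa [IsSpeed.travel_zero] at this
      have := h₁.strictMono_position
        (show travel e₁ 1 - (travel e₁ 1 + travel e₂ x) < 0 by linarith)
      rw [h₁.position_zero] at this
      exact lt_asymm this h.1
    rw [a2, add_zero, profile, add_sub_cancel_left, h₂.position_travel, extendZero_of_mem _ hx,
      extendZero_of_notMem _ n1, mul_zero, zero_add]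

lemma targetWave_eq_zero (h₁ : IsSpeed e₁) (h₂ : IsSpeed e₂)
    (hL : ∀ s, travel e₁ 1 + travel e₂ 1 ≤ s → W s = 0) {t : ℝ}
    (ht : travel e₁ 1 + travel e₂ 1 ≤ t) : targetWave e₁ e₂ q W t = 0 := by
  have z : toL2 (fun _ => 0) = 0 := by
    refine Lp.ext ?_
    filter_upwards [toL2_ae_of_continuousOn continuousOn_const, Lp.coeFn_zero ℝ 2 unitMeasure]
      with x h1 h2
    rw [h1, h2, Pi.zero_apply]
  have w1 : wave W (fun x => travel e₁ 1 - travel e₁ x) t = 0 := by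
    rw [wave, ← z]
    refine toL2_congr fun x hx => hL _ ?_
    have := h₁.strictMono_travel.monotone hx.2
    linarith
  have w2 : wave W (fun x => travel e₁ 1 + travel e₂ x) t = 0 := by
    rw [wave, ← z]
    refine toL2_congr fun x hx => hL _ ?_
    have a := h₂.strictMono_travel.monotone hx.1
    have b := h₁.strictMono_travel.monotone (zero_le_one (α := ℝ))
    rw [IsSpeed.travel_zero] at a b
    linarith
  rw [targetWave, w1, w2, smul_zero]
  rfl

/-- The target system is solvable; its solutions are uniformly bounded and vanish in finite time. -/
theorem exists_isTargetSolution (h₁ : IsSpeed e₁) (h₂ : IsSpeed e₂) (hq : q ≠ 0) :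
    ∃ C : ℝ, 0 ≤ C ∧ ∀ z₀ : L2unit × L2unit, ∃ z, IsTargetSolution e₁ e₂ q z ∧ z 0 = z₀ ∧
      (∀ t, ‖z t‖ ≤ C * ‖z₀‖) ∧ ∀ t, travel e₁ 1 + travel e₂ 1 ≤ t → z t = 0 := by
  obtain ⟨C₁, hC₁, b1⟩ := exists_norm_wave_le (distortion_travel_sub h₁ (travel e₁ 1))
  obtain ⟨C₂, hC₂, b2⟩ := exists_norm_wave_le (distortion_travel_add h₂ (travel e₁ 1))
  obtain ⟨C, hC, b⟩ := exists_eLpNorm_profile_le (q := q) h₁ h₂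
  refine ⟨(|q| * C₁ + C₂) * C, by positivity, fun z₀ =>
    ⟨targetWave e₁ e₂ q (profile e₁ e₂ q z₀), ?_, targetWave_zero h₁ h₂ hq z₀, fun t => ?_,
      fun t ht => targetWave_eq_zero h₁ h₂ (fun s => profile_eq_zero h₁ h₂ z₀) ht⟩⟩
  · exact isTargetSolution_targetWave h₁ h₂ (stronglyMeasurable_profile h₁ h₂ z₀)
      (memLp_profile h₁ h₂ z₀) fun s => profile_eq_zero h₁ h₂ z₀
  · have hW := memLp_profile (q := q) h₁ h₂ z₀
    have n1 := (b1 _ hW t).trans (mul_le_mul_of_nonneg_left (b z₀) hC₁)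
    have n2 := (b2 _ hW t).trans (mul_le_mul_of_nonneg_left (b z₀) hC₂)
    have p1 : 0 ≤ |q| * (C₁ * (C * ‖z₀‖)) := by positivity
    have p2 : 0 ≤ C₂ * (C * ‖z₀‖) := by positivity
    refine max_le ?_ ?_
    · simp only [targetWave, norm_smul, Real.norm_eq_abs]
      linarith [mul_le_mul_of_nonneg_left n1 (abs_nonneg q)]
    · simp only [targetWave]
      linarith

end

/-! ### The closed loop -/

lemma stateNorm_eq (w : L2unit × L2unit) : stateNorm w.1 w.2 = √(‖w.1‖ ^ 2 + ‖w.2‖ ^ 2) := by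
  rw [stateNorm, ← real_inner_self_eq_norm_sq, ← real_inner_self_eq_norm_sq, inner_eq_integral,
    inner_eq_integral]
  refine congrArg _ (Eq.trans ?_ (integral_add ((Lp.memLp w.1).integrable_mul (Lp.memLp w.1))
    ((Lp.memLp w.2).integrable_mul (Lp.memLp w.2))))
  simp only [sq]

lemma norm_le_stateNorm (w : L2unit × L2unit) : ‖w‖ ≤ stateNorm w.1 w.2 := by
  rw [stateNorm_eq]
  exact max_le (Real.le_sqrt_of_sq_le (le_add_of_nonneg_right (sq_nonneg _)))
    (Real.le_sqrt_of_sq_le (le_add_of_nonneg_left (sq_nonneg _)))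

lemma stateNorm_le (w : L2unit × L2unit) : stateNorm w.1 w.2 ≤ 2 * ‖w‖ := by
  rw [stateNorm_eq]
  refine Real.sqrt_le_iff.2 ⟨by positivity, ?_⟩
  have h1 := pow_le_pow_left₀ (norm_nonneg _) (norm_fst_le w) 2
  have h2 := pow_le_pow_left₀ (norm_nonneg _) (norm_snd_le w) 2
  nlinarith [sq_nonneg ‖w‖]

section

variable {P : HyperbolicPlant} {K : KernelMatrix}

lemma finalTime_eq (hP : IsRegular P) : P.finalTime =
    travel (fun x => P.ε₁ (clamp x)) 1 + travel (fun x => P.ε₂ (clamp x)) 1 := by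
  rw [HyperbolicPlant.finalTime, travel, travel, ← intervalIntegral.integral_add
    (hP.speed₁.continuous_inv.intervalIntegrable _ _)
    (hP.speed₂.continuous_inv.intervalIntegrable _ _)]
  refine intervalIntegral.integral_congr fun x hx => ?_
  rw [uIcc_of_le zero_le_one] at hx
  simp only [clamp_of_mem hx, one_div]

/-- A path of states solves the closed loop iff its backstepping transform solves the target
system. -/
lemma isClosedLoopSolution_iff_isTargetSolution (hP : IsRegular P) (hK : P.IsBacksteppingKernel K)
    {u₀ v₀ : L2unit} {u v : ℝ → L2unit} :
    P.IsClosedLoopSolution K u₀ v₀ u v ↔ (u 0, v 0) = (u₀, v₀) ∧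
      IsTargetSolution (fun x => P.ε₁ (clamp x)) (fun x => P.ε₂ (clamp x)) P.q
        fun t => backOp K (u t, v t) := by
  rw [isClosedLoopSolution_iff hP hK]
  constructor
  · rintro ⟨hw, hi, h⟩
    exact ⟨hi, (backOp K).continuous.comp_continuousOn hw, h⟩
  · rintro ⟨hi, h⟩
    refine ⟨?_, hi, h.eqn⟩
    -- Continuity of the transformed path gives that of the original one through the bounded
    -- inverse.
    obtain ⟨T, hT⟩ := isUnit_backOp hK
    have hinv : ∀ w, (↑T⁻¹ : (L2unit × L2unit) →L[ℝ] (L2unit × L2unit)) (backOp K w) = w := fun w => by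
      rw [← hT]
      exact DFunLike.congr_fun T.inv_mul w
    refine ((↑T⁻¹ : (L2unit × L2unit) →L[ℝ] (L2unit × L2unit)).continuous.comp_continuousOn
      h.cont).congr fun t _ => ?_
    simp only [Function.comp_apply, hinv]

/-- Solvability, uniform boundedness and extinction in finite time of the closed loop. -/
theorem closedLoop (hP : IsRegular P) (hK : P.IsBacksteppingKernel K) :
    ∃ C : ℝ, 0 ≤ C ∧ ∀ u₀ v₀ : L2unit, ∃ u v : ℝ → L2unit, P.IsClosedLoopSolution K u₀ v₀ u v ∧
      (∀ u' v', P.IsClosedLoopSolution K u₀ v₀ u' v' → ∀ t, 0 ≤ t → u' t = u t ∧ v' t = v t) ∧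
      (∀ t, stateNorm (u t) (v t) ≤ C * stateNorm u₀ v₀) ∧
      ∀ t, P.finalTime ≤ t → u t = 0 ∧ v t = 0 := by
  obtain ⟨C, hC, hex⟩ := exists_isTargetSolution hP.speed₁ hP.speed₂ hP.q
  obtain ⟨T, hT⟩ := isUnit_backOp hK
  set S : (L2unit × L2unit) →L[ℝ] (L2unit × L2unit) := ↑T⁻¹ with hS
  have hST : ∀ w, S (backOp K w) = w := fun w => by
    rw [← hT]
    exact DFunLike.congr_fun T.inv_mul w
  have hTS : ∀ w, backOp K (S w) = w := fun w => by
    rw [← hT]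
    exact DFunLike.congr_fun T.mul_inv w
  -- The product carries the maximum norm: it is dominated by `stateNorm`, and `stateNorm` is at
  -- most twice it, whence the 2.
  refine ⟨2 * (‖S‖ * (C * ‖backOp K‖)), by positivity, fun u₀ v₀ => ?_⟩
  obtain ⟨z, hz, hz0, hzC, hzL⟩ := hex (backOp K (u₀, v₀))
  refine ⟨fun t => (S (z t)).1, fun t => (S (z t)).2, ?_, fun u' v' h t ht => ?_, fun t => ?_,
    fun t ht => ?_⟩
  · rw [isClosedLoopSolution_iff_isTargetSolution hP hK]
    refine ⟨by rw [Prod.mk.eta, hz0, hST], ?_⟩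
    simpa only [Prod.mk.eta, hTS] using hz
  · obtain ⟨hi, h'⟩ := (isClosedLoopSolution_iff_isTargetSolution hP hK).1 h
    have := (h'.sub hz).eq_zero hP.speed₁ hP.speed₂ hP.q (by simp only [hi, hz0, sub_self]) ht
    rw [sub_eq_zero] at this
    have h2 := congrArg S this
    rw [hST] at h2
    exact Prod.ext_iff.1 h2
  · calc stateNorm (S (z t)).1 (S (z t)).2 ≤ 2 * ‖S (z t)‖ := stateNorm_le _
      _ ≤ 2 * (‖S‖ * (C * (‖backOp K‖ * stateNorm u₀ v₀))) := by
          have h1 := (backOp K).le_of_opNorm_le_of_le le_rfl (norm_le_stateNorm (u₀, v₀))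
          have h2 := (hzC t).trans (mul_le_mul_of_nonneg_left h1 hC)
          exact mul_le_mul_of_nonneg_left (S.le_of_opNorm_le_of_le le_rfl h2) zero_le_two
      _ = _ := by ring
  · have : S (z t) = 0 := by rw [hzL t (by rwa [← finalTime_eq hP]), map_zero]
    exact Prod.ext_iff.1 this

/-- A uniformly bounded system that comes to rest in finite time decays at every exponential rate. -/
lemma decay_of_bound {C L lam b : ℝ} {n : ℝ → ℝ} (hC : 0 ≤ C) (hlam : 0 < lam) (hb : 0 ≤ b)
    (hn : ∀ t, n t ≤ C * b) (hL : ∀ t, L ≤ t → n t = 0) (t : ℝ) :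
    n t ≤ (C * Real.exp (lam * L) + 1) * Real.exp (-lam * t) * b := by
  rcases le_or_gt L t with h | h
  · rw [hL t h]; positivity
  · have h1 : 1 ≤ Real.exp (lam * L) * Real.exp (-lam * t) := by
      rw [← Real.exp_add, Real.one_le_exp_iff]
      nlinarith
    have h2 : 0 ≤ Real.exp (-lam * t) * b := by positivity
    calc n t ≤ C * b := hn t
      _ ≤ C * b * (Real.exp (lam * L) * Real.exp (-lam * t)) := le_mul_of_one_le_right (by positivity) h1
      _ ≤ C * b * (Real.exp (lam * L) * Real.exp (-lam * t)) + Real.exp (-lam * t) * b :=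
          le_add_of_nonneg_right h2
      _ = _ := by ring

end

end Backstepping

theorem mainTheorem2 (P : HyperbolicPlant)
    (hc₁ : ContinuousOn P.c₁ (Set.Icc 0 1)) (hc₂ : ContinuousOn P.c₂ (Set.Icc 0 1))
    (hε₁ : ContDiffOn ℝ 1 P.ε₁ (Set.Icc 0 1)) (hε₂ : ContDiffOn ℝ 1 P.ε₂ (Set.Icc 0 1))
    (hε₁_pos : ∀ x ∈ Set.Icc (0 : ℝ) 1, 0 < P.ε₁ x)
    (hε₂_pos : ∀ x ∈ Set.Icc (0 : ℝ) 1, 0 < P.ε₂ x)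
    (hq : P.q ≠ 0) :
    -- the kernel equations have exactly one continuous solution on the triangle
    (∃ K : KernelMatrix, P.IsBacksteppingKernel K ∧
      ∀ K' : KernelMatrix, P.IsBacksteppingKernel K' →
        ∀ x ξ : ℝ, (x, ξ) ∈ kernelTriangle →
          K'.uu x ξ = K.uu x ξ ∧ K'.uv x ξ = K.uv x ξ ∧
          K'.vu x ξ = K.vu x ξ ∧ K'.vv x ξ = K.vv x ξ) ∧
    ∀ K : KernelMatrix, P.IsBacksteppingKernel K →
      -- the closed loop has exactly one solution for every initial datum
      (∀ u₀ v₀ : L2unit, ∃ u v : ℝ → L2unit, P.IsClosedLoopSolution K u₀ v₀ u v ∧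
        ∀ u' v' : ℝ → L2unit, P.IsClosedLoopSolution K u₀ v₀ u' v' →
          ∀ t : ℝ, 0 ≤ t → u' t = u t ∧ v' t = v t) ∧
      -- exponential decay with arbitrary rate
      (∀ lam : ℝ, 0 < lam → ∃ c : ℝ, 0 < c ∧
        ∀ (u₀ v₀ : L2unit) (u v : ℝ → L2unit), P.IsClosedLoopSolution K u₀ v₀ u v →
          ∀ t : ℝ, 0 ≤ t →
            stateNorm (u t) (v t) ≤ c * Real.exp (-lam * t) * stateNorm u₀ v₀) ∧
      -- the zero state is reached in finite time
      (∀ (u₀ v₀ : L2unit) (u v : ℝ → L2unit), P.IsClosedLoopSolution K u₀ v₀ u v →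
        ∀ t : ℝ, P.finalTime ≤ t → u t = 0 ∧ v t = 0) := by
  have hP : Backstepping.IsRegular P := ⟨hc₁, hc₂, hε₁, hε₂, hε₁_pos, hε₂_pos, hq⟩
  refine ⟨Backstepping.existsUnique_kernel hP, fun K hK => ?_⟩
  obtain ⟨C, hC, h⟩ := Backstepping.closedLoop hP hK
  refine ⟨fun u₀ v₀ => ?_, fun lam hlam => ?_, fun u₀ v₀ u v huv t ht => ?_⟩
  · obtain ⟨u, v, huv, huniq, -⟩ := h u₀ v₀
    exact ⟨u, v, huv, huniq⟩
  -- Before the final time exp(λ t_F) compensates exp(-λ t), and afterwards the state is zero. The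
  -- added 1 keeps the constant positive when `C` is 0.
  · refine ⟨C * Real.exp (lam * P.finalTime) + 1, by positivity, fun u₀ v₀ u v huv t ht => ?_⟩
    obtain ⟨u', v', -, huniq, hbound, hzero⟩ := h u₀ v₀
    obtain ⟨h1, h2⟩ := huniq u v huv t ht
    rw [h1, h2]
    refine Backstepping.decay_of_bound (n := fun t => stateNorm (u' t) (v' t)) hC hlam
      (Real.sqrt_nonneg _) hbound (fun s hs => ?_) t
    obtain ⟨z1, z2⟩ := hzero s hs
    have := Backstepping.stateNorm_eq (u' s, v' s)
    simpa [z1, z2] using this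
  · obtain ⟨u', v', -, huniq, -, hzero⟩ := h u₀ v₀
    -- Solutions agree only at nonnegative times, so the final time has to be seen to be nonnegative
    -- before uniqueness can be used.
    have ht0 : 0 ≤ t := by
      refine le_trans ?_ ht
      refine intervalIntegral.integral_nonneg zero_le_one fun x hx => ?_
      have := hε₁_pos x hx
      have := hε₂_pos x hx
      positivity
    obtain ⟨h1, h2⟩ := huniq u v huv t ht0
    rw [h1, h2]
    exact hzero t ht
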